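/- **Proposition 3.2.** Let $\mathbb T=\mathbb R/2\pi\mathbb Z$. For a function $f$ on $\mathbb T\times\mathbb R$ let $\hat f(k,\xi)=\frac1{2\pi}\iint f(x,y)e^{-i(kx+\xi y)}\,dx\,dy$, $k\in\mathbb Z$, $\xi\in\mathbb R$, let $f_0(y)=\frac1{2\pi}\int_{\mathbb T}f(x,y)\,dx$ and $f_{\ne}=f-f_0$. A symbol $a(k,\xi)$ acts as the Fourier multiplier $\widehat{af}=a\hat f$; $(D_x,D_y)$ has symbol $(k,\xi)$, $\langle\partial_x\rangle$ has symbol $(1+k^2)^{1/2}$, and $\Lambda_t$ has symbol $(1+k^2+(\xi+tk)^2)^{1/2}$. *Multipliers.* Fix $\varphi\in C^\infty(\mathbb R)$ with $0\le\varphi\le1$, $0\le\varphi'\le\frac14$, $\varphi'=\frac14$ on $[-1,1]$, and $\mu\in[\frac23,1)$. For $\nu,\delta_0>0$ and $t\ge0$ put $$\mathcal M_1(k,\xi)=\varphi\big(\nu^{1/3}|k|^{-1/3}\mathrm{sgn}(k)\,\xi\big)\ (k\ne0),\qquad \mathcal M_1(0,\xi)=0,$$ $$\mathcal M_2(k,\xi)=\tfrac\pi2+\arctan\tfrac{\xi}{k}\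 \ (0<|k|\le\nu^{-1/2}),\qquad \mathcal M_2=0\ \text{ otherwise},$$ $$\mathcal M_3(t,k,\xi)=\sum_{l\in\mathbb Z\setminus\{0\}}\frac{|l|^\mu}{|l|^2}\Big(\mathrm{sgn}(l)\arctan\frac{\xi+t(k-l)}{1+|k-l|+|l|}+\frac\pi2\Big)\ \ (|k|\le\nu^{-1/2}),\qquad \mathcal M_3=0\ \text{ otherwise},$$ $$\mathcal M_t=e^{\delta_0\nu^{1/3}t\,\mathbf 1_{k\ne0}}\,(\mathcal M_1+\mathcal M_2+\mathcal M_3+1),\qquad \Upsilon_t(k,\xi)=\sum_{l\in\mathbb Z\setminus\{0\}}\frac{|l|^\mu}{|l|}\,\frac{1+|k-l|+|l|}{(1+|k-l|+|l|)^2+(\xi+t(k-l))^2}.$$ *The system.* For $\nu>0$ let $(\omega,\theta)$ be a real-valued solution, on a time interval $(0,T)$, of $$\partial_t\omega+y\partial_x\omega-\nu\Delta\omega+u\cdot\nabla\omega=\partial_x\theta,\qquad \partial_t\theta+y\partial_x\theta+u^1_0\,\partial_x\theta-\nu\Delta\theta=0,$$ where $u=(u^1,u^2)\in L^2$ is the velocity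 with $\operatorname{div}u=0$, $\partial_xu^2-\partial_yu^1=\omega$, and $u^1_0$ is the zero mode of $u^1$. The solution is regular for positive times: $\omega,\theta,u$ are $C^2$ in $(t,x,y)$ on $(0,T)\times\mathbb T\times\mathbb R$ and bounded in every $H^s(\mathbb T\times\mathbb R)$, uniformly on compact subsets of $(0,T)$. Put $$\mathcal{CK}(\omega)=\tfrac{\delta_0}2\Big(\nu\|(D_x,D_y)\sqrt{\mathcal M_t}\Lambda_t^m\omega\|_{L^2}^2+\nu^{1/3}\||D_x|^{1/3}\sqrt{\mathcal M_t}\Lambda_t^m\omega\|_{L^2}^2+\|\nabla\sqrt{\mathcal M_t}\Lambda_t^mu^2_{\ne}\|_{L^2}^2+\|\sqrt{\mathcal M_t\Upsilon_t}\Lambda_t^m\omega\|_{L^2}^2\Big),$$ $$\mathcal{CK}(\theta)=\tfrac{\delta_0}2\Big(\nu\|(D_x,D_y)\sqrt{\mathcal M_t}\Lambda_t^m\langle\partial_x\rangle^{m_1}\theta\|_{L^2}^2+\nu^{1/3}\||D_x|^{1/3}\sqrt{\mathcal M_t}\Lambda_t^m\langle\partial_x\rangle^{m_1}\theta\|_{L^2}^2\Big),$$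 and let $\mathcal{CK}(\theta_{\ne})$ be the same expression with $\theta_{\ne}$ in place of $\theta$. *Claim.* There is $\delta_{\max}>0$ (depending only on $\varphi,\mu$) such that for every $\delta_0\in(0,\delta_{\max}]$ and all real $m>2$, $m_1\ge1$ there are $\delta>0$ and $K_0>0$, independent of $\nu$, such that the following holds for all $K\ge K_0$, all $0<\nu\le1$, all solutions as above and all $t$ with $\nu^{-1/6}\le t<T$. If $$\|\sqrt{\mathcal M_t}\Lambda_t^m\omega(t)\|_{L^2}\le\delta\nu^{1/3}\quad\text{and}\quad\|\langle\partial_x\rangle^{m_1}\sqrt{\mathcal M_t}\Lambda_t^m\theta(t)\|_{L^2}\le\delta\nu^{2/3},$$ then the energies below are differentiable at $t$, and $$\frac{d}{dt}\Big(\|\sqrt{\mathcal M_t}\Lambda_t^m\omega\|_{L^2}^2+K\nu^{-2/3}\|\langle\partial_x\rangle^{m_1}\sqrt{\mathcal M_t}\Lambda_t^m\theta_{\ne}\|_{L^2}^2\Big)+\mathcal{CK}(\omega)+K\nu^{-2/3}\,\mathcal{CK}(\theta_{\ne})\le0,$$ $$\frac{d}{dt}\Big(\|\sqrt{\mathcal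 M_t}\Lambda_t^m\omega\|_{L^2}^2+K\nu^{-2/3}\|\langle\partial_x\rangle^{m_1}\sqrt{\mathcal M_t}\Lambda_t^m\theta\|_{L^2}^2\Big)+\mathcal{CK}(\omega)+K\nu^{-2/3}\,\mathcal{CK}(\theta)\le0.$$ -/

import Mathlib

open MeasureTheory Set

namespace Boussinesq

noncomputable section

/-! ## Fourier analysis on `𝕋 × ℝ`, with `𝕋 = ℝ / 2πℤ`

A function on `𝕋 × ℝ` is a function `f x y` of two real variables that is `2π`-periodic in `x`.
Frequencies are pairs `p = (k, ξ)` in `ℤ × ℝ`. -/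

/-- Counting measure in `k` times Lebesgue measure in `ξ`. -/
def freqMeasure : Measure (ℤ × ℝ) := (Measure.count : Measure ℤ).prod (volume : Measure ℝ)

/-- `f` belongs to `H^s(𝕋 × ℝ)` for every `s` and `F` is its Fourier transform, normalized as
`F (k, ξ) = (2π)⁻¹ ∫∫ f(x, y) e^{-i(kx + ξy)} dx dy`, so that Plancherel's formula reads
`‖f‖²_{L²} = ∑_k ∫ |F (k, ξ)|² dξ`. The last clause is the inversion formula (the integral
converges absolutely by the second clause); it determines `F` almost everywhere and makes `f`
`2π`-periodic in `x`. -/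
structure IsFourierTransform (f : ℝ → ℝ → ℝ) (F : ℤ × ℝ → ℂ) : Prop where
  aestronglyMeasurable : AEStronglyMeasurable F freqMeasure
  sobolev : ∀ s : ℕ,
    Integrable (fun p : ℤ × ℝ => (1 + (p.1 : ℝ) ^ 2 + p.2 ^ 2) ^ s * ‖F p‖ ^ 2) freqMeasure
  inversion : ∀ x y : ℝ, (f x y : ℂ) = ((2 * Real.pi : ℝ) : ℂ)⁻¹ *
    ∫ p : ℤ × ℝ, F p * Complex.exp (Complex.I * (((p.1 : ℝ) * x + p.2 * y : ℝ) : ℂ)) ∂freqMeasure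

/-- The time-dependent function `f t x y` is of class `C²` on `(0, T) × 𝕋 × ℝ`, is bounded in every
Sobolev space `H^s(𝕋 × ℝ)` uniformly on compact subintervals of `(0, T)`, and has the spatial
Fourier transform `F t` at each time `t`. -/
structure IsRegular (T : ℝ) (f : ℝ → ℝ → ℝ → ℝ) (F : ℝ → ℤ × ℝ → ℂ) : Prop where
  contDiffOn : ContDiffOn ℝ 2 (fun q : ℝ × ℝ × ℝ => f q.1 q.2.1 q.2.2) (Ioo 0 T ×ˢ univ)
  fourier : ∀ t ∈ Ioo 0 T, IsFourierTransform (f t) (F t)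
  locallyBounded : ∀ a b : ℝ, 0 < a → b < T → ∀ s : ℕ, ∃ C : ℝ, ∀ t ∈ Icc a b,
    ∫ p : ℤ × ℝ, (1 + (p.1 : ℝ) ^ 2 + p.2 ^ 2) ^ s * ‖F t p‖ ^ 2 ∂freqMeasure ≤ C

/-- The `L²` norm `‖a(D) f‖_{L²}` of the Fourier multiplier with symbol `a`, applied to the function
with Fourier transform `F`. -/
def mulNorm (a : ℤ × ℝ → ℝ) (F : ℤ × ℝ → ℂ) : ℝ :=
  Real.sqrt (∫ p : ℤ × ℝ, (a p) ^ 2 * ‖F p‖ ^ 2 ∂freqMeasure)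

/-- Fourier transform of the nonzero-mode part `f_≠ = f - f₀`. -/
def nonzeroMode (F : ℤ × ℝ → ℂ) : ℤ × ℝ → ℂ := fun p => if p.1 = 0 then 0 else F p

/-- The zero mode `f₀(y) = (2π)⁻¹ ∫_𝕋 f(x, y) dx`. -/
def zeroMode (f : ℝ → ℝ → ℝ) (y : ℝ) : ℝ := (2 * Real.pi)⁻¹ * ∫ x in (0 : ℝ)..(2 * Real.pi), f x y

/-! ## The system -/

/-- `∂ₓ f`. -/
def dx (f : ℝ → ℝ → ℝ) (x y : ℝ) : ℝ := deriv (fun x' => f x' y) x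

/-- `∂_y f`. -/
def dy (f : ℝ → ℝ → ℝ) (x y : ℝ) : ℝ := deriv (fun y' => f x y') y

/-- `∂ₜ f`. -/
def dt (f : ℝ → ℝ → ℝ → ℝ) (t x y : ℝ) : ℝ := deriv (fun s => f s x y) t

/-- `Δ f`. -/
def lap (f : ℝ → ℝ → ℝ) (x y : ℝ) : ℝ := dx (dx f) x y + dy (dy f) x y

/-- `(ω, θ)` with velocity `u = (u₁, u₂)` is a smooth solution on `(0, T) × 𝕋 × ℝ` of
`∂ₜω + y ∂ₓω - νΔω + u·∇ω = ∂ₓθ`, `∂ₜθ + y ∂ₓθ + (u₁)₀ ∂ₓθ - νΔθ = 0`,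
and `ωh, θh, u₁h, u₂h` are the spatial Fourier transforms. The velocity is the finite energy field
`u = ∇^⊥ Δ⁻¹ ω`, that is, the square integrable field with `div u = 0` and
`∂ₓu₂ - ∂_y u₁ = ω`. The evolution equation of the zero mode `(u₁)₀` is the integral in `y` of the
zero mode of the vorticity equation, and initial data are not needed, so neither is required. -/
structure IsSolution (ν T : ℝ) (ω θ u₁ u₂ : ℝ → ℝ → ℝ → ℝ)
    (ωh θh u₁h u₂h : ℝ → ℤ × ℝ → ℂ) : Prop where
  regular_ω : IsRegular T ω ωh
  regular_θ : IsRegular T θ θh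
  regular_u₁ : IsRegular T u₁ u₁h
  regular_u₂ : IsRegular T u₂ u₂h
  div_free : ∀ t ∈ Ioo 0 T, ∀ x y, dx (u₁ t) x y + dy (u₂ t) x y = 0
  curl : ∀ t ∈ Ioo 0 T, ∀ x y, ω t x y = dx (u₂ t) x y - dy (u₁ t) x y
  vorticity : ∀ t ∈ Ioo 0 T, ∀ x y,
    dt ω t x y + y * dx (ω t) x y - ν * lap (ω t) x y
      + (u₁ t x y * dx (ω t) x y + u₂ t x y * dy (ω t) x y) = dx (θ t) x y
  temperature : ∀ t ∈ Ioo 0 T, ∀ x y,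
    dt θ t x y + y * dx (θ t) x y + zeroMode (u₁ t) y * dx (θ t) x y - ν * lap (θ t) x y = 0

/-! ## The multipliers -/

/-- The cut-off profile: smooth, `0 ≤ φ ≤ 1`, `0 ≤ φ' ≤ 1/4`, and `φ' = 1/4` on `[-1, 1]`. -/
structure IsProfile (φ : ℝ → ℝ) : Prop where
  smooth : ContDiff ℝ (⊤ : ℕ∞) φ
  range : ∀ x, 0 ≤ φ x ∧ φ x ≤ 1
  deriv_range : ∀ x, 0 ≤ deriv φ x ∧ deriv φ x ≤ 1 / 4
  deriv_eq : ∀ x ∈ Icc (-1 : ℝ) 1, deriv φ x = 1 / 4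

/-- `Λ_t(k, ξ) = (1 + k² + (ξ + tk)²)^{1/2}`. -/
def Lam (t : ℝ) (p : ℤ × ℝ) : ℝ := Real.sqrt (1 + (p.1 : ℝ) ^ 2 + (p.2 + t * p.1) ^ 2)

/-- Symbol of `⟨∂ₓ⟩`. -/
def angX (p : ℤ × ℝ) : ℝ := Real.sqrt (1 + (p.1 : ℝ) ^ 2)

/-- Symbol of the length of `(D_x, D_y)`. -/
def absD (p : ℤ × ℝ) : ℝ := Real.sqrt ((p.1 : ℝ) ^ 2 + p.2 ^ 2)

/-- Symbol of `|D_x|^{1/3}`. -/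
def absDxThird (p : ℤ × ℝ) : ℝ := |(p.1 : ℝ)| ^ (1 / 3 : ℝ)

/-- `φ(ν^{1/3} |k|^{-1/3} sgn(k) ξ)` for `k ≠ 0`, and `0` for `k = 0`. -/
def M₁ (φ : ℝ → ℝ) (ν : ℝ) (p : ℤ × ℝ) : ℝ :=
  if p.1 = 0 then 0
  else φ (ν ^ (1 / 3 : ℝ) * |(p.1 : ℝ)| ^ (-(1 / 3) : ℝ) * Real.sign p.1 * p.2)

/-- `π/2 + arctan(ξ/k)` for `0 < |k| ≤ ν^{-1/2}`, and `0` otherwise. -/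
def M₂ (ν : ℝ) (p : ℤ × ℝ) : ℝ :=
  if p.1 ≠ 0 ∧ |(p.1 : ℝ)| ≤ ν ^ (-(1 / 2) : ℝ) then Real.pi / 2 + Real.arctan (p.2 / p.1) else 0

/-- `∑_{l ≠ 0} |l|^{μ-2} (sgn(l) arctan((ξ + t(k-l)) / (1 + |k-l| + |l|)) + π/2)` for
`|k| ≤ ν^{-1/2}`, and `0` otherwise. -/
def M₃ (μ ν t : ℝ) (p : ℤ × ℝ) : ℝ :=
  if |(p.1 : ℝ)| ≤ ν ^ (-(1 / 2) : ℝ) then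
    ∑' l : ℤ, if l = 0 then 0 else
      |(l : ℝ)| ^ μ / |(l : ℝ)| ^ 2 *
        (Real.sign l *
          Real.arctan ((p.2 + t * ((p.1 : ℝ) - l)) / (1 + |(p.1 : ℝ) - l| + |(l : ℝ)|))
          + Real.pi / 2)
  else 0

/-- `𝓜 = e^{δ₀ ν^{1/3} t} (M₁ + M₂ + M₃ + 1)` on the nonzero modes, and `M₁ + M₂ + M₃ + 1` on the
zero mode, which has no enhanced dissipation. -/
def M (φ : ℝ → ℝ) (μ δ₀ ν t : ℝ) (p : ℤ × ℝ) : ℝ :=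
  Real.exp (if p.1 = 0 then 0 else δ₀ * ν ^ (1 / 3 : ℝ) * t) *
    (M₁ φ ν p + M₂ ν p + M₃ μ ν t p + 1)

/-- `Υ(t, k, ξ) = ∑_{l ≠ 0} |l|^{μ-1} (1 + |k-l| + |l|) / ((1 + |k-l| + |l|)² + (ξ + t(k-l))²)`. -/
def Upsilon (μ t : ℝ) (p : ℤ × ℝ) : ℝ :=
  ∑' l : ℤ, if l = 0 then 0 else
    |(l : ℝ)| ^ μ / |(l : ℝ)| *
      ((1 + |(p.1 : ℝ) - l| + |(l : ℝ)|) /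
        ((1 + |(p.1 : ℝ) - l| + |(l : ℝ)|) ^ 2 + (p.2 + t * ((p.1 : ℝ) - l)) ^ 2))

/-- Symbol of `√𝓜_t Λ_t^m`. -/
def wt (φ : ℝ → ℝ) (μ δ₀ ν m t : ℝ) (p : ℤ × ℝ) : ℝ :=
  Real.sqrt (M φ μ δ₀ ν t p) * Lam t p ^ m

/-- Symbol of `⟨∂ₓ⟩^{m₁} √𝓜_t Λ_t^m`. -/
def wtX (φ : ℝ → ℝ) (μ δ₀ ν m m₁ t : ℝ) (p : ℤ × ℝ) : ℝ :=
  angX p ^ m₁ * wt φ μ δ₀ ν m t p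

/-! ## The energy and the dissipation functionals -/

/-- `‖√𝓜_t Λ_t^m f‖² + K ν^{-2/3} ‖⟨∂ₓ⟩^{m₁} √𝓜_t Λ_t^m g‖²`, where `F`, `G` are the Fourier transforms
of `f`, `g`. -/
def energy (φ : ℝ → ℝ) (μ δ₀ ν m m₁ K t : ℝ) (F G : ℤ × ℝ → ℂ) : ℝ :=
  mulNorm (wt φ μ δ₀ ν m t) F ^ 2
    + K * ν ^ (-(2 / 3) : ℝ) * mulNorm (wtX φ μ δ₀ ν m m₁ t) G ^ 2

/-- `𝓒𝓚(ω)`, in terms of the Fourier transforms `W` of `ω` and `U₂` of `u₂`. -/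
def CKω (φ : ℝ → ℝ) (μ δ₀ ν m t : ℝ) (W U₂ : ℤ × ℝ → ℂ) : ℝ :=
  δ₀ / 2 *
    (ν * mulNorm (fun p => absD p * wt φ μ δ₀ ν m t p) W ^ 2
      + ν ^ (1 / 3 : ℝ) * mulNorm (fun p => absDxThird p * wt φ μ δ₀ ν m t p) W ^ 2
      + mulNorm (fun p => absD p * wt φ μ δ₀ ν m t p) (nonzeroMode U₂) ^ 2
      + mulNorm (fun p => Real.sqrt (Upsilon μ t p) * wt φ μ δ₀ ν m t p) W ^ 2)

/-- `𝓒𝓚(θ)`, in terms of the Fourier transform `G` of `θ`. -/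
def CKθ (φ : ℝ → ℝ) (μ δ₀ ν m m₁ t : ℝ) (G : ℤ × ℝ → ℂ) : ℝ :=
  δ₀ / 2 *
    (ν * mulNorm (fun p => absD p * wtX φ μ δ₀ ν m m₁ t p) G ^ 2
      + ν ^ (1 / 3 : ℝ) * mulNorm (fun p => absDxThird p * wtX φ μ δ₀ ν m m₁ t p) G ^ 2)

end

end Boussinesq

/-!
Everything is done in Fourier variables. A solution of `∂ₜf + y∂ₓf - νΔf = r` has, in the frame that
moves with the Couette flow, a Fourier transform that is constant in time up to `νΔf + r`, and the
symbol `Λ_t` does not depend on time in this frame. The energy is therefore differentiable, and its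
derivative is made of the derivative of `𝓜` along the characteristics, the viscous term and the
contribution of `r` (`hasDerivAt_integral_transport`, `hasDerivAt_weighted_energy`). No continuity in
time of `r` with values in `L²` is available. It is not needed: a curve in a Hilbert space that is
differentiable with bounded derivative when tested against a total family is Lipschitz and weakly
differentiable, and this suffices for the quadratic energy (`hasDerivAt_integral_weight_mul_sq`).

The multiplier `𝓜` is built so that it decreases along the characteristics. With viscosity this yields
a dissipation with the symbol `dissip = ν|D|² + ν^{1/3}|k|^{2/3} + k²/|D|² + Υ`, up to the constant
`coer μ` (`coercivity`). The three last terms are the enhanced dissipation, the inviscid damping of the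
velocity and the suppression of echoes. The growth rate `δ₀ν^{1/3}` is absorbed when `δ₀ ≤ coer μ`, and
`𝓒𝓚` is at most `δ₀/2` times the dissipation (`IsSolution.CKω_eq`, `CKθ_le`).

It remains to bound the interactions by `ν^{-1/3}` times the norm of the vorticity times the dissipation.
* For the nonzero modes of the velocity, the symbol of the transport is bounded pointwise by a product of
  two square roots of the dissipation, taken at two of the three frequencies `b`, `c`, `b + c`, and a
  kernel (`wt_mul_advSymbol_le`). If the velocity has the lower frequency, inviscid damping at times
  `t ≥ ν^{-1/6}` supplies the small factor (`advSymbol_le_of_low`). If it has the higher frequency, the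
  critical interactions are the echoes, for which one term of the series `Υ` at the outgoing frequency
  pays (`echo_bound`, `advSymbol_le_of_high`).
* The transport by the zero mode `(u₁)₀` is antisymmetric, so that only the difference of the squared
  weights at the two frequencies enters. Its derivative in `ξ` is of lower order (`wt_sq_sub_le`).
* The kernels are sums of `Λ_t^{1-m}` at one frequency, which is square integrable for `m > 2`, and a term
  of mixed type from the echoes. The Cauchy-Schwarz inequality then gives the trilinear bounds
  `nonzero_transport_le` and `zero_transport_le`.

Smallness of the vorticity, `‖√𝓜 Λ^m ω‖ ≤ δν^{1/3}`, turns these bounds into a small multiple of the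
dissipation. The buoyancy `∂ₓθ` loses a derivative in `x` and a factor `ν^{-1/3}` against the enhanced
dissipation, which is what the weight `⟨∂ₓ⟩^{m₁}` and the factor `Kν^{-2/3}` provide (`buoyancy_le`).
The same argument applies to `θ` and to its nonzero modes, which satisfy the same equation
(`IsSolution.energy_le`).
-/

open scoped ENNReal

namespace Boussinesq

/-! ### Frequency space -/

instance : SigmaFinite freqMeasure := by unfold freqMeasure; infer_instance

instance : Measure.IsAddLeftInvariant freqMeasure := by unfold freqMeasure; infer_instance

instance : Measure.IsNegInvariant (Measure.count : Measure ℤ) := by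
  refine ⟨Measure.ext fun s hs => ?_⟩
  rw [Measure.neg, Measure.map_apply measurable_neg hs]
  simp only [Set.neg_preimage]
  rw [Measure.count_apply (by measurability), Measure.count_apply hs]
  simp [Set.encard_neg]

instance : Measure.IsNegInvariant freqMeasure :=
  ⟨((Measure.measurePreserving_neg (Measure.count : Measure ℤ)).prod
    (Measure.measurePreserving_neg (volume : Measure ℝ))).map_eq⟩

theorem measurable_of_continuous_section {β : Type*} [MeasurableSpace β] [TopologicalSpace β]
    [BorelSpace β] {f : ℤ × ℝ → β} (h : ∀ k, Continuous fun ξ => f (k, ξ)) : Measurable f :=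
  measurable_from_prod_countable_right fun k => (h k).measurable

theorem lintegral_freq {f : ℤ × ℝ → ℝ≥0∞} (hf : AEMeasurable f freqMeasure) :
    ∫⁻ p, f p ∂freqMeasure = ∑' k : ℤ, ∫⁻ ξ : ℝ, f (k, ξ) := by
  unfold freqMeasure at *
  rw [lintegral_prod _ hf, lintegral_count]

/-- The Japanese bracket squared, `1 + k² + ξ²`. -/
noncomputable def bracket (p : ℤ × ℝ) : ℝ := 1 + (p.1 : ℝ) ^ 2 + p.2 ^ 2

theorem one_le_bracket (p : ℤ × ℝ) : 1 ≤ bracket p := by unfold bracket; nlinarith [sq_nonneg (p.1 : ℝ), sq_nonneg p.2]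
theorem bracket_pos (p : ℤ × ℝ) : 0 < bracket p := by unfold bracket; positivity

theorem measurable_bracket : Measurable bracket :=
  measurable_of_continuous_section fun k => by unfold bracket; fun_prop

/-- Peetre's inequality. -/
theorem bracket_le_mul (a b : ℤ × ℝ) : bracket a ≤ 2 * (bracket b * bracket (a - b)) := by
  unfold bracket
  simp only [Prod.fst_sub, Prod.snd_sub, Int.cast_sub]
  nlinarith [sq_nonneg ((b.1 : ℝ) - (a.1 - b.1)), sq_nonneg (b.2 - (a.2 - b.2)),
    mul_nonneg (add_nonneg (sq_nonneg (b.1 : ℝ)) (sq_nonneg b.2))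
      (add_nonneg (sq_nonneg ((a.1 : ℝ) - b.1)) (sq_nonneg (a.2 - b.2)))]

theorem lintegral_bracket_rpow_lt_top {q : ℝ} (hq : 1 < q) :
    ∫⁻ p, ENNReal.ofReal (bracket p ^ (-q)) ∂freqMeasure < ∞ := by
  have hle : ∀ p : ℤ × ℝ, ENNReal.ofReal (bracket p ^ (-q)) ≤
      ENNReal.ofReal ((1 + (p.1 : ℝ) ^ 2) ^ (-q / 2)) *
        ENNReal.ofReal ((1 + ‖p.2‖ ^ 2) ^ (-q / 2)) := by
    intro p
    rw [← ENNReal.ofReal_mul (by positivity)]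
    apply ENNReal.ofReal_le_ofReal
    have hx : (0 : ℝ) < 1 + (p.1 : ℝ) ^ 2 := by positivity
    have hy : (0 : ℝ) < 1 + ‖p.2‖ ^ 2 := by positivity
    rw [← Real.mul_rpow hx.le hy.le]
    have h1 : bracket p ^ (-q) = (bracket p ^ 2) ^ (-q / 2) := by
      rw [← Real.rpow_natCast, ← Real.rpow_mul (bracket_pos p).le]; congr 1; push_cast; ring
    rw [h1]
    apply Real.rpow_le_rpow_of_nonpos (by positivity)
    · unfold bracket; rw [Real.norm_eq_abs, sq_abs]; nlinarith [sq_nonneg (p.1 : ℝ), sq_nonneg p.2,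
        mul_nonneg (sq_nonneg (p.1 : ℝ)) (sq_nonneg p.2), sq_nonneg ((p.1 : ℝ)^2), sq_nonneg (p.2^2)]
    · linarith
  refine (lintegral_mono hle).trans_lt ?_
  unfold freqMeasure
  rw [lintegral_prod_mul (f := fun k : ℤ => ENNReal.ofReal ((1 + (k : ℝ) ^ 2) ^ (-q / 2)))
    (g := fun x : ℝ => ENNReal.ofReal ((1 + ‖x‖ ^ 2) ^ (-q / 2))) (by fun_prop) (by fun_prop)]
  refine ENNReal.mul_lt_top ?_ ?_
  · rw [lintegral_count]
    refine lt_top_iff_ne_top.2 (Summable.tsum_ofReal_ne_top ?_)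
    have hs : Summable fun k : ℤ => |(k : ℝ)| ^ (-q) + if k = 0 then (1 : ℝ) else 0 :=
      (Real.summable_abs_int_rpow hq).add (summable_of_ne_finset_zero (s := {0}) (by
        intro b hb; simp at hb; simp [hb]))
    refine hs.of_nonneg_of_le (fun k => by positivity) fun k => ?_
    by_cases hk : k = 0
    · subst hk; simp [Real.zero_rpow (show -q ≠ 0 by linarith)]
    · have hk' : (0 : ℝ) < |(k : ℝ)| := by positivity
      simp only [hk, if_false, add_zero]
      have h1 : |(k : ℝ)| ^ (-q) = (|(k : ℝ)| ^ 2) ^ (-q / 2) := by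
        rw [← Real.rpow_natCast, ← Real.rpow_mul hk'.le]; congr 1; push_cast; ring
      rw [h1]
      apply Real.rpow_le_rpow_of_nonpos (by positivity)
      · rw [sq_abs]; linarith
      · linarith
  · have := (integrable_rpow_neg_one_add_norm_sq (E := ℝ) (μ := volume) (r := q) (by simpa using hq))
    have h2 := this.lintegral_lt_top
    exact h2

/-! ### Cauchy-Schwarz -/

theorem sq_lintegral_mul_le {α : Type*} [MeasurableSpace α] {ν : Measure α} {f g : α → ℝ≥0∞}
    (hf : AEMeasurable f ν) (hg : AEMeasurable g ν) :
    (∫⁻ x, f x * g x ∂ν) ^ 2 ≤ (∫⁻ x, f x ^ 2 ∂ν) * ∫⁻ x, g x ^ 2 ∂ν := by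
  have h := ENNReal.lintegral_mul_le_Lp_mul_Lq ν Real.HolderConjugate.two_two hf hg
  simp only [Pi.mul_apply] at h
  calc (∫⁻ x, f x * g x ∂ν) ^ 2 ≤ ((∫⁻ x, f x ^ (2 : ℝ) ∂ν) ^ (1 / 2 : ℝ) *
        (∫⁻ x, g x ^ (2 : ℝ) ∂ν) ^ (1 / 2 : ℝ)) ^ 2 := by gcongr
    _ = _ := by
      rw [mul_pow, ← ENNReal.rpow_natCast, ← ENNReal.rpow_natCast, ← ENNReal.rpow_mul,
        ← ENNReal.rpow_mul]
      norm_num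

/-- The Cauchy-Schwarz inequality for the measure with density `f`. -/
theorem sq_lintegral_mul_le' {α : Type*} [MeasurableSpace α] {ν : Measure α} {f g : α → ℝ≥0∞}
    (hf : AEMeasurable f ν) (hg : AEMeasurable g ν) :
    (∫⁻ x, f x * g x ∂ν) ^ 2 ≤ (∫⁻ x, f x ∂ν) * ∫⁻ x, f x * g x ^ 2 ∂ν := by
  have key : ∀ y : ℝ≥0∞, y ^ (1 / 2 : ℝ) * y ^ (1 / 2 : ℝ) = y := fun y => by
    rw [← ENNReal.rpow_add_of_nonneg _ _ (by norm_num) (by norm_num)]; norm_num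
  have h := sq_lintegral_mul_le (f := fun x => f x ^ (1 / 2 : ℝ))
    (g := fun x => f x ^ (1 / 2 : ℝ) * g x) (hf.pow_const _) ((hf.pow_const _).mul hg)
  simpa only [← mul_assoc, key, mul_pow, sq (_ ^ (1 / 2 : ℝ)), ← sq] using h

/-! ### Rapidly decaying families -/

/-- `∫ ⟨p⟩^{2s} |F|²`, the square of the `H^s` norm of the function with Fourier transform `F`. -/
noncomputable def sobolevE (s : ℕ) (F : ℤ × ℝ → ℂ) : ℝ≥0∞ :=
  ∫⁻ p, ENNReal.ofReal (bracket p ^ s) * ‖F p‖ₑ ^ 2 ∂freqMeasure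

/-- A family of functions on frequency space that is bounded in every weighted `L²` space,
uniformly over the parameter set `I`. -/
structure RapidOn {ι : Type*} (I : Set ι) (F : ι → ℤ × ℝ → ℂ) : Prop where
  aestronglyMeasurable : ∀ t ∈ I, AEStronglyMeasurable (F t) freqMeasure
  bounded : ∀ s : ℕ, ∃ C : NNReal, ∀ t ∈ I, sobolevE s (F t) ≤ C

/-- A single function that lies in every weighted `L²` space. -/
abbrev Rapid (F : ℤ × ℝ → ℂ) : Prop := RapidOn (univ : Set Unit) fun _ => F

section
variable {ι : Type*} {I : Set ι} {F G : ι → ℤ × ℝ → ℂ}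

theorem RapidOn.rapid (h : RapidOn I F) {t : ι} (ht : t ∈ I) : Rapid (F t) :=
  ⟨fun _ _ => h.1 t ht, fun s => let ⟨C, hC⟩ := h.2 s; ⟨C, fun _ _ => hC t ht⟩⟩

theorem RapidOn.add (hF : RapidOn I F) (hG : RapidOn I G) :
    RapidOn I fun t p => F t p + G t p := by
  refine ⟨fun t ht => (hF.1 t ht).add (hG.1 t ht), fun s => ?_⟩
  obtain ⟨C, hC⟩ := hF.2 s
  obtain ⟨C', hC'⟩ := hG.2 s
  refine ⟨2 * C + 2 * C', fun t ht => ?_⟩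
  have hm : AEMeasurable (fun p => ENNReal.ofReal (bracket p ^ s) * ‖F t p‖ₑ ^ 2) freqMeasure :=
    (((measurable_bracket.pow_const s).ennreal_ofReal).aemeasurable).mul
      ((hF.1 t ht).enorm.pow_const 2)
  calc sobolevE s (fun p => F t p + G t p)
      ≤ ∫⁻ p, (2 * (ENNReal.ofReal (bracket p ^ s) * ‖F t p‖ₑ ^ 2) +
        2 * (ENNReal.ofReal (bracket p ^ s) * ‖G t p‖ₑ ^ 2)) ∂freqMeasure := by
        refine lintegral_mono fun p => ?_
        have h1 : ‖F t p + G t p‖ₑ ^ 2 ≤ 2 * ‖F t p‖ₑ ^ 2 + 2 * ‖G t p‖ₑ ^ 2 := by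
          calc ‖F t p + G t p‖ₑ ^ 2 ≤ (‖F t p‖ₑ + ‖G t p‖ₑ) ^ 2 := by gcongr; exact enorm_add_le _ _
            _ ≤ _ := by
              have h := ENNReal.rpow_add_le_mul_rpow_add_rpow ‖F t p‖ₑ ‖G t p‖ₑ (p := 2) (by norm_num)
              norm_num [ENNReal.rpow_ofNat, mul_add] at h
              exact h
        calc _ ≤ ENNReal.ofReal (bracket p ^ s) * (2 * ‖F t p‖ₑ ^ 2 + 2 * ‖G t p‖ₑ ^ 2) := by gcongr
          _ = _ := by ring
    _ = 2 * sobolevE s (F t) + 2 * sobolevE s (G t) := by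
        rw [lintegral_add_left' (hm.const_mul 2), lintegral_const_mul' _ _ (by norm_num),
          lintegral_const_mul' _ _ (by norm_num)]; rfl
    _ ≤ _ := by push_cast; gcongr <;> [exact hC t ht; exact hC' t ht]

theorem RapidOn.mul_poly (hF : RapidOn I F) {m : ι → ℤ × ℝ → ℂ}
    (hm : ∀ t ∈ I, AEStronglyMeasurable (m t) freqMeasure)
    (hb : ∃ (C : ℝ) (j : ℕ), ∀ t ∈ I, ∀ p, ‖m t p‖ ≤ C * bracket p ^ j) :
    RapidOn I fun t p => m t p * F t p := by
  obtain ⟨C, j, hb⟩ := hb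
  refine ⟨fun t ht => (hm t ht).mul (hF.1 t ht), fun s => ?_⟩
  obtain ⟨C', hC'⟩ := hF.2 (s + 2 * j)
  refine ⟨(C ^ 2).toNNReal * C', fun t ht => ?_⟩
  calc sobolevE s (fun p => m t p * F t p)
      ≤ ∫⁻ p, ENNReal.ofReal (C ^ 2) *
          (ENNReal.ofReal (bracket p ^ (s + 2 * j)) * ‖F t p‖ₑ ^ 2) ∂freqMeasure := by
        refine lintegral_mono fun p => ?_
        have h1 : ‖m t p‖ₑ ^ 2 ≤ ENNReal.ofReal (C ^ 2 * bracket p ^ (2 * j)) := by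
          rw [← ofReal_norm, ← ENNReal.ofReal_pow (norm_nonneg _)]
          apply ENNReal.ofReal_le_ofReal
          calc ‖m t p‖ ^ 2 ≤ (C * bracket p ^ j) ^ 2 := by gcongr; exact hb t ht p
            _ = _ := by ring
        have hJ := (bracket_pos p).le
        calc ENNReal.ofReal (bracket p ^ s) * ‖m t p * F t p‖ₑ ^ 2
            = ENNReal.ofReal (bracket p ^ s) * (‖m t p‖ₑ ^ 2 * ‖F t p‖ₑ ^ 2) := by
              rw [enorm_mul, mul_pow]
          _ ≤ ENNReal.ofReal (bracket p ^ s) *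
              (ENNReal.ofReal (C ^ 2 * bracket p ^ (2 * j)) * ‖F t p‖ₑ ^ 2) := by gcongr
          _ = _ := by
              rw [ENNReal.ofReal_mul (by positivity), pow_add, ENNReal.ofReal_mul (by positivity)]
              ring
    _ = ENNReal.ofReal (C ^ 2) * sobolevE (s + 2 * j) (F t) := by
        rw [lintegral_const_mul' _ _ ENNReal.ofReal_ne_top]; rfl
    _ ≤ _ := by push_cast; gcongr; exacts [le_rfl, hC' t ht]

/-- Weighted `L¹` norms are controlled by weighted `L²` norms. -/
theorem RapidOn.weighted_l1 (hF : RapidOn I F) (s : ℕ) : ∃ C : NNReal, ∀ t ∈ I,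
    ∫⁻ p, ENNReal.ofReal (bracket p ^ s) * ‖F t p‖ₑ ∂freqMeasure ≤ C := by
  obtain ⟨C, hC⟩ := hF.2 (2 * s + 2)
  have hfin := (lintegral_bracket_rpow_lt_top (q := 2) (by norm_num)).ne
  refine ⟨(∫⁻ p, ENNReal.ofReal (bracket p ^ (-2 : ℝ)) ∂freqMeasure).toNNReal + C, fun t ht => ?_⟩
  rw [ENNReal.coe_add, ENNReal.coe_toNNReal hfin]
  refine le_trans ?_ (add_le_add le_rfl (hC t ht))
  unfold sobolevE
  rw [← lintegral_add_left (measurable_bracket.pow_const _).ennreal_ofReal]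
  refine lintegral_mono fun p => ?_
  have hJ := bracket_pos p
  rw [← ofReal_norm, ← ENNReal.ofReal_pow (norm_nonneg _),
    ← ENNReal.ofReal_mul (by positivity), ← ENNReal.ofReal_mul (by positivity),
    ← ENNReal.ofReal_add (by positivity) (by positivity)]
  apply ENNReal.ofReal_le_ofReal
  have h1 : bracket p ^ s * ‖F t p‖ = (bracket p)⁻¹ * (bracket p ^ (s + 1) * ‖F t p‖) := by
    rw [pow_succ]; field_simp
  have h2 : bracket p ^ (-2 : ℝ) = (bracket p)⁻¹ ^ 2 := by
    rw [Real.rpow_neg hJ.le, inv_pow]; norm_cast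
  have h3 : bracket p ^ (2 * s + 2) * ‖F t p‖ ^ 2 = (bracket p ^ (s + 1) * ‖F t p‖) ^ 2 := by ring
  rw [h1, h2, h3]
  nlinarith [sq_nonneg ((bracket p)⁻¹ - bracket p ^ (s + 1) * ‖F t p‖),
    sq_nonneg ((bracket p)⁻¹ ), sq_nonneg (bracket p ^ (s + 1) * ‖F t p‖)]

/-- The convolution that corresponds to the pointwise product of functions on `𝕋 × ℝ`. -/
noncomputable def conv (F G : ℤ × ℝ → ℂ) (a : ℤ × ℝ) : ℂ :=
  ((2 * Real.pi : ℝ) : ℂ)⁻¹ * ∫ b, F b * G (a - b) ∂freqMeasure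

theorem aestronglyMeasurable_conv_integrand {F G : ℤ × ℝ → ℂ}
    (hF : AEStronglyMeasurable F freqMeasure) (hG : AEStronglyMeasurable G freqMeasure) :
    AEStronglyMeasurable (fun q : (ℤ × ℝ) × (ℤ × ℝ) => F q.2 * G (q.1 - q.2))
      (freqMeasure.prod freqMeasure) :=
  AEStronglyMeasurable.convolution_integrand (ContinuousLinearMap.mul ℝ ℂ) hF hG

theorem aemeasurable_conv_integrand {F G : ℤ × ℝ → ℝ≥0∞}
    (hF : AEMeasurable F freqMeasure) (hG : AEMeasurable G freqMeasure) :
    AEMeasurable (fun q : (ℤ × ℝ) × (ℤ × ℝ) => F q.2 * G (q.1 - q.2))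
      (freqMeasure.prod freqMeasure) :=
  (hF.comp_quasiMeasurePreserving Measure.quasiMeasurePreserving_snd).mul
    (hG.comp_quasiMeasurePreserving (quasiMeasurePreserving_sub _ _))

/-- Young's inequality `‖F ⋆ G‖₂ ≤ ‖F‖₁ ‖G‖₂`, with polynomial weights. -/
theorem sobolevE_conv_le {F G : ℤ × ℝ → ℂ}
    (hF : AEStronglyMeasurable F freqMeasure) (hG : AEStronglyMeasurable G freqMeasure) (s : ℕ) :
    sobolevE s (conv F G) ≤ ENNReal.ofReal (2 ^ s) *
      ((∫⁻ p, ENNReal.ofReal (bracket p ^ s) * ‖F p‖ₑ ∂freqMeasure) ^ 2 * sobolevE s G) := by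
  set L := ∫⁻ p, ENNReal.ofReal (bracket p ^ s) * ‖F p‖ₑ ∂freqMeasure with hL
  have mJ : Measurable fun p => ENNReal.ofReal (bracket p ^ s) :=
    (measurable_bracket.pow_const s).ennreal_ofReal
  have hL0 : ∫⁻ p, ‖F p‖ₑ ∂freqMeasure ≤ L := by
    refine lintegral_mono fun p => ?_
    calc ‖F p‖ₑ = 1 * ‖F p‖ₑ := (one_mul _).symm
      _ ≤ _ := by
        gcongr
        rw [ENNReal.one_le_ofReal]
        exact one_le_pow₀ (one_le_bracket p)
  have hpt : ∀ a, ENNReal.ofReal (bracket a ^ s) * ‖conv F G a‖ₑ ^ 2 ≤ L * (ENNReal.ofReal (2 ^ s) *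
      ∫⁻ b, (ENNReal.ofReal (bracket b ^ s) * ‖F b‖ₑ) *
        (ENNReal.ofReal (bracket (a - b) ^ s) * ‖G (a - b)‖ₑ ^ 2) ∂freqMeasure) := by
    intro a
    have hGa : AEMeasurable (fun b => ‖G (a - b)‖ₑ) freqMeasure :=
      hG.enorm.comp_quasiMeasurePreserving (quasiMeasurePreserving_sub_left freqMeasure a)
    have h1 : ‖conv F G a‖ₑ ≤ ∫⁻ b, ‖F b‖ₑ * ‖G (a - b)‖ₑ ∂freqMeasure := by
      unfold conv
      rw [enorm_mul]
      have hc : ‖((2 * Real.pi : ℝ) : ℂ)⁻¹‖ₑ ≤ 1 := by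
        rw [← ofReal_norm, ENNReal.ofReal_le_one, norm_inv, Complex.norm_real,
          Real.norm_of_nonneg (by positivity)]
        apply inv_le_one_of_one_le₀
        linarith [Real.pi_gt_three]
      calc _ ≤ 1 * ∫⁻ b, ‖F b * G (a - b)‖ₑ ∂freqMeasure := by
            gcongr; exact enorm_integral_le_lintegral_enorm _
        _ = _ := by simp only [one_mul, enorm_mul]
    have h2 : ‖conv F G a‖ₑ ^ 2 ≤ L * ∫⁻ b, ‖F b‖ₑ * ‖G (a - b)‖ₑ ^ 2 ∂freqMeasure :=
      calc _ ≤ (∫⁻ b, ‖F b‖ₑ * ‖G (a - b)‖ₑ ∂freqMeasure) ^ 2 := by gcongr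
        _ ≤ _ := sq_lintegral_mul_le' hF.enorm hGa
        _ ≤ _ := by gcongr
    calc _ ≤ ENNReal.ofReal (bracket a ^ s) *
          (L * ∫⁻ b, ‖F b‖ₑ * ‖G (a - b)‖ₑ ^ 2 ∂freqMeasure) := by gcongr
      _ = L * ∫⁻ b, ENNReal.ofReal (bracket a ^ s) * (‖F b‖ₑ * ‖G (a - b)‖ₑ ^ 2) ∂freqMeasure := by
          rw [lintegral_const_mul' _ _ ENNReal.ofReal_ne_top]; ring
      _ ≤ L * ∫⁻ b, ENNReal.ofReal (2 ^ s) * ((ENNReal.ofReal (bracket b ^ s) * ‖F b‖ₑ) *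
        (ENNReal.ofReal (bracket (a - b) ^ s) * ‖G (a - b)‖ₑ ^ 2)) ∂freqMeasure := by
          refine mul_le_mul' le_rfl (lintegral_mono fun b => ?_)
          have hb := (bracket_pos b).le
          have hab := (bracket_pos (a - b)).le
          calc _ ≤ ENNReal.ofReal ((2 * (bracket b * bracket (a - b))) ^ s) *
                (‖F b‖ₑ * ‖G (a - b)‖ₑ ^ 2) := by
                gcongr
                · exact (bracket_pos a).le
                · exact bracket_le_mul a b
            _ = _ := by
                rw [mul_pow, mul_pow, ENNReal.ofReal_mul (by positivity),
                  ENNReal.ofReal_mul (by positivity)]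
                ring
      _ = _ := by rw [lintegral_const_mul' _ _ ENNReal.ofReal_ne_top]
  have hmG : AEMeasurable (fun c => ENNReal.ofReal (bracket c ^ s) * ‖G c‖ₑ ^ 2) freqMeasure :=
    mJ.aemeasurable.mul (hG.enorm.pow_const 2)
  have hmF : AEMeasurable (fun c => ENNReal.ofReal (bracket c ^ s) * ‖F c‖ₑ) freqMeasure :=
    mJ.aemeasurable.mul hF.enorm
  have hm := aemeasurable_conv_integrand hmF hmG
  have hm' : AEMeasurable (fun a => ∫⁻ b, (ENNReal.ofReal (bracket b ^ s) * ‖F b‖ₑ) *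
        (ENNReal.ofReal (bracket (a - b) ^ s) * ‖G (a - b)‖ₑ ^ 2) ∂freqMeasure) freqMeasure :=
    hm.lintegral_prod_right'
  calc sobolevE s (conv F G) ≤ ∫⁻ a, L * (ENNReal.ofReal (2 ^ s) *
      ∫⁻ b, (ENNReal.ofReal (bracket b ^ s) * ‖F b‖ₑ) *
        (ENNReal.ofReal (bracket (a - b) ^ s) * ‖G (a - b)‖ₑ ^ 2) ∂freqMeasure) ∂freqMeasure :=
        lintegral_mono hpt
    _ = L * (ENNReal.ofReal (2 ^ s) * ∫⁻ a, ∫⁻ b, (ENNReal.ofReal (bracket b ^ s) * ‖F b‖ₑ) *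
        (ENNReal.ofReal (bracket (a - b) ^ s) * ‖G (a - b)‖ₑ ^ 2) ∂freqMeasure ∂freqMeasure) := by
        rw [lintegral_const_mul'' _ (hm'.const_mul _), lintegral_const_mul'' _ hm']
    _ = L * (ENNReal.ofReal (2 ^ s) * ∫⁻ b, (ENNReal.ofReal (bracket b ^ s) * ‖F b‖ₑ) *
          sobolevE s G ∂freqMeasure) := by
        rw [lintegral_lintegral_swap hm]
        congr 3
        ext b
        have hb : AEMeasurable (fun a => ENNReal.ofReal (bracket (a - b) ^ s) * ‖G (a - b)‖ₑ ^ 2)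
            freqMeasure :=
          hmG.comp_quasiMeasurePreserving
            (measurePreserving_sub_right freqMeasure b).quasiMeasurePreserving
        rw [lintegral_const_mul'' _ hb]
        congr 1
        exact lintegral_sub_right_eq_self
          (fun c => ENNReal.ofReal (bracket c ^ s) * ‖G c‖ₑ ^ 2) b
    _ = _ := by rw [lintegral_mul_const'' _ hmF]; ring

theorem RapidOn.conv (hF : RapidOn I F) (hG : RapidOn I G) :
    RapidOn I fun t => conv (F t) (G t) := by
  refine ⟨fun t ht => ?_, fun s => ?_⟩
  · exact ((aestronglyMeasurable_conv_integrand (hF.1 t ht) (hG.1 t ht)).integral_prod_right').const_mul _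
  · obtain ⟨C, hC⟩ := hF.weighted_l1 s
    obtain ⟨C', hC'⟩ := hG.2 s
    refine ⟨(2 ^ s : ℝ).toNNReal * (C ^ 2 * C'), fun t ht => ?_⟩
    refine (sobolevE_conv_le (hF.1 t ht) (hG.1 t ht) s).trans ?_
    push_cast
    gcongr
    exacts [le_rfl, hC t ht, hC' t ht]

end

theorem Rapid.aesm {F : ℤ × ℝ → ℂ} (hF : Rapid F) : AEStronglyMeasurable F freqMeasure :=
  hF.1 () (mem_univ _)

theorem Rapid.integrable_pow_mul {F : ℤ × ℝ → ℂ} (hF : Rapid F) (s : ℕ) :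
    Integrable (fun p => bracket p ^ s * ‖F p‖) freqMeasure := by
  refine ⟨((measurable_bracket.pow_const s).aestronglyMeasurable).mul hF.aesm.norm, ?_⟩
  obtain ⟨C, hC⟩ := hF.weighted_l1 s
  refine lt_of_eq_of_lt ?_ ((hC () (mem_univ _)).trans_lt ENNReal.coe_lt_top)
  refine lintegral_congr fun p => ?_
  rw [enorm_mul, enorm_norm, Real.enorm_of_nonneg (pow_nonneg (bracket_pos p).le s)]

theorem Rapid.integrable {F : ℤ × ℝ → ℂ} (hF : Rapid F) : Integrable F freqMeasure := by
  have := hF.integrable_pow_mul 0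
  simp only [pow_zero, one_mul] at this
  exact (integrable_norm_iff hF.aesm).1 this

theorem integrable_sq_of_sobolevE {F : ℤ × ℝ → ℂ} (hF : AEStronglyMeasurable F freqMeasure)
    {s : ℕ} (h : sobolevE s F ≠ ∞) :
    Integrable (fun p => bracket p ^ s * ‖F p‖ ^ 2) freqMeasure := by
  refine ⟨((measurable_bracket.pow_const s).aestronglyMeasurable).mul (hF.norm.pow 2), ?_⟩
  refine lt_of_eq_of_lt ?_ h.lt_top
  refine lintegral_congr fun p => ?_
  rw [enorm_mul, Real.enorm_of_nonneg (pow_nonneg (bracket_pos p).le s), enorm_pow, enorm_norm]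

theorem Rapid.integrable_sq {F : ℤ × ℝ → ℂ} (hF : Rapid F) (s : ℕ) :
    Integrable (fun p => bracket p ^ s * ‖F p‖ ^ 2) freqMeasure := by
  obtain ⟨C, hC⟩ := hF.2 s
  exact integrable_sq_of_sobolevE hF.aesm ((hC () (mem_univ _)).trans_lt ENNReal.coe_lt_top).ne

theorem sobolevE_eq_ofReal_integral {F : ℤ × ℝ → ℂ} {s : ℕ}
    (h : Integrable (fun p => bracket p ^ s * ‖F p‖ ^ 2) freqMeasure) :
    sobolevE s F = ENNReal.ofReal (∫ p, bracket p ^ s * ‖F p‖ ^ 2 ∂freqMeasure) := by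
  rw [ofReal_integral_eq_lintegral_ofReal h (Filter.Eventually.of_forall fun p =>
    mul_nonneg (pow_nonneg (bracket_pos p).le s) (sq_nonneg _))]
  refine lintegral_congr fun p => ?_
  rw [ENNReal.ofReal_mul (pow_nonneg (bracket_pos p).le s), ENNReal.ofReal_pow (norm_nonneg _),
    ofReal_norm]

theorem IsFourierTransform.rapid {f : ℝ → ℝ → ℝ} {F : ℤ × ℝ → ℂ} (h : IsFourierTransform f F) :
    Rapid F := by
  refine ⟨fun _ _ => h.1, fun s => ⟨(sobolevE s F).toNNReal, fun _ _ => ?_⟩⟩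
  rw [ENNReal.coe_toNNReal]
  have := sobolevE_eq_ofReal_integral (F := F) (s := s) (h.2 s)
  rw [this]
  exact ENNReal.ofReal_ne_top

theorem IsRegular.rapidOn {T : ℝ} {f : ℝ → ℝ → ℝ → ℝ} {F : ℝ → ℤ × ℝ → ℂ} (h : IsRegular T f F)
    {a b : ℝ} (ha : 0 < a) (hb : b < T) : RapidOn (Icc a b) F := by
  have hI : ∀ t ∈ Icc a b, t ∈ Ioo 0 T := fun t ht => ⟨ha.trans_le ht.1, ht.2.trans_lt hb⟩
  refine ⟨fun t ht => (h.fourier t (hI t ht)).1, fun s => ?_⟩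
  obtain ⟨C, hC⟩ := h.locallyBounded a b ha hb s
  refine ⟨C.toNNReal, fun t ht => ?_⟩
  rw [sobolevE_eq_ofReal_integral ((h.fourier t (hI t ht)).2 s)]
  exact ENNReal.ofReal_le_ofReal (hC t ht)

/-! ### Fourier inversion -/

/-- The plane wave `e^{i(kx + ξy)}` as a function of the frequency. -/
noncomputable def wave (x y : ℝ) (p : ℤ × ℝ) : ℂ :=
  Complex.exp (Complex.I * (((p.1 : ℝ) * x + p.2 * y : ℝ) : ℂ))

theorem norm_wave (x y : ℝ) (p : ℤ × ℝ) : ‖wave x y p‖ = 1 := by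
  unfold wave; rw [mul_comm]; exact Complex.norm_exp_ofReal_mul_I _

theorem measurable_wave (x y : ℝ) : Measurable (wave x y) :=
  measurable_of_continuous_section fun k => by unfold wave; fun_prop

theorem wave_mul (x y : ℝ) (p q : ℤ × ℝ) : wave x y (p + q) = wave x y p * wave x y q := by
  unfold wave; rw [← Complex.exp_add]; congr 1; push_cast [Prod.fst_add, Prod.snd_add]; ring

theorem integrable_mul_wave {F : ℤ × ℝ → ℂ} (hF : Integrable F freqMeasure) (x y : ℝ) :
    Integrable (fun p => F p * wave x y p) freqMeasure :=
  hF.mul_bdd (c := 1) (measurable_wave x y).aestronglyMeasurable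
    (Filter.Eventually.of_forall fun p => (norm_wave x y p).le)

/-- The inverse Fourier transform. -/
noncomputable def invFourier (F : ℤ × ℝ → ℂ) (x y : ℝ) : ℂ :=
  ((2 * Real.pi : ℝ) : ℂ)⁻¹ * ∫ p, F p * wave x y p ∂freqMeasure

theorem IsFourierTransform.eq_invFourier {f : ℝ → ℝ → ℝ} {F : ℤ × ℝ → ℂ}
    (h : IsFourierTransform f F) (x y : ℝ) : (f x y : ℂ) = invFourier F x y := h.3 x y

theorem invFourier_add {F G : ℤ × ℝ → ℂ} (hF : Rapid F) (hG : Rapid G) (x y : ℝ) :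
    invFourier (fun p => F p + G p) x y = invFourier F x y + invFourier G x y := by
  unfold invFourier
  rw [← mul_add, ← integral_add (integrable_mul_wave hF.integrable x y)
    (integrable_mul_wave hG.integrable x y)]
  simp only [add_mul]

theorem invFourier_const_mul (c : ℂ) (F : ℤ × ℝ → ℂ) (x y : ℝ) :
    invFourier (fun p => c * F p) x y = c * invFourier F x y := by
  unfold invFourier
  simp only [mul_assoc, integral_const_mul]
  ring

theorem invFourier_congr {F G : ℤ × ℝ → ℂ} (h : F =ᵐ[freqMeasure] G) (x y : ℝ) :
    invFourier F x y = invFourier G x y := by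
  unfold invFourier
  congr 1
  exact integral_congr_ae (h.mono fun p hp => by simp only [hp])

theorem invFourier_conv {F G : ℤ × ℝ → ℂ} (hF : Rapid F) (hG : Rapid G) (x y : ℝ) :
    invFourier (conv F G) x y = invFourier F x y * invFourier G x y := by
  have h := integral_convolution (ContinuousLinearMap.mul ℝ ℂ) (μ := freqMeasure) (ν := freqMeasure)
    (integrable_mul_wave hF.integrable x y) (integrable_mul_wave hG.integrable x y)
  simp only [ContinuousLinearMap.mul_apply'] at h
  unfold invFourier
  rw [show ∀ c u v : ℂ, c * u * (c * v) = c * (c * (u * v)) from fun c u v => by ring, ← h]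
  congr 1
  rw [← integral_const_mul]
  refine integral_congr_ae (Filter.Eventually.of_forall fun a => ?_)
  unfold conv convolution
  simp only
  rw [mul_assoc, ← integral_mul_const]
  congr 1
  refine integral_congr_ae (Filter.Eventually.of_forall fun b => ?_)
  simp only [ContinuousLinearMap.mul_apply']
  have := wave_mul x y b (a - b)
  rw [add_sub_cancel] at this
  rw [this]; ring

/-- Differentiation under the integral of an oscillating phase with frequency `m p`. The two space
derivatives of the inverse Fourier transform are instances. -/
theorem hasDerivAt_integral_phase {F : ℤ × ℝ → ℂ} (hF : Rapid F) {m : ℤ × ℝ → ℝ}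
    (hm : Measurable m) (hm' : ∀ p, |m p| ≤ bracket p) {e : ℝ → ℤ × ℝ → ℂ}
    (he : ∀ x, Measurable (e x)) (he1 : ∀ x p, ‖e x p‖ = 1)
    (hd : ∀ p x, HasDerivAt (fun x => e x p) (Complex.I * m p * e x p) x) (x : ℝ) :
    HasDerivAt (fun x => ∫ p, F p * e x p ∂freqMeasure)
      (∫ p, (Complex.I * m p * F p) * e x p ∂freqMeasure) x := by
  have hmeas : ∀ x, AEStronglyMeasurable (fun p => F p * e x p) freqMeasure := fun x =>
    hF.aesm.mul (he x).aestronglyMeasurable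
  refine (hasDerivAt_integral_of_dominated_loc_of_deriv_le (s := univ)
    (F' := fun x p => (Complex.I * m p * F p) * e x p) (bound := fun p => bracket p ^ 1 * ‖F p‖) Filter.univ_mem
    (Filter.Eventually.of_forall hmeas) ?_ ?_ ?_ (hF.integrable_pow_mul 1) ?_).2
  · exact hF.integrable.mul_bdd (c := 1) (he x).aestronglyMeasurable
      (Filter.Eventually.of_forall fun p => (he1 x p).le)
  · exact (((Complex.measurable_ofReal.comp hm).const_mul _).aestronglyMeasurable.mul
      hF.aesm).mul (he x).aestronglyMeasurable
  · refine Filter.Eventually.of_forall fun p x _ => ?_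
    rw [norm_mul, norm_mul, norm_mul, he1, Complex.norm_I, Complex.norm_real, Real.norm_eq_abs]
    simp only [one_mul, mul_one, pow_one]
    gcongr; exact hm' p
  · refine Filter.Eventually.of_forall fun p x _ => ?_
    exact ((hd p x).const_mul (F p)).congr_deriv (by ring)

theorem abs_fst_le_bracket (p : ℤ × ℝ) : |(p.1 : ℝ)| ≤ bracket p := by
  unfold bracket
  rw [abs_le]; constructor <;> nlinarith [sq_nonneg ((p.1 : ℝ) - 1), sq_nonneg ((p.1 : ℝ) + 1), sq_nonneg p.2]

theorem abs_snd_le_bracket (p : ℤ × ℝ) : |p.2| ≤ bracket p := by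
  unfold bracket
  rw [abs_le]; constructor <;> nlinarith [sq_nonneg (p.2 - 1), sq_nonneg (p.2 + 1), sq_nonneg (p.1 : ℝ)]

theorem measurable_fst_cast : Measurable fun p : ℤ × ℝ => (p.1 : ℝ) := by fun_prop

/-- Fourier symbol `ik` of `∂ₓ`. -/
noncomputable def mulX (F : ℤ × ℝ → ℂ) : ℤ × ℝ → ℂ := fun p => Complex.I * ((p.1 : ℝ) : ℂ) * F p

/-- Fourier symbol `iξ` of `∂_y`. -/
noncomputable def mulY (F : ℤ × ℝ → ℂ) : ℤ × ℝ → ℂ := fun p => Complex.I * (p.2 : ℂ) * F p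

theorem hasDerivAt_invFourier_x {F : ℤ × ℝ → ℂ} (hF : Rapid F) (x y : ℝ) :
    HasDerivAt (fun x => invFourier F x y) (invFourier (mulX F) x y) x := by
  refine HasDerivAt.const_mul _ (hasDerivAt_integral_phase hF measurable_fst_cast
    abs_fst_le_bracket (fun x => measurable_wave x y) (fun x p => norm_wave x y p) (fun p x => ?_) x)
  unfold wave
  have h1 : HasDerivAt (fun x : ℝ => (p.1 : ℝ) * x + p.2 * y) ((p.1 : ℝ)) x := by
    simpa using ((hasDerivAt_id x).const_mul (p.1 : ℝ)).add_const (p.2 * y)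
  exact ((h1.ofReal_comp.const_mul Complex.I).cexp).congr_deriv (by ring)

theorem hasDerivAt_invFourier_y {F : ℤ × ℝ → ℂ} (hF : Rapid F) (x y : ℝ) :
    HasDerivAt (fun y => invFourier F x y) (invFourier (mulY F) x y) y := by
  refine HasDerivAt.const_mul _ (hasDerivAt_integral_phase hF measurable_snd
    abs_snd_le_bracket (fun y => measurable_wave x y) (fun y p => norm_wave x y p) (fun p y => ?_) y)
  unfold wave
  have h1 : HasDerivAt (fun y : ℝ => (p.1 : ℝ) * x + p.2 * y) p.2 y := by
    simpa using ((hasDerivAt_id y).const_mul p.2).const_add ((p.1 : ℝ) * x)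
  exact ((h1.ofReal_comp.const_mul Complex.I).cexp).congr_deriv (by ring)

section
variable {ι : Type*} {I : Set ι} {F : ι → ℤ × ℝ → ℂ}

theorem RapidOn.mulX (hF : RapidOn I F) : RapidOn I fun t => mulX (F t) :=
  hF.mul_poly (m := fun _ p => Complex.I * ((p.1 : ℝ) : ℂ))
    (fun _ _ => ((Complex.measurable_ofReal.comp measurable_fst_cast).const_mul _).aestronglyMeasurable)
    ⟨1, 1, fun _ _ p => by
      rw [norm_mul, Complex.norm_I, Complex.norm_real]; simpa using abs_fst_le_bracket p⟩

theorem RapidOn.mulY (hF : RapidOn I F) : RapidOn I fun t => mulY (F t) :=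
  hF.mul_poly (m := fun _ p => Complex.I * (p.2 : ℂ))
    (fun _ _ => ((Complex.measurable_ofReal.comp measurable_snd).const_mul _).aestronglyMeasurable)
    ⟨1, 1, fun _ _ p => by
      rw [norm_mul, Complex.norm_I, Complex.norm_real]; simpa using abs_snd_le_bracket p⟩

theorem RapidOn.const_mul (hF : RapidOn I F) (c : ℂ) : RapidOn I fun t p => c * F t p :=
  hF.mul_poly (m := fun _ _ => c) (fun _ _ => aestronglyMeasurable_const)
    ⟨‖c‖, 0, fun _ _ p => by simp⟩

theorem RapidOn.indicator (hF : RapidOn I F) (s : Set ℤ) [DecidablePred (· ∈ s)] :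
    RapidOn I fun t p => if p.1 ∈ s then F t p else 0 := by
  have := hF.mul_poly (m := fun _ p => if p.1 ∈ s then (1 : ℂ) else 0)
    (fun _ _ => (measurable_of_continuous_section fun k => by
      by_cases h : k ∈ s <;> simp only [h, if_true, if_false] <;> fun_prop).aestronglyMeasurable)
    ⟨1, 0, fun _ _ p => by by_cases h : p.1 ∈ s <;> simp [h]⟩
  simpa using this
end

theorem hasDerivAt_of_ofReal {g : ℝ → ℝ} {g' : ℂ} {x : ℝ}
    (h : HasDerivAt (fun x => (g x : ℂ)) g' x) : HasDerivAt g g'.re x ∧ ((g'.re : ℝ) : ℂ) = g' := by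
  have h1 : HasDerivAt (fun x => ((g x : ℂ)).re) g'.re x :=
    (Complex.reCLM.hasFDerivAt.comp_hasDerivAt x h)
  have h2 : HasDerivAt (fun x => ((g x : ℂ)).im) g'.im x :=
    (Complex.imCLM.hasFDerivAt.comp_hasDerivAt x h)
  simp only [Complex.ofReal_re, Complex.ofReal_im] at h1 h2
  refine ⟨h1, Complex.ext (by simp) ?_⟩
  simpa using (hasDerivAt_const x (0 : ℝ)).unique h2

/-- `(f x y : ℂ) = invFourier F x y` with `F` rapidly decaying. -/
structure IsInv (f : ℝ → ℝ → ℝ) (F : ℤ × ℝ → ℂ) : Prop where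
  rapid : Rapid F
  eq : ∀ x y, (f x y : ℂ) = invFourier F x y

theorem IsFourierTransform.isInv {f : ℝ → ℝ → ℝ} {F : ℤ × ℝ → ℂ} (h : IsFourierTransform f F) :
    IsInv f F := ⟨h.rapid, h.eq_invFourier⟩

section
variable {f g : ℝ → ℝ → ℝ} {F G : ℤ × ℝ → ℂ}

theorem IsInv.hasDerivAt_x (h : IsInv f F) (x y : ℝ) :
    HasDerivAt (fun x => f x y) (dx f x y) x ∧ (dx f x y : ℂ) = invFourier (mulX F) x y := by
  have h1 : HasDerivAt (fun x => (f x y : ℂ)) (invFourier (mulX F) x y) x := by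
    simp only [h.eq]; exact hasDerivAt_invFourier_x h.rapid x y
  obtain ⟨h2, h3⟩ := hasDerivAt_of_ofReal h1
  have : dx f x y = (invFourier (mulX F) x y).re := h2.deriv
  rw [this]
  exact ⟨h2, h3⟩

theorem IsInv.hasDerivAt_y (h : IsInv f F) (x y : ℝ) :
    HasDerivAt (fun y => f x y) (dy f x y) y ∧ (dy f x y : ℂ) = invFourier (mulY F) x y := by
  have h1 : HasDerivAt (fun y => (f x y : ℂ)) (invFourier (mulY F) x y) y := by
    simp only [h.eq]; exact hasDerivAt_invFourier_y h.rapid x y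
  obtain ⟨h2, h3⟩ := hasDerivAt_of_ofReal h1
  have : dy f x y = (invFourier (mulY F) x y).re := h2.deriv
  rw [this]
  exact ⟨h2, h3⟩

theorem IsInv.dx (h : IsInv f F) : IsInv (dx f) (mulX F) :=
  ⟨h.rapid.mulX, fun x y => (h.hasDerivAt_x x y).2⟩

theorem IsInv.dy (h : IsInv f F) : IsInv (dy f) (mulY F) :=
  ⟨h.rapid.mulY, fun x y => (h.hasDerivAt_y x y).2⟩

theorem IsInv.add (h : IsInv f F) (h' : IsInv g G) :
    IsInv (fun x y => f x y + g x y) (fun p => F p + G p) :=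
  ⟨h.rapid.add h'.rapid, fun x y => by
    push_cast; rw [h.eq, h'.eq, invFourier_add h.rapid h'.rapid]⟩

theorem IsInv.const_mul (h : IsInv f F) (c : ℝ) :
    IsInv (fun x y => c * f x y) (fun p => (c : ℂ) * F p) :=
  ⟨h.rapid.const_mul c, fun x y => by push_cast; rw [h.eq, invFourier_const_mul]⟩

theorem IsInv.mul (h : IsInv f F) (h' : IsInv g G) :
    IsInv (fun x y => f x y * g x y) (conv F G) :=
  ⟨h.rapid.conv h'.rapid, fun x y => by
    push_cast; rw [h.eq, h'.eq, invFourier_conv h.rapid h'.rapid]⟩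
end

/-! ### Injectivity of the inverse Fourier transform -/

/-- A real integrable function with vanishing Fourier transform is zero: its positive and negative
parts are the densities of finite measures with the same characteristic function. -/
theorem real_ae_eq_zero_of_fourier {g : ℝ → ℝ} (hg : Integrable g)
    (h : ∀ y : ℝ, ∫ ξ, (g ξ : ℂ) * Complex.exp (y * ξ * Complex.I) = 0) : g =ᵐ[volume] 0 := by
  have hfin : ∀ g : ℝ → ℝ, Integrable g →
      IsFiniteMeasure (volume.withDensity fun ξ => ENNReal.ofReal (g ξ)) := fun g hg =>
    isFiniteMeasure_withDensity_ofReal hg.2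
  have hI : ∀ g : ℝ → ℝ, Integrable g → ∀ y : ℝ,
      Integrable (fun ξ => ((max (g ξ) 0 : ℝ) : ℂ) * Complex.exp (y * ξ * Complex.I)) :=
    fun g hg y => (hg.pos_part.ofReal).mul_bdd (c := 1) (by fun_prop)
      (Filter.Eventually.of_forall fun ξ => by
        rw [show (y : ℂ) * ξ * Complex.I = ((y * ξ : ℝ) : ℂ) * Complex.I by push_cast; ring,
          Complex.norm_exp_ofReal_mul_I])
  have hchar : ∀ g : ℝ → ℝ, Integrable g → ∀ y,
      charFun (volume.withDensity fun ξ => ENNReal.ofReal (g ξ)) y =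
        ∫ ξ, ((max (g ξ) 0 : ℝ) : ℂ) * Complex.exp (y * ξ * Complex.I) := fun g hg y => by
    rw [charFun_apply_real, integral_withDensity_eq_integral_toReal_smul₀
      hg.1.aemeasurable.ennreal_ofReal (Filter.Eventually.of_forall fun _ => ENNReal.ofReal_lt_top)]
    simp only [ENNReal.toReal_ofReal', Complex.real_smul]
  have := hfin g hg
  have := hfin (fun ξ => -g ξ) hg.neg
  have heq : (volume.withDensity fun ξ => ENNReal.ofReal (g ξ)) =
      volume.withDensity fun ξ => ENNReal.ofReal (-g ξ) := by
    refine Measure.ext_of_charFun (funext fun y => ?_)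
    rw [hchar g hg y, hchar (fun ξ => -g ξ) hg.neg y, ← sub_eq_zero, ← integral_sub (hI g hg y) (hI (fun ξ => -g ξ) hg.neg y),
      ← h y]
    congr 1
    ext ξ
    rw [← sub_mul, ← Complex.ofReal_sub]
    congr 2
    exact max_zero_sub_max_neg_zero_eq_self (g ξ)
  have h2 := (withDensity_eq_iff hg.1.aemeasurable.ennreal_ofReal
    hg.1.neg.aemeasurable.ennreal_ofReal hg.lintegral_lt_top.ne).1 heq
  filter_upwards [h2] with ξ hξ
  have h3 := congrArg ENNReal.toReal hξ
  simp only [Pi.neg_apply, ENNReal.toReal_ofReal'] at h3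
  have := max_zero_sub_max_neg_zero_eq_self (g ξ)
  simp only [Pi.zero_apply]
  linarith

theorem complex_ae_eq_zero_of_fourier {f : ℝ → ℂ} (hf : Integrable f)
    (h : ∀ y : ℝ, ∫ ξ, f ξ * Complex.exp (y * ξ * Complex.I) = 0) : f =ᵐ[volume] 0 := by
  have hI : ∀ f : ℝ → ℂ, Integrable f → ∀ y : ℝ,
      Integrable (fun ξ => f ξ * Complex.exp (y * ξ * Complex.I)) :=
    fun f hf y => hf.mul_bdd (c := 1) (by fun_prop)
      (Filter.Eventually.of_forall fun ξ => by
        rw [show (y : ℂ) * ξ * Complex.I = ((y * ξ : ℝ) : ℂ) * Complex.I by push_cast; ring,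
          Complex.norm_exp_ofReal_mul_I])
  have hfc : Integrable (fun ξ => (starRingEnd ℂ) (f ξ)) :=
    ⟨Complex.continuous_conj.comp_aestronglyMeasurable hf.1, by
      simpa [HasFiniteIntegral, RCLike.enorm_conj] using hf.2⟩
  have hc : ∀ y : ℝ, ∫ ξ, (starRingEnd ℂ) (f ξ) * Complex.exp (y * ξ * Complex.I) = 0 := fun y => by
    rw [← map_zero (starRingEnd ℂ), ← h (-y), ← integral_conj]
    congr 1; ext ξ
    rw [map_mul, ← Complex.exp_conj]
    congr 2
    simp
  have hre : (fun ξ => (f ξ).re) =ᵐ[volume] 0 := by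
    refine real_ae_eq_zero_of_fourier hf.re fun y => ?_
    have h1 : ∀ ξ : ℝ, ((f ξ).re : ℂ) * Complex.exp (y * ξ * Complex.I) =
        (1 / 2) * (f ξ * Complex.exp (y * ξ * Complex.I) +
          (starRingEnd ℂ) (f ξ) * Complex.exp (y * ξ * Complex.I)) := fun ξ => by
      rw [Complex.re_eq_add_conj]; ring
    simp only [h1]
    rw [integral_const_mul, integral_add (hI f hf y) (hI _ hfc y), h, hc]; simp
  have him : (fun ξ => (f ξ).im) =ᵐ[volume] 0 := by
    refine real_ae_eq_zero_of_fourier hf.im fun y => ?_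
    have h1 : ∀ ξ : ℝ, ((f ξ).im : ℂ) * Complex.exp (y * ξ * Complex.I) =
        (1 / (2 * Complex.I)) * (f ξ * Complex.exp (y * ξ * Complex.I) -
          (starRingEnd ℂ) (f ξ) * Complex.exp (y * ξ * Complex.I)) := fun ξ => by
      rw [Complex.im_eq_sub_conj]; ring
    simp only [h1]
    rw [integral_const_mul, integral_sub (hI f hf y) (hI _ hfc y), h, hc]; simp
  filter_upwards [hre, him] with ξ h1 h2
  exact Complex.ext h1 h2

/-- Integration against `e^{-inx}` over a period extracts the `n`-th mode. -/
theorem integral_exp_mul_invFourier {F : ℤ × ℝ → ℂ} (hF : Integrable F freqMeasure) (n : ℤ) (y : ℝ) :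
    ∫ x in (0 : ℝ)..(2 * Real.pi), Complex.exp (-(Complex.I * n * x)) * invFourier F x y =
      (2 * Real.pi : ℝ) * invFourier (fun p => if p.1 = n then F p else 0) 0 y := by
  have horth : ∀ p : ℤ × ℝ, ∫ x in (0 : ℝ)..(2 * Real.pi), Complex.exp (-(Complex.I * n * x)) *
      (F p * wave x y p) = (2 * Real.pi : ℝ) * ((if p.1 = n then F p else 0) * wave 0 y p) := by
    intro p
    have h1 : ∀ x : ℝ, Complex.exp (-(Complex.I * n * x)) * (F p * wave x y p) =
        (F p * wave 0 y p) * Complex.exp ((Complex.I * ((p.1 - n : ℤ) : ℂ)) * x) := by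
      intro x
      unfold wave
      rw [mul_left_comm, mul_assoc (F p), ← Complex.exp_add, ← Complex.exp_add]
      congr 2; push_cast; ring
    simp only [h1]
    rw [intervalIntegral.integral_const_mul]
    by_cases hk : p.1 = n
    · simp [hk]; ring
    · have hne : Complex.I * ((p.1 - n : ℤ) : ℂ) ≠ 0 :=
        mul_ne_zero Complex.I_ne_zero (by exact_mod_cast sub_ne_zero.2 hk)
      rw [integral_exp_mul_complex hne]
      have h2 : Complex.exp (Complex.I * ((p.1 - n : ℤ) : ℂ) * ((2 * Real.pi : ℝ) : ℂ)) = 1 := by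
        rw [Complex.exp_eq_one_iff]
        exact ⟨p.1 - n, by push_cast; ring⟩
      rw [h2]
      simp [hk]
  unfold invFourier
  have hsw : (∫ x in (0 : ℝ)..(2 * Real.pi), (∫ p, Complex.exp (-(Complex.I * n * x)) *
      (F p * wave x y p) ∂freqMeasure)) =
      ∫ p, (∫ x in (0 : ℝ)..(2 * Real.pi), Complex.exp (-(Complex.I * n * x)) *
      (F p * wave x y p)) ∂freqMeasure := by
    refine intervalIntegral_integral_swap ?_
    have : IsFiniteMeasure (volume.restrict (uIoc 0 (2 * Real.pi))) :=
      ⟨by simp [uIoc]⟩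
    have hF2 : Integrable (fun q : ℝ × (ℤ × ℝ) => F q.2)
        ((volume.restrict (uIoc 0 (2 * Real.pi))).prod freqMeasure) := hF.comp_snd _
    have hme : Measurable fun q : ℝ × (ℤ × ℝ) => Complex.exp (-(Complex.I * n * q.1)) * wave q.1 y q.2 := by
      unfold wave
      fun_prop
    refine (hF2.mul_bdd (c := 1) hme.aestronglyMeasurable
      (Filter.Eventually.of_forall fun q => ?_)).congr (Filter.Eventually.of_forall fun q => ?_)
    · rw [norm_mul, norm_wave, mul_one,
        show -(Complex.I * n * q.1) = ((-(n * q.1) : ℝ) : ℂ) * Complex.I by push_cast; ring,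
        Complex.norm_exp_ofReal_mul_I]
    · simp only [Function.uncurry]; ring
  simp only [integral_const_mul] at hsw
  rw [mul_left_comm, ← integral_const_mul, ← integral_congr_ae (Filter.Eventually.of_forall horth),
    ← hsw, ← intervalIntegral.integral_const_mul]
  congr 1; ext x; ring

theorem integral_single_mode {F : ℤ × ℝ → ℂ} (hF : Integrable F freqMeasure) (n : ℤ) :
    ∫ p, (if p.1 = n then F p else 0) ∂freqMeasure = ∫ ξ, F (n, ξ) := by
  have hI : Integrable (fun p : ℤ × ℝ => if p.1 = n then F p else 0) freqMeasure := by
    have : MeasurableSet {p : ℤ × ℝ | p.1 = n} := measurable_fst (measurableSet_singleton n)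
    refine (hF.indicator this).congr (Filter.Eventually.of_forall fun p => ?_)
    simp [Set.indicator]
  unfold freqMeasure at *
  rw [integral_prod _ hI]
  rw [← setIntegral_eq_integral_of_forall_compl_eq_zero (s := {n}), integral_singleton]
  · simp [Measure.real]
  · intro k hk
    have : k ≠ n := by simpa using hk
    simp [this]

theorem integrable_section {F : ℤ × ℝ → ℂ} (hF : Integrable F freqMeasure) (n : ℤ) :
    Integrable fun ξ => F (n, ξ) := by
  unfold freqMeasure at hF
  have := hF.prod_right_ae
  rw [Measure.ae_count_iff] at this
  exact this n

/-- Injectivity: every mode `F (n, ·)` has vanishing Fourier transform in `y`. -/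
theorem ae_eq_zero_of_invFourier {F : ℤ × ℝ → ℂ} (hF : Integrable F freqMeasure)
    (h : ∀ x y, invFourier F x y = 0) : F =ᵐ[freqMeasure] 0 := by
  have hsec : ∀ n : ℤ, (fun ξ => F (n, ξ)) =ᵐ[volume] 0 := fun n => by
    refine complex_ae_eq_zero_of_fourier (integrable_section hF n) fun y => ?_
    have h1 := integral_exp_mul_invFourier hF n y
    simp only [h, mul_zero, intervalIntegral.integral_zero] at h1
    have hpi : ((2 * Real.pi : ℝ) : ℂ) ≠ 0 := by
      exact_mod_cast (by positivity : (2 * Real.pi : ℝ) ≠ 0)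
    unfold invFourier at h1
    rw [mul_inv_cancel_left₀ hpi] at h1
    have h2 := integral_single_mode (integrable_mul_wave hF 0 y) n
    simp only [ite_mul, zero_mul] at h1
    rw [← h1] at h2
    rw [h2]
    congr 1; ext ξ
    unfold wave
    congr 2; push_cast; ring
  have hl : ∫⁻ p, ‖F p‖ₑ ∂freqMeasure = 0 := by
    rw [lintegral_freq hF.1.enorm]
    refine ENNReal.tsum_eq_zero.2 fun n => ?_
    rw [lintegral_eq_zero_iff' (integrable_section hF n).1.enorm]
    filter_upwards [hsec n] with ξ hξ
    simpa using hξ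
  rw [lintegral_eq_zero_iff' hF.1.enorm] at hl
  filter_upwards [hl] with p hp
  simpa using hp

theorem ae_eq_of_invFourier {F G : ℤ × ℝ → ℂ} (hF : Rapid F) (hG : Rapid G)
    (h : ∀ x y, invFourier F x y = invFourier G x y) : F =ᵐ[freqMeasure] G := by
  have h1 := ae_eq_zero_of_invFourier (Rapid.integrable (hF.add (hG.const_mul (-1)))) fun x y => by
    rw [invFourier_add hF (hG.const_mul (-1)), invFourier_const_mul, h]; ring
  filter_upwards [h1] with p hp
  simp only [Pi.zero_apply] at hp
  linear_combination hp

theorem IsInv.ae_eq {f : ℝ → ℝ → ℝ} {F G : ℤ × ℝ → ℂ} (h : IsInv f F) (h' : IsInv f G) :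
    F =ᵐ[freqMeasure] G :=
  ae_eq_of_invFourier h.rapid h'.rapid fun x y => by rw [← h.eq, ← h'.eq]

/-- Fourier transforms of real functions are Hermitian. -/
theorem IsInv.conj_neg {f : ℝ → ℝ → ℝ} {F : ℤ × ℝ → ℂ} (h : IsInv f F) :
    ∀ᵐ p ∂freqMeasure, F (-p) = (starRingEnd ℂ) (F p) := by
  have hR : Rapid fun p => (starRingEnd ℂ) (F (-p)) := by
    have hmp := Measure.measurePreserving_neg freqMeasure
    have ham : AEStronglyMeasurable (fun p => F (-p)) freqMeasure :=
      h.rapid.aesm.comp_measurePreserving hmp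
    refine ⟨fun _ _ => Complex.continuous_conj.comp_aestronglyMeasurable ham, fun s => ?_⟩
    obtain ⟨C, hC⟩ := h.rapid.2 s
    refine ⟨C, fun _ _ => le_of_eq_of_le ?_ (hC () (mem_univ _))⟩
    unfold sobolevE
    rw [← lintegral_neg_eq_self (fun p => ENNReal.ofReal (bracket p ^ s) * ‖F p‖ₑ ^ 2)]
    refine lintegral_congr fun p => ?_
    rw [RCLike.enorm_conj]
    simp [bracket]
  have h2 : IsInv f fun p => (starRingEnd ℂ) (F (-p)) := by
    refine ⟨hR, fun x y => ?_⟩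
    rw [← Complex.conj_ofReal, h.eq]
    unfold invFourier
    rw [map_mul, ← integral_conj, ← integral_neg_eq_self]
    simp only [map_inv₀, Complex.conj_ofReal, map_mul]
    congr 2; ext p; congr 1
    unfold wave
    rw [← Complex.exp_conj]
    congr 1
    simp
    ring
  filter_upwards [h2.ae_eq h] with p hp
  rw [← hp, Complex.conj_conj]

/-- The zero mode has Fourier transform `F` restricted to `k = 0`. -/
theorem IsInv.zeroMode {f : ℝ → ℝ → ℝ} {F : ℤ × ℝ → ℂ} (h : IsInv f F) :
    IsInv (fun _ y => zeroMode f y) (fun p => if p.1 = 0 then F p else 0) := by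
  refine ⟨h.rapid.indicator {0}, fun x y => ?_⟩
  have h1 := integral_exp_mul_invFourier h.rapid.integrable 0 y
  simp only [Int.cast_zero, mul_zero, zero_mul, neg_zero, Complex.exp_zero, one_mul, ← h.eq] at h1
  rw [intervalIntegral.integral_ofReal] at h1
  have hpi : ((2 * Real.pi : ℝ) : ℂ) ≠ 0 := by
    exact_mod_cast (by positivity : (2 * Real.pi : ℝ) ≠ 0)
  unfold Boussinesq.zeroMode
  rw [Complex.ofReal_mul, h1, Complex.ofReal_inv, inv_mul_cancel_left₀ hpi]
  unfold invFourier
  congr 2; ext p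
  by_cases hp : p.1 = 0 <;> simp [hp, wave]

/-! ### Differentiation of quadratic functionals along weakly differentiable curves -/

section Hilbert
variable {H : Type*} [NormedAddCommGroup H] [InnerProductSpace ℂ H]
  {S : Set H} {v h : ℝ → H} {t r C : ℝ}

theorem hasDerivAt_inner_of_mem_span
    (hd : ∀ e ∈ S, ∀ s ∈ Metric.ball t r,
      HasDerivAt (fun s => inner ℂ e (v s)) (inner ℂ e (h s)) s) :
    ∀ e ∈ Submodule.span ℂ S, ∀ s ∈ Metric.ball t r,
      HasDerivAt (fun s => inner ℂ e (v s)) (inner ℂ e (h s)) s := by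
  intro e he s hs
  induction he using Submodule.span_induction with
  | mem x hx => exact hd x hx s hs
  | zero => simpa using hasDerivAt_const s (0 : ℂ)
  | add x y _ _ hx hy => simp only [inner_add_left]; exact hx.add hy
  | smul c x _ hx => simpa only [inner_smul_left] using hx.const_mul _

/-- A curve that has a bounded derivative when tested against a total set is Lipschitz. -/
theorem norm_sub_le_of_weak_deriv (hS : (Submodule.span ℂ S).topologicalClosure = ⊤)
    (hC : ∀ s ∈ Metric.ball t r, ‖h s‖ ≤ C)
    (hd : ∀ e ∈ S, ∀ s ∈ Metric.ball t r,
      HasDerivAt (fun s => inner ℂ e (v s)) (inner ℂ e (h s)) s)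
    {s s' : ℝ} (hs : s ∈ Metric.ball t r) (hs' : s' ∈ Metric.ball t r) :
    ‖v s' - v s‖ ≤ C * |s' - s| := by
  have h1 : ∀ e ∈ Submodule.span ℂ S, ‖inner ℂ e (v s' - v s)‖ ≤ ‖e‖ * C * |s' - s| := by
    intro e he
    rw [inner_sub_right]
    refine Convex.norm_image_sub_le_of_norm_hasDerivWithin_le (s := Metric.ball t r)
      (f := fun s => inner ℂ e (v s)) (f' := fun s => inner ℂ e (h s))
      (fun x hx => (hasDerivAt_inner_of_mem_span hd e he x hx).hasDerivWithinAt)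
      (fun x hx => ?_) (convex_ball t r) hs hs'
    exact (norm_inner_le_norm _ _).trans (by gcongr; exact hC x hx)
  have h2 : ∀ x : H, ‖inner ℂ x (v s' - v s)‖ ≤ ‖x‖ * C * |s' - s| := by
    intro x
    have hcl : IsClosed {x : H | ‖inner ℂ x (v s' - v s)‖ ≤ ‖x‖ * C * |s' - s|} :=
      isClosed_le (by fun_prop) (by fun_prop)
    have hx : x ∈ closure (Submodule.span ℂ S : Set H) := by
      rw [← Submodule.topologicalClosure_coe, hS]; trivial
    exact hcl.closure_subset_iff.2 (fun e he => h1 e he) hx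
  have h3 := h2 (v s' - v s)
  rw [inner_self_eq_norm_sq_to_K] at h3
  simp only [norm_pow, RCLike.norm_ofReal, abs_norm] at h3
  have hC0 : 0 ≤ C := (norm_nonneg _).trans (hC s hs)
  by_cases h0 : ‖v s' - v s‖ = 0
  · rw [h0]; positivity
  · have : 0 < ‖v s' - v s‖ := lt_of_le_of_ne (norm_nonneg _) (Ne.symm h0)
    nlinarith

/-- A curve that has a bounded derivative when tested against a total set is weakly
differentiable. -/
theorem hasDerivAt_inner_of_weak_deriv (hS : (Submodule.span ℂ S).topologicalClosure = ⊤)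
    (hr : 0 < r) (hC : ∀ s ∈ Metric.ball t r, ‖h s‖ ≤ C)
    (hd : ∀ e ∈ S, ∀ s ∈ Metric.ball t r,
      HasDerivAt (fun s => inner ℂ e (v s)) (inner ℂ e (h s)) s) (x : H) :
    HasDerivAt (fun s => inner ℂ x (v s)) (inner ℂ x (h t)) t := by
  rw [hasDerivAt_iff_isLittleO, Asymptotics.isLittleO_iff]
  intro ε hε
  have ht : t ∈ Metric.ball t r := Metric.mem_ball_self hr
  have hC0 : 0 ≤ C := (norm_nonneg _).trans (hC t ht)
  have hx : x ∈ closure (Submodule.span ℂ S : Set H) := by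
    rw [← Submodule.topologicalClosure_coe, hS]; trivial
  obtain ⟨e, he, hxe⟩ := Metric.mem_closure_iff.1 hx (ε / (2 * (2 * C + 1))) (by positivity)
  rw [dist_eq_norm] at hxe
  have h1 := hasDerivAt_inner_of_mem_span hd e he t ht
  rw [hasDerivAt_iff_isLittleO, Asymptotics.isLittleO_iff] at h1
  filter_upwards [h1 (half_pos hε), Metric.ball_mem_nhds t hr] with s hs hsb
  simp only [Complex.real_smul] at hs ⊢
  have hL := norm_sub_le_of_weak_deriv hS hC hd ht hsb
  rw [← Real.norm_eq_abs] at hL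
  have hsplit : inner ℂ x (v s) - inner ℂ x (v t) - ((s - t : ℝ) : ℂ) * inner ℂ x (h t) =
      (inner ℂ e (v s) - inner ℂ e (v t) - ((s - t : ℝ) : ℂ) * inner ℂ e (h t)) +
        (inner ℂ (x - e) (v s - v t) - ((s - t : ℝ) : ℂ) * inner ℂ (x - e) (h t)) := by
    simp only [inner_sub_left, inner_sub_right]; ring
  rw [hsplit]
  have h3 : ‖inner ℂ (x - e) (v s - v t)‖ ≤ ‖x - e‖ * (C * ‖s - t‖) :=
    (norm_inner_le_norm _ _).trans (by gcongr)
  have h4 : ‖((s - t : ℝ) : ℂ) * inner ℂ (x - e) (h t)‖ ≤ ‖s - t‖ * (‖x - e‖ * C) := by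
    rw [norm_mul, Complex.norm_real]
    gcongr
    exact (norm_inner_le_norm _ _).trans (by gcongr; exact hC t ht)
  have h5 : ‖x - e‖ * (2 * C) ≤ ε / 2 := by
    calc ‖x - e‖ * (2 * C) ≤ ε / (2 * (2 * C + 1)) * (2 * C + 1) := by gcongr; linarith
      _ = ε / 2 := by field_simp
  calc _ ≤ ε / 2 * ‖s - t‖ + (‖x - e‖ * (C * ‖s - t‖) + ‖s - t‖ * (‖x - e‖ * C)) :=
        (norm_add_le _ _).trans (add_le_add hs ((norm_sub_le _ _).trans (add_le_add h3 h4)))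
    _ = ε / 2 * ‖s - t‖ + (‖x - e‖ * (2 * C)) * ‖s - t‖ := by ring
    _ ≤ ε / 2 * ‖s - t‖ + ε / 2 * ‖s - t‖ := by gcongr
    _ = ε * ‖s - t‖ := by ring

end Hilbert

section Quadratic
variable {α : Type*} [MeasurableSpace α] {ν : Measure α}

theorem inner_toLp {f g : α → ℂ} (hf : MemLp f 2 ν) (hg : MemLp g 2 ν) :
    inner ℂ (hf.toLp f) (hg.toLp g) = ∫ p, (starRingEnd ℂ) (f p) * g p ∂ν := by
  rw [L2.inner_def]
  refine integral_congr_ae ?_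
  filter_upwards [hf.coeFn_toLp, hg.coeFn_toLp] with p h1 h2
  rw [h1, h2, RCLike.inner_apply, mul_comm]

theorem norm_toLp_sq {f : α → ℂ} (hf : MemLp f 2 ν) :
    ‖hf.toLp f‖ ^ 2 = ∫ p, ‖f p‖ ^ 2 ∂ν := by
  have h := inner_toLp hf hf
  rw [inner_self_eq_norm_sq_to_K] at h
  have h2 : ∀ p, (starRingEnd ℂ) (f p) * f p = ((‖f p‖ ^ 2 : ℝ) : ℂ) := fun p => by
    rw [Complex.conj_mul']; push_cast; rfl
  simp only [h2] at h
  rw [integral_complex_ofReal] at h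
  apply Complex.ofReal_injective
  rw [← h]
  push_cast
  rfl

theorem hasDerivAt_zero_of_abs_le_sq {R : ℝ → ℝ} {t r K : ℝ} (hr : 0 < r)
    (h : ∀ s ∈ Metric.ball t r, |R s| ≤ K * |s - t| ^ 2) : HasDerivAt R 0 t := by
  have hO : R =O[nhds t] fun s => ‖s - t‖ ^ 2 := by
    refine Asymptotics.IsBigO.of_bound K ?_
    filter_upwards [Metric.ball_mem_nhds t hr] with s hs
    simpa [Real.norm_eq_abs] using h s hs
  have := (hO.hasFDerivAt (𝕜 := ℝ) (by norm_num)).hasDerivAt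
  simpa using this

theorem integrable_weight_mul_conj_mul {a : α → ℝ} {f g : α → ℂ} {A : ℝ}
    (ha : AEStronglyMeasurable a ν) (hA : ∀ p, |a p| ≤ A) (hf : MemLp f 2 ν) (hg : MemLp g 2 ν) :
    Integrable (fun p => (starRingEnd ℂ) ((a p : ℂ) * f p) * g p) ν := by
  have hm : MemLp (fun p => (a p : ℂ) * f p) 2 ν :=
    hf.of_le_mul (c := A) ((Complex.continuous_ofReal.comp_aestronglyMeasurable ha).mul hf.1)
      (Filter.Eventually.of_forall fun p => by
        rw [norm_mul, Complex.norm_real, Real.norm_eq_abs]; gcongr; exact hA p)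
  have hm' : MemLp (fun p => (starRingEnd ℂ) ((a p : ℂ) * f p)) 2 ν :=
    hm.of_le (Complex.continuous_conj.comp_aestronglyMeasurable hm.1)
      (Filter.Eventually.of_forall fun p => by rw [RCLike.norm_conj])
  exact hm'.integrable_mul hg

/-- Let `V` be a curve in `L²` that, tested against every member of a total family, has the
derivative `Z`, where `Z` is locally bounded in `L²`. For weights `a` that are bounded, Lipschitz
and pointwise differentiable in time, `∫ a |V|²` can be differentiated by the product rule. No
continuity or joint measurability of `Z` in time is needed: the quadratic remainder is controlled
by the Lipschitz bound, and the linear part by weak differentiability. -/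
theorem hasDerivAt_integral_weight_mul_sq {𝓔 : Set (α → ℂ)} (h𝓔 : ∀ e ∈ 𝓔, MemLp e 2 ν)
    (htot : ∀ g : α → ℂ, MemLp g 2 ν → (∀ e ∈ 𝓔, ∫ p, (starRingEnd ℂ) (e p) * g p ∂ν = 0) →
      g =ᵐ[ν] 0)
    {V Z : ℝ → α → ℂ} {t r : ℝ} (hr : 0 < r)
    (hV : ∀ s ∈ Metric.ball t r, MemLp (V s) 2 ν) (hZ : ∀ s ∈ Metric.ball t r, MemLp (Z s) 2 ν)
    {C : ℝ} (hC : ∀ s ∈ Metric.ball t r, ∫ p, ‖Z s p‖ ^ 2 ∂ν ≤ C)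
    (hd : ∀ e ∈ 𝓔, ∀ s ∈ Metric.ball t r,
      HasDerivAt (fun s => ∫ p, (starRingEnd ℂ) (e p) * V s p ∂ν)
        (∫ p, (starRingEnd ℂ) (e p) * Z s p ∂ν) s)
    {a : ℝ → α → ℝ} {a' : α → ℝ} {A : ℝ} (hA0 : 0 ≤ A)
    (ham : ∀ s ∈ Metric.ball t r, AEStronglyMeasurable (a s) ν) (ham' : AEStronglyMeasurable a' ν)
    (haA : ∀ s ∈ Metric.ball t r, ∀ p, |a s p| ≤ A)
    (haL : ∀ s ∈ Metric.ball t r, ∀ s' ∈ Metric.ball t r, ∀ p, |a s p - a s' p| ≤ A * |s - s'|)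
    (had : ∀ p, HasDerivAt (fun s => a s p) (a' p) t) :
    HasDerivAt (fun s => ∫ p, a s p * ‖V s p‖ ^ 2 ∂ν)
      (∫ p, a' p * ‖V t p‖ ^ 2 ∂ν +
        2 * ∫ p, a t p * ((starRingEnd ℂ) (V t p) * Z t p).re ∂ν) t := by
  classical
  have ht : t ∈ Metric.ball t r := Metric.mem_ball_self hr
  have hnb := Metric.ball_mem_nhds t hr
  -- the curve in the Hilbert space `L²`
  let S : Set (Lp ℂ 2 ν) := {x | ∃ e, ∃ he : e ∈ 𝓔, x = (h𝓔 e he).toLp e}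
  let v : ℝ → Lp ℂ 2 ν := fun s => if hs : s ∈ Metric.ball t r then (hV s hs).toLp (V s) else 0
  let z : ℝ → Lp ℂ 2 ν := fun s => if hs : s ∈ Metric.ball t r then (hZ s hs).toLp (Z s) else 0
  have hv : ∀ s (hs : s ∈ Metric.ball t r), v s = (hV s hs).toLp (V s) := fun s hs => dif_pos hs
  have hz : ∀ s (hs : s ∈ Metric.ball t r), z s = (hZ s hs).toLp (Z s) := fun s hs => dif_pos hs
  have hS : (Submodule.span ℂ S).topologicalClosure = ⊤ := by
    rw [Submodule.topologicalClosure_eq_top_iff, Submodule.eq_bot_iff]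
    intro g hg
    rw [Submodule.mem_orthogonal] at hg
    have h0 : (g : α → ℂ) =ᵐ[ν] 0 := by
      refine htot g (Lp.memLp g) fun e he => ?_
      have h1 := hg _ (Submodule.subset_span ⟨e, he, rfl⟩)
      rw [← Lp.toLp_coeFn g (Lp.memLp g), inner_toLp] at h1
      exact h1
    exact (Lp.eq_zero_iff_ae_eq_zero).2 h0
  have hzC : ∀ s ∈ Metric.ball t r, ‖z s‖ ≤ Real.sqrt C := fun s hs => by
    rw [hz s hs]
    apply Real.le_sqrt_of_sq_le
    rw [norm_toLp_sq]
    exact hC s hs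
  have hdS : ∀ x ∈ S, ∀ s ∈ Metric.ball t r,
      HasDerivAt (fun s => inner ℂ x (v s)) (inner ℂ x (z s)) s := by
    rintro x ⟨e, he, rfl⟩ s hs
    rw [hz s hs, inner_toLp]
    refine (hd e he s hs).congr_of_eventuallyEq ?_
    filter_upwards [Metric.isOpen_ball.mem_nhds hs] with s' hs'
    rw [hv s' hs', inner_toLp]
  have hMa : MemLp (fun p => (a t p : ℂ) * V t p) 2 ν :=
    (hV t ht).of_le_mul (c := A)
      ((Complex.continuous_ofReal.comp_aestronglyMeasurable (ham t ht)).mul (hV t ht).1)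
      (Filter.Eventually.of_forall fun p => by
        rw [norm_mul, Complex.norm_real, Real.norm_eq_abs]; gcongr; exact haA t ht p)
  -- the linear part
  have hlin : HasDerivAt (fun s => 2 * (∫ p, (starRingEnd ℂ) ((a t p : ℂ) * V t p) * V s p ∂ν).re)
      (2 * ∫ p, a t p * ((starRingEnd ℂ) (V t p) * Z t p).re ∂ν) t := by
    have h1 := hasDerivAt_inner_of_weak_deriv hS hr hzC hdS (hMa.toLp _)
    have h2 := Complex.reCLM.hasFDerivAt.comp_hasDerivAt t h1
    rw [hz t ht, inner_toLp] at h2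
    have h3 : (∫ p, (starRingEnd ℂ) ((a t p : ℂ) * V t p) * Z t p ∂ν).re =
        ∫ p, a t p * ((starRingEnd ℂ) (V t p) * Z t p).re ∂ν := by
      have hi := integrable_weight_mul_conj_mul (ham t ht) (haA t ht) (hV t ht) (hZ t ht)
      have := integral_re hi
      simp only [RCLike.re_eq_complex_re] at this
      rw [← this]
      congr 1; ext p
      rw [map_mul, Complex.conj_ofReal, mul_assoc, Complex.re_ofReal_mul]
    rw [← h3]
    refine HasDerivAt.const_mul 2 (HasDerivAt.congr_of_eventuallyEq h2 ?_)
    filter_upwards [hnb] with s hs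
    simp only [Function.comp, Complex.reCLM_apply]
    rw [hv s hs, inner_toLp]
  -- the part where only the weight moves
  have hVsq : ∀ s ∈ Metric.ball t r, Integrable (fun p => ‖V s p‖ ^ 2) ν := fun s hs =>
    (hV s hs).integrable_norm_pow (by norm_num)
  have hIa : ∀ s ∈ Metric.ball t r, ∀ s' ∈ Metric.ball t r,
      Integrable (fun p => a s p * ‖V s' p‖ ^ 2) ν := fun s hs s' hs' =>
    (hVsq s' hs').bdd_mul (c := A) (ham s hs)
      (Filter.Eventually.of_forall fun p => by rw [Real.norm_eq_abs]; exact haA s hs p)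
  have hwt : HasDerivAt (fun s => ∫ p, a s p * ‖V t p‖ ^ 2 ∂ν) (∫ p, a' p * ‖V t p‖ ^ 2 ∂ν) t := by
    refine (hasDerivAt_integral_of_dominated_loc_of_lip (F := fun s p => a s p * ‖V t p‖ ^ 2)
      (F' := fun p => a' p * ‖V t p‖ ^ 2) (bound := fun p => A * ‖V t p‖ ^ 2) hnb ?_
      (hIa t ht t ht) (ham'.mul ((hV t ht).1.norm.pow 2)) ?_ ((hVsq t ht).const_mul A) ?_).2
    · filter_upwards [hnb] with s hs
      exact (ham s hs).mul ((hV t ht).1.norm.pow 2)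
    · refine Filter.Eventually.of_forall fun p => ?_
      rw [lipschitzOnWith_iff_dist_le_mul]
      intro s hs s' hs'
      rw [Real.dist_eq, Real.dist_eq, ← sub_mul, abs_mul, abs_of_nonneg (sq_nonneg ‖V t p‖),
        Real.coe_nnabs, abs_of_nonneg (by positivity : 0 ≤ A * ‖V t p‖ ^ 2)]
      calc _ ≤ A * |s - s'| * ‖V t p‖ ^ 2 := by gcongr; exact haL s hs s' hs' p
        _ = _ := by ring
    · exact Filter.Eventually.of_forall fun p => (had p).mul_const _
  -- the quadratic remainder
  let R : ℝ → ℝ := fun s => ∫ p, (a s p * ‖V s p‖ ^ 2 - a s p * ‖V t p‖ ^ 2 -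
    2 * (((starRingEnd ℂ) ((a t p : ℂ) * V t p) * V s p).re -
      ((starRingEnd ℂ) ((a t p : ℂ) * V t p) * V t p).re)) ∂ν
  have hRbound : ∀ s ∈ Metric.ball t r,
      |R s| ≤ (A * ∫ p, ‖V t p‖ ^ 2 ∂ν + 2 * A * Real.sqrt C ^ 2) * |s - t| ^ 2 := by
    intro s hs
    have hD : MemLp (fun p => V s p - V t p) 2 ν := (hV s hs).sub (hV t ht)
    have hDsq : ∫ p, ‖V s p - V t p‖ ^ 2 ∂ν ≤ (Real.sqrt C * |s - t|) ^ 2 := by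
      have h1 := norm_sub_le_of_weak_deriv hS hzC hdS ht hs
      rw [hv s hs, hv t ht, ← MemLp.toLp_sub] at h1
      have h2 := norm_toLp_sq ((hV s hs).sub (hV t ht))
      simp only [Pi.sub_apply] at h2
      rw [← h2]
      gcongr
    have hDi : Integrable (fun p => ‖V s p - V t p‖ ^ 2) ν := hD.integrable_norm_pow (by norm_num)
    calc |R s| ≤ ∫ p, (A * |s - t| ^ 2 * ‖V t p‖ ^ 2 + 2 * A * ‖V s p - V t p‖ ^ 2) ∂ν := by
          rw [← Real.norm_eq_abs]
          refine norm_integral_le_of_norm_le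
            (((hVsq t ht).const_mul _).add (hDi.const_mul _)) (Filter.Eventually.of_forall fun p => ?_)
          rw [Real.norm_eq_abs]
          have hid : a s p * ‖V s p‖ ^ 2 - a s p * ‖V t p‖ ^ 2 -
              2 * (((starRingEnd ℂ) ((a t p : ℂ) * V t p) * V s p).re -
                ((starRingEnd ℂ) ((a t p : ℂ) * V t p) * V t p).re) =
              a s p * ‖V s p - V t p‖ ^ 2 + 2 * ((a s p - a t p) *
                ((starRingEnd ℂ) (V t p) * (V s p - V t p)).re) := by
            rw [map_mul, Complex.conj_ofReal, mul_assoc, mul_assoc, Complex.re_ofReal_mul,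
              Complex.re_ofReal_mul, Complex.sq_norm, Complex.sq_norm, Complex.sq_norm,
              Complex.normSq_apply, Complex.normSq_apply, Complex.normSq_apply]
            simp only [Complex.sub_re, Complex.sub_im, Complex.mul_re, Complex.conj_re,
              Complex.conj_im]
            ring
          rw [hid]
          have hb1 : |a s p * ‖V s p - V t p‖ ^ 2| ≤ A * ‖V s p - V t p‖ ^ 2 := by
            rw [abs_mul, abs_of_nonneg (sq_nonneg ‖V s p - V t p‖)]
            gcongr; exact haA s hs p
          have hb2 : |(a s p - a t p) * ((starRingEnd ℂ) (V t p) * (V s p - V t p)).re| ≤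
              A * |s - t| * (‖V t p‖ * ‖V s p - V t p‖) := by
            rw [abs_mul]
            gcongr
            · exact haL s hs t ht p
            · refine (Complex.abs_re_le_norm _).trans ?_
              rw [norm_mul, RCLike.norm_conj]
          have hb3 : 2 * (|s - t| * (‖V t p‖ * ‖V s p - V t p‖)) ≤
              |s - t| ^ 2 * ‖V t p‖ ^ 2 + ‖V s p - V t p‖ ^ 2 := by
            nlinarith [sq_nonneg (|s - t| * ‖V t p‖ - ‖V s p - V t p‖)]
          calc _ ≤ A * ‖V s p - V t p‖ ^ 2 + 2 * (A * |s - t| * (‖V t p‖ * ‖V s p - V t p‖)) := by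
                refine (abs_add_le _ _).trans (add_le_add hb1 ?_)
                rw [abs_mul, abs_of_pos (by norm_num : (0 : ℝ) < 2)]
                gcongr
            _ = A * ‖V s p - V t p‖ ^ 2 + A * (2 * (|s - t| * (‖V t p‖ * ‖V s p - V t p‖))) := by
                ring
            _ ≤ A * ‖V s p - V t p‖ ^ 2 + A * (|s - t| ^ 2 * ‖V t p‖ ^ 2 + ‖V s p - V t p‖ ^ 2) := by
                gcongr
            _ = _ := by ring
      _ = A * |s - t| ^ 2 * ∫ p, ‖V t p‖ ^ 2 ∂ν + 2 * A * ∫ p, ‖V s p - V t p‖ ^ 2 ∂ν := by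
          rw [integral_add ((hVsq t ht).const_mul _) (hDi.const_mul _), integral_const_mul,
            integral_const_mul]
      _ ≤ A * |s - t| ^ 2 * ∫ p, ‖V t p‖ ^ 2 ∂ν + 2 * A * (Real.sqrt C * |s - t|) ^ 2 := by gcongr
      _ = _ := by ring
  have hR := hasDerivAt_zero_of_abs_le_sq hr hRbound
  have hsum := (hwt.add hlin).add hR
  rw [add_zero] at hsum
  refine (hsum.sub_const (2 * (∫ p, (starRingEnd ℂ) ((a t p : ℂ) * V t p) * V t p ∂ν).re)).congr_of_eventuallyEq ?_
  filter_upwards [hnb] with s hs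
  have hi1 := integrable_weight_mul_conj_mul (ham t ht) (haA t ht) (hV t ht) (hV s hs)
  have hi2 := integrable_weight_mul_conj_mul (ham t ht) (haA t ht) (hV t ht) (hV t ht)
  have e1 := integral_re hi1
  have e2 := integral_re hi2
  simp only [RCLike.re_eq_complex_re] at e1 e2
  have h5 : R s = ∫ p, a s p * ‖V s p‖ ^ 2 ∂ν - ∫ p, a s p * ‖V t p‖ ^ 2 ∂ν -
      2 * (∫ p, ((starRingEnd ℂ) ((a t p : ℂ) * V t p) * V s p).re ∂ν -
        ∫ p, ((starRingEnd ℂ) ((a t p : ℂ) * V t p) * V t p).re ∂ν) := by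
    have r1 : Integrable (fun p => ((starRingEnd ℂ) ((a t p : ℂ) * V t p) * V s p).re) ν := hi1.re
    have r2 : Integrable (fun p => ((starRingEnd ℂ) ((a t p : ℂ) * V t p) * V t p).re) ν := hi2.re
    rw [← integral_sub r1 r2, ← integral_const_mul, ← integral_sub (hIa s hs s hs) (hIa s hs t ht),
      ← integral_sub]
    · exact (hIa s hs s hs).sub (hIa s hs t ht)
    · exact (r1.sub r2).const_mul 2
  simp only [Pi.add_apply]
  rw [h5, e1, e2]
  ring

end Quadratic

/-! ### The moving frame -/

/-- The shear `(k, ζ) ↦ (k, ζ - sk)` of frequency space, which undoes transport by the Couette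
flow over time `s`. -/
def shear (s : ℝ) : ℤ × ℝ ≃ᵐ ℤ × ℝ where
  toFun p := (p.1, p.2 - s * p.1)
  invFun p := (p.1, p.2 + s * p.1)
  left_inv p := by simp
  right_inv p := by simp
  measurable_toFun := measurable_from_prod_countable_right fun k => by
    simp only [Equiv.coe_fn_mk]; fun_prop
  measurable_invFun := measurable_from_prod_countable_right fun k => by
    simp only [Equiv.coe_fn_symm_mk]; fun_prop

@[simp] theorem shear_apply (s : ℝ) (p : ℤ × ℝ) : shear s p = (p.1, p.2 - s * p.1) := rfl
theorem measurePreserving_shear (s : ℝ) : MeasurePreserving (shear s) freqMeasure freqMeasure := by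
  unfold freqMeasure
  refine MeasurePreserving.skew_product (f := fun k : ℤ => k) (g := fun k ξ => ξ - s * k)
    (MeasurePreserving.id _) ?_ ?_
  · exact (shear s).measurable.snd
  · exact Filter.Eventually.of_forall fun k => (measurePreserving_sub_right volume (s * k)).map_eq

theorem bracket_le_shear {s R : ℝ} (hs : |s| ≤ R) (p : ℤ × ℝ) :
    bracket p ≤ (2 + 2 * R ^ 2) * bracket (shear s p) := by
  have h : s ^ 2 ≤ R ^ 2 := sq_le_sq' (by linarith [neg_abs_le s]) ((le_abs_self s).trans hs)
  simp only [shear_apply, bracket]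
  have h1 := mul_le_mul_of_nonneg_right h (sq_nonneg (p.1 : ℝ))
  nlinarith [sq_nonneg (p.2 - 2 * (s * p.1)), sq_nonneg (p.1 : ℝ), sq_nonneg (p.2 - s * p.1), sq_nonneg R,
    mul_nonneg (sq_nonneg R) (sq_nonneg (p.2 - s * p.1))]

/-- In the frame that moves with the flow, the Fourier transform is composed with the shear. -/
theorem invFourier_shear (F : ℤ × ℝ → ℂ) (s x y : ℝ) :
    invFourier (fun p => F (shear s p)) x y = invFourier F (x + s * y) y := by
  unfold invFourier
  congr 1
  rw [← (measurePreserving_shear s).integral_comp' (f := shear s)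
    (fun p => F p * wave (x + s * y) y p)]
  refine integral_congr_ae (Filter.Eventually.of_forall fun p => ?_)
  simp only [shear_apply, wave]
  congr 3; push_cast; ring

theorem RapidOn.comp_shear {I : Set ℝ} {F : ℝ → ℤ × ℝ → ℂ} (hF : RapidOn I F) {R : ℝ}
    (hR : ∀ s ∈ I, |s| ≤ R) : RapidOn I fun s p => F s (shear s p) := by
  refine ⟨fun s hs => (hF.1 s hs).comp_measurePreserving (measurePreserving_shear s), fun n => ?_⟩
  obtain ⟨C, hC⟩ := hF.2 n
  refine ⟨((2 + 2 * R ^ 2) ^ n).toNNReal * C, fun s hs => ?_⟩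
  have hm : AEMeasurable (fun p => ENNReal.ofReal (bracket p ^ n) * ‖F s p‖ₑ ^ 2) freqMeasure :=
    ((measurable_bracket.pow_const n).ennreal_ofReal).aemeasurable.mul ((hF.1 s hs).enorm.pow_const 2)
  calc sobolevE n (fun p => F s (shear s p))
      ≤ ∫⁻ p, ENNReal.ofReal ((2 + 2 * R ^ 2) ^ n) *
          (ENNReal.ofReal (bracket (shear s p) ^ n) * ‖F s (shear s p)‖ₑ ^ 2) ∂freqMeasure := by
        refine lintegral_mono fun p => ?_
        rw [← mul_assoc, ← ENNReal.ofReal_mul (by positivity), ← mul_pow]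
        gcongr
        · exact (bracket_pos p).le
        · exact bracket_le_shear (hR s hs) p
    _ = ENNReal.ofReal ((2 + 2 * R ^ 2) ^ n) * sobolevE n (F s) := by
        rw [lintegral_const_mul' _ _ ENNReal.ofReal_ne_top]
        congr 1
        exact (measurePreserving_shear s).lintegral_comp_emb (shear s).measurableEmbedding
          (fun p => ENNReal.ofReal (bracket p ^ n) * ‖F s p‖ₑ ^ 2)
    _ ≤ _ := by push_cast; gcongr; exacts [le_rfl, hC s hs]

theorem Rapid.memLp_pow_mul {F : ℤ × ℝ → ℂ} (hF : Rapid F) (j : ℕ) :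
    MemLp (fun p => ((bracket p ^ j : ℝ) : ℂ) * F p) 2 freqMeasure := by
  have hm : AEStronglyMeasurable (fun p => ((bracket p ^ j : ℝ) : ℂ) * F p) freqMeasure :=
    (Complex.measurable_ofReal.comp (measurable_bracket.pow_const j)).aestronglyMeasurable.mul hF.aesm
  rw [memLp_two_iff_integrable_sq_norm hm]
  refine (hF.integrable_sq (2 * j)).congr (Filter.Eventually.of_forall fun p => ?_)
  simp only
  rw [norm_mul, Complex.norm_real, Real.norm_of_nonneg (pow_nonneg (bracket_pos p).le j)]
  ring

theorem memLp_inv_bracket {j : ℕ} (hj : 1 ≤ j) :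
    MemLp (fun p => ((bracket p ^ j)⁻¹ : ℝ)) 2 freqMeasure := by
  have hm : AEStronglyMeasurable (fun p => ((bracket p ^ j)⁻¹ : ℝ)) freqMeasure :=
    (measurable_bracket.pow_const j).inv.aestronglyMeasurable
  rw [memLp_two_iff_integrable_sq hm]
  refine ⟨hm.pow 2, ?_⟩
  refine lt_of_le_of_lt (lintegral_mono fun p => ?_)
    (lintegral_bracket_rpow_lt_top (q := 2) (by norm_num))
  have hJ := bracket_pos p
  rw [Real.enorm_of_nonneg (by positivity)]
  apply ENNReal.ofReal_le_ofReal
  simp only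
  rw [Real.rpow_neg hJ.le, inv_pow]
  apply inv_anti₀ (by positivity)
  have : bracket p ^ (2 : ℝ) = bracket p ^ 2 := by norm_cast
  rw [this, ← pow_mul]
  exact pow_le_pow_right₀ (one_le_bracket p) (by omega)

/-- The Fourier transform of a solution of `∂ₜf + y∂ₓf = g` is, in the moving frame, weakly
differentiable in time, so that weighted `L²` energies can be differentiated. The weight `β s` is
prescribed in the fixed frame, and its regularity is measured along the characteristics
`s ↦ shear s p`. -/
theorem hasDerivAt_integral_transport {T : ℝ} {f : ℝ → ℝ → ℝ → ℝ} {F G : ℝ → ℤ × ℝ → ℂ}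
    (hf : IsRegular T f F) (hG : ∀ a b : ℝ, 0 < a → b < T → RapidOn (Icc a b) G)
    (heq : ∀ t ∈ Ioo 0 T, ∀ x y, ((dt f t x y + y * dx (f t) x y : ℝ) : ℂ) = invFourier (G t) x y)
    {β : ℝ → ℤ × ℝ → ℝ} {β' : ℝ → ℤ × ℝ → ℝ} {t A r₀ : ℝ} {j : ℕ} (ht : t ∈ Ioo 0 T) (hA : 0 ≤ A)
    (hr₀ : 0 < r₀)
    (hβm : ∀ s, Measurable (β s)) (hβm' : Measurable (β' t))
    (hβd : ∀ p, ∀ s, HasDerivAt (fun s => β s (shear s p)) (β' s (shear s p)) s)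
    (hβA : ∀ s ∈ Metric.ball t r₀, ∀ p, |β s (shear s p)| ≤ A * bracket p ^ j)
    (hβA' : ∀ s ∈ Metric.ball t r₀, ∀ p, |β' s (shear s p)| ≤ A * bracket p ^ j) :
    HasDerivAt (fun s => ∫ p, β s p * ‖F s p‖ ^ 2 ∂freqMeasure)
      (∫ p, β' t p * ‖F t p‖ ^ 2 ∂freqMeasure +
        2 * ∫ p, β t p * ((starRingEnd ℂ) (F t p) * G t p).re ∂freqMeasure) t := by
  obtain ⟨r, hr, hrr₀, hrt⟩ : ∃ r, 0 < r ∧ r ≤ r₀ ∧ Icc (t - r) (t + r) ⊆ Ioo 0 T := by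
    refine ⟨min r₀ (min (t / 2) ((T - t) / 2)), ?_, min_le_left _ _, fun s hs => ?_⟩
    · have := ht.1; have := ht.2
      exact lt_min hr₀ (lt_min (by linarith) (by linarith))
    · have h1 : min r₀ (min (t / 2) ((T - t) / 2)) ≤ t / 2 := (min_le_right _ _).trans (min_le_left _ _)
      have h2 : min r₀ (min (t / 2) ((T - t) / 2)) ≤ (T - t) / 2 :=
        (min_le_right _ _).trans (min_le_right _ _)
      have := ht.1; have := ht.2
      exact ⟨by linarith [hs.1], by linarith [hs.2]⟩
  have hsub : ∀ s ∈ Metric.ball t r, s ∈ Icc (t - r) (t + r) := fun s hs => by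
    rw [Real.ball_eq_Ioo] at hs; exact ⟨hs.1.le, hs.2.le⟩
  have hT : ∀ s ∈ Metric.ball t r, s ∈ Ioo 0 T := fun s hs => hrt (hsub s hs)
  have h0 : 0 < t - r := (hrt ⟨le_rfl, by linarith⟩).1
  have h1 : t + r < T := (hrt ⟨by linarith, le_rfl⟩).2
  have hbd : ∀ s ∈ Icc (t - r) (t + r), |s| ≤ t + r := fun s hs => by
    rw [abs_of_pos (by linarith [hs.1])]; exact hs.2
  have hFS := (hf.rapidOn h0 h1).comp_shear hbd
  have hGS := (hG _ _ h0 h1).comp_shear hbd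
  -- weights that make the polynomially growing `β` bounded
  let J : ℤ × ℝ → ℝ := fun p => bracket p ^ (j + 1)
  have hJ : ∀ p, 0 < J p := fun p => pow_pos (bracket_pos p) _
  have hJj : ∀ p, bracket p ^ j ≤ J p ^ 2 := fun p => by
    simp only [J]; rw [← pow_mul]
    exact pow_le_pow_right₀ (one_le_bracket p) (by omega)
  have hJm : Measurable J := measurable_bracket.pow_const _
  have hmem : MemLp (fun p => ((J p)⁻¹ : ℝ)) 2 freqMeasure := memLp_inv_bracket (by omega)
  let E : ℝ → ℝ → ℤ × ℝ → ℂ := fun x y p => ((J p)⁻¹ : ℝ) * (starRingEnd ℂ) (wave x y p)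
  have hE : ∀ x y, MemLp (E x y) 2 freqMeasure := fun x y =>
    hmem.of_le ((Complex.measurable_ofReal.comp hJm.inv).mul
      (Complex.continuous_conj.measurable.comp (measurable_wave x y))).aestronglyMeasurable
      (Filter.Eventually.of_forall fun p => by
        simp only [E]
        rw [norm_mul, RCLike.norm_conj, norm_wave, mul_one, Complex.norm_real])
  have hEV : ∀ x y (g : ℤ × ℝ → ℂ), ∫ p, (starRingEnd ℂ) (E x y p) * ((J p : ℂ) * g p) ∂freqMeasure =
      (2 * Real.pi : ℝ) * invFourier g x y := fun x y g => by
    have hpi : ((2 * Real.pi : ℝ) : ℂ) ≠ 0 := by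
      exact_mod_cast (by positivity : (2 * Real.pi : ℝ) ≠ 0)
    unfold invFourier
    rw [mul_inv_cancel_left₀ hpi]
    refine integral_congr_ae (Filter.Eventually.of_forall fun p => ?_)
    simp only [E, map_mul, Complex.conj_conj, Complex.conj_ofReal]
    have : (J p : ℂ) ≠ 0 := by exact_mod_cast (hJ p).ne'
    push_cast
    field_simp
  obtain ⟨C, hC⟩ := hGS.2 (2 * (j + 1))
  have key := hasDerivAt_integral_weight_mul_sq (ν := freqMeasure)
    (𝓔 := {e | ∃ x y, e = E x y})
    (V := fun s p => (J p : ℂ) * F s (shear s p)) (Z := fun s p => (J p : ℂ) * G s (shear s p))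
    (a := fun s p => β s (shear s p) / J p ^ 2) (a' := fun p => β' t (shear t p) / J p ^ 2)
    (t := t) (r := r) (C := C) (A := A)
    (by rintro e ⟨x, y, rfl⟩; exact hE x y) ?_ hr
    (fun s hs => (hFS.rapid (hsub s hs)).memLp_pow_mul (j + 1))
    (fun s hs => (hGS.rapid (hsub s hs)).memLp_pow_mul (j + 1)) ?_ ?_ hA
    (fun s hs => (((hβm s).comp (shear s).measurable).div (hJm.pow_const 2)).aestronglyMeasurable)
    (((hβm').comp (shear t).measurable).div (hJm.pow_const 2)).aestronglyMeasurable ?_ ?_ ?_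
  · -- undo the change of frame
    have hcv : ∀ (s : ℝ) (g : ℤ × ℝ → ℝ), ∫ p, g (shear s p) ∂freqMeasure = ∫ p, g p ∂freqMeasure :=
      fun s g => (measurePreserving_shear s).integral_comp' g
    have e1 : ∀ (s : ℝ) (p : ℤ × ℝ) (b : ℝ), b / J p ^ 2 * ‖(J p : ℂ) * F s (shear s p)‖ ^ 2 =
        b * ‖F s (shear s p)‖ ^ 2 := fun s p b => by
      have := (hJ p).ne'
      rw [norm_mul, Complex.norm_real, Real.norm_of_nonneg (hJ p).le]
      field_simp
    have e2 : ∀ p : ℤ × ℝ, β t (shear t p) / J p ^ 2 *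
        ((starRingEnd ℂ) ((J p : ℂ) * F t (shear t p)) * ((J p : ℂ) * G t (shear t p))).re =
        β t (shear t p) * ((starRingEnd ℂ) (F t (shear t p)) * G t (shear t p)).re := fun p => by
      have := (hJ p).ne'
      have e3 : (starRingEnd ℂ) ((J p : ℂ) * F t (shear t p)) * ((J p : ℂ) * G t (shear t p)) =
          ((J p ^ 2 : ℝ) : ℂ) * ((starRingEnd ℂ) (F t (shear t p)) * G t (shear t p)) := by
        rw [map_mul, Complex.conj_ofReal]; push_cast; ring
      rw [e3, Complex.re_ofReal_mul]
      field_simp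
    simp only [e1, e2] at key
    rw [← hcv t (fun p => β' t p * ‖F t p‖ ^ 2),
      ← hcv t (fun p => β t p * ((starRingEnd ℂ) (F t p) * G t p).re)]
    refine key.congr_of_eventuallyEq (Filter.Eventually.of_forall fun s => ?_)
    exact (hcv s (fun p => β s p * ‖F s p‖ ^ 2)).symm
  · -- the plane waves are total
    intro g hg horth
    have hgi : Integrable (fun p => ((J p)⁻¹ : ℂ) * g p) freqMeasure := by
      have := (hmem.ofReal (K := ℂ)).integrable_mul hg
      refine this.congr (Filter.Eventually.of_forall fun p => ?_)
      simp
    have h0 := ae_eq_zero_of_invFourier hgi fun x y => by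
      have h2 := horth (E x y) ⟨x, y, rfl⟩
      have h3 := hEV x y (fun p => ((J p)⁻¹ : ℂ) * g p)
      have h4 : ∀ p, (J p : ℂ) * (((J p)⁻¹ : ℂ) * g p) = g p := fun p => by
        rw [mul_inv_cancel_left₀]; exact_mod_cast (hJ p).ne'
      simp only [h4, h2] at h3
      have hpi : ((2 * Real.pi : ℝ) : ℂ) ≠ 0 := by
        exact_mod_cast (by positivity : (2 * Real.pi : ℝ) ≠ 0)
      exact (mul_eq_zero.1 h3.symm).resolve_left hpi
    filter_upwards [h0] with p hp
    have : ((J p)⁻¹ : ℂ) ≠ 0 := by exact_mod_cast inv_ne_zero (hJ p).ne'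
    exact (mul_eq_zero.1 hp).resolve_left this
  · -- the time derivative is bounded
    intro s hs
    have hR := hGS.rapid (hsub s hs)
    have h2 := hC s (hsub s hs)
    rw [sobolevE_eq_ofReal_integral (hR.integrable_sq _)] at h2
    have h3 : ∫ p, ‖(J p : ℂ) * G s (shear s p)‖ ^ 2 ∂freqMeasure =
        ∫ p, bracket p ^ (2 * (j + 1)) * ‖G s (shear s p)‖ ^ 2 ∂freqMeasure := by
      refine integral_congr_ae (Filter.Eventually.of_forall fun p => ?_)
      simp only [J]
      rw [norm_mul, Complex.norm_real, Real.norm_of_nonneg (hJ p).le]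
      simp only [J]; ring
    rw [h3]
    have := ENNReal.toReal_mono ENNReal.coe_ne_top h2
    rwa [ENNReal.toReal_ofReal (integral_nonneg fun p =>
      mul_nonneg (pow_nonneg (bracket_pos p).le _) (sq_nonneg _))] at this
  · -- pointwise time derivatives along the characteristics of the transport
    rintro e ⟨x, y, rfl⟩ s hs
    rw [hEV]
    simp only [hEV, invFourier_shear]
    refine HasDerivAt.const_mul _ ?_
    rw [← heq s (hT s hs)]
    have hdiff : DifferentiableAt ℝ (fun q : ℝ × ℝ × ℝ => f q.1 q.2.1 q.2.2) (s, x + s * y, y) := by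
      refine (hf.contDiffOn.contDiffAt ?_).differentiableAt (by norm_num)
      exact (isOpen_Ioo.prod isOpen_univ).mem_nhds ⟨hT s hs, mem_univ _⟩
    set L := fderiv ℝ (fun q : ℝ × ℝ × ℝ => f q.1 q.2.1 q.2.2) (s, x + s * y, y) with hL
    have hpath : HasDerivAt (fun s : ℝ => ((s, x + s * y, y) : ℝ × ℝ × ℝ)) ((1, y, 0) : ℝ × ℝ × ℝ) s := by
      refine (hasDerivAt_id s).prodMk (HasDerivAt.prodMk ?_ (hasDerivAt_const s y))
      simpa using ((hasDerivAt_id s).mul_const y).const_add x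
    have hd1 := hdiff.hasFDerivAt.comp_hasDerivAt s hpath
    have hpt : HasDerivAt (fun s' : ℝ => ((s', x + s * y, y) : ℝ × ℝ × ℝ)) ((1, 0, 0) : ℝ × ℝ × ℝ) s :=
      (hasDerivAt_id s).prodMk ((hasDerivAt_const s _).prodMk (hasDerivAt_const s y))
    have hpx : HasDerivAt (fun x' : ℝ => ((s, x', y) : ℝ × ℝ × ℝ)) ((0, 1, 0) : ℝ × ℝ × ℝ) (x + s * y) :=
      (hasDerivAt_const _ s).prodMk ((hasDerivAt_id _).prodMk (hasDerivAt_const _ y))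
    have hdt : dt f s (x + s * y) y = L (1, 0, 0) := by
      have := hdiff.hasFDerivAt.comp_hasDerivAt s hpt
      exact this.deriv
    have hdx : dx (f s) (x + s * y) y = L (0, 1, 0) := by
      have := HasFDerivAt.comp_hasDerivAt (x + s * y) hdiff.hasFDerivAt hpx
      exact this.deriv
    have hval : dt f s (x + s * y) y + y * dx (f s) (x + s * y) y = L (1, y, 0) := by
      rw [hdt, hdx, ← smul_eq_mul, ← map_smul, ← map_add]
      simp
    rw [hval]
    refine (hd1.ofReal_comp).congr_of_eventuallyEq ?_
    filter_upwards [isOpen_Ioo.mem_nhds (hT s hs)] with s' hs'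
    exact ((hf.fourier s' hs').eq_invFourier _ _).symm
  · intro s hs p
    rw [abs_div, abs_of_pos (pow_pos (hJ p) 2), div_le_iff₀ (pow_pos (hJ p) 2)]
    exact (hβA s (Metric.ball_subset_ball hrr₀ hs) p).trans (by gcongr; exact hJj p)
  · intro s hs s' hs' p
    rw [← sub_div, abs_div, abs_of_pos (pow_pos (hJ p) 2), div_le_iff₀ (pow_pos (hJ p) 2)]
    have := Convex.norm_image_sub_le_of_norm_hasDerivWithin_le (s := Metric.ball t r)
      (f := fun s => β s (shear s p)) (C := A * bracket p ^ j)
      (fun s _ => (hβd p s).hasDerivWithinAt)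
      (fun s hs => hβA' s (Metric.ball_subset_ball hrr₀ hs) p) (convex_ball t r) hs' hs
    simp only [Real.norm_eq_abs] at this
    calc _ ≤ A * bracket p ^ j * |s - s'| := this
      _ ≤ A * J p ^ 2 * |s - s'| := by gcongr; exact hJj p
      _ = _ := by ring
  · exact fun p => (hβd p t).div_const _

/-! ### The multipliers -/

/-- The coefficients `|l|^{μ-2}`, `l ≠ 0`, of the multiplier `M₃`. -/
noncomputable def echoCoef (μ : ℝ) (l : ℤ) : ℝ := if l = 0 then 0 else |(l : ℝ)| ^ μ / |(l : ℝ)| ^ 2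

/-- `∑_{l ≠ 0} |l|^{μ-2}`. -/
noncomputable def echoSum (μ : ℝ) : ℝ := ∑' l : ℤ, echoCoef μ l

section
variable {φ : ℝ → ℝ} {μ δ₀ ν m t : ℝ}

theorem echoCoef_nonneg (μ : ℝ) (l : ℤ) : 0 ≤ echoCoef μ l := by
  unfold echoCoef; split_ifs <;> positivity

theorem summable_echoCoef (hμ : μ < 1) : Summable (echoCoef μ) := by
  refine (Real.summable_abs_int_rpow (b := 2 - μ) (by linarith)).of_nonneg_of_le
    (echoCoef_nonneg μ) fun l => ?_
  unfold echoCoef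
  split_ifs with h
  · positivity
  · have hl : (0 : ℝ) < |(l : ℝ)| := by positivity
    rw [neg_sub, Real.rpow_sub hl]
    norm_num

theorem echoSum_nonneg (μ : ℝ) : 0 ≤ echoSum μ := tsum_nonneg (echoCoef_nonneg μ)

/-- The terms of the series defining `M₃`. -/
noncomputable def echoTerm (μ t : ℝ) (p : ℤ × ℝ) (l : ℤ) : ℝ := if l = 0 then 0 else
      |(l : ℝ)| ^ μ / |(l : ℝ)| ^ 2 *
        (Real.sign l *
          Real.arctan ((p.2 + t * ((p.1 : ℝ) - l)) / (1 + |(p.1 : ℝ) - l| + |(l : ℝ)|))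
          + Real.pi / 2)

/-- The terms of the series defining `Υ`. -/
noncomputable def upsTerm (μ t : ℝ) (p : ℤ × ℝ) (l : ℤ) : ℝ := if l = 0 then 0 else
    |(l : ℝ)| ^ μ / |(l : ℝ)| *
      ((1 + |(p.1 : ℝ) - l| + |(l : ℝ)|) /
        ((1 + |(p.1 : ℝ) - l| + |(l : ℝ)|) ^ 2 + (p.2 + t * ((p.1 : ℝ) - l)) ^ 2))

theorem M₃_eq (μ ν t : ℝ) (p : ℤ × ℝ) : M₃ μ ν t p =
    if |(p.1 : ℝ)| ≤ ν ^ (-(1 / 2) : ℝ) then ∑' l, echoTerm μ t p l else 0 := rfl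

theorem Upsilon_eq (μ t : ℝ) (p : ℤ × ℝ) : Upsilon μ t p = ∑' l, upsTerm μ t p l := rfl

theorem abs_sign_mul_arctan_le (s x : ℝ) : |Real.sign s * Real.arctan x| ≤ Real.pi / 2 := by
  rw [abs_mul]
  have h1 : |Real.sign s| ≤ 1 := by
    rcases Real.sign_apply_eq s with h | h | h <;> rw [h] <;> norm_num
  have h2 : |Real.arctan x| ≤ Real.pi / 2 :=
    abs_le.2 ⟨(Real.neg_pi_div_two_lt_arctan x).le, (Real.arctan_lt_pi_div_two x).le⟩
  calc _ ≤ 1 * (Real.pi / 2) := by gcongr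
    _ = _ := one_mul _

theorem echoTerm_nonneg (μ t : ℝ) (p : ℤ × ℝ) (l : ℤ) : 0 ≤ echoTerm μ t p l := by
  unfold echoTerm
  split_ifs
  · exact le_rfl
  · have := abs_le.1 (abs_sign_mul_arctan_le l
      ((p.2 + t * ((p.1 : ℝ) - l)) / (1 + |(p.1 : ℝ) - l| + |(l : ℝ)|)))
    exact mul_nonneg (by positivity) (by linarith [this.1])

theorem echoTerm_le (μ t : ℝ) (p : ℤ × ℝ) (l : ℤ) : echoTerm μ t p l ≤ Real.pi * echoCoef μ l := by
  unfold echoTerm echoCoef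
  split_ifs
  · simp
  · have := abs_le.1 (abs_sign_mul_arctan_le l
      ((p.2 + t * ((p.1 : ℝ) - l)) / (1 + |(p.1 : ℝ) - l| + |(l : ℝ)|)))
    rw [mul_comm Real.pi]
    gcongr; linarith [this.2]

theorem summable_echoTerm (hμ : μ < 1) (t : ℝ) (p : ℤ × ℝ) : Summable (echoTerm μ t p) :=
  ((summable_echoCoef hμ).mul_left Real.pi).of_nonneg_of_le (echoTerm_nonneg μ t p) (echoTerm_le μ t p)

theorem upsTerm_nonneg (μ t : ℝ) (p : ℤ × ℝ) (l : ℤ) : 0 ≤ upsTerm μ t p l := by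
  unfold upsTerm; split_ifs <;> positivity

theorem div_sq_add_le {A B : ℝ} (hA : 0 < A) : A / (A ^ 2 + B ^ 2) ≤ A⁻¹ := by
  rw [div_le_iff₀ (by positivity)]
  have : A⁻¹ * (A ^ 2 + B ^ 2) = A + A⁻¹ * B ^ 2 := by field_simp
  rw [this]
  have : 0 ≤ A⁻¹ * B ^ 2 := by positivity
  linarith

theorem upsTerm_le (μ t : ℝ) (p : ℤ × ℝ) (l : ℤ) : upsTerm μ t p l ≤ echoCoef μ l := by
  unfold upsTerm echoCoef
  split_ifs with h
  · exact le_rfl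
  · have hl : (0 : ℝ) < |(l : ℝ)| := by positivity
    calc _ ≤ |(l : ℝ)| ^ μ / |(l : ℝ)| * (1 + |(p.1 : ℝ) - l| + |(l : ℝ)|)⁻¹ := by
          gcongr; exact div_sq_add_le (by positivity)
      _ ≤ |(l : ℝ)| ^ μ / |(l : ℝ)| * (|(l : ℝ)|)⁻¹ := by
          gcongr; linarith [abs_nonneg ((p.1 : ℝ) - l)]
      _ = _ := by field_simp

theorem summable_upsTerm (hμ : μ < 1) (t : ℝ) (p : ℤ × ℝ) : Summable (upsTerm μ t p) :=
  (summable_echoCoef hμ).of_nonneg_of_le (upsTerm_nonneg μ t p) (upsTerm_le μ t p)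

theorem Upsilon_nonneg (μ t : ℝ) (p : ℤ × ℝ) : 0 ≤ Upsilon μ t p := tsum_nonneg (upsTerm_nonneg μ t p)

theorem Upsilon_le (hμ : μ < 1) (t : ℝ) (p : ℤ × ℝ) : Upsilon μ t p ≤ echoSum μ :=
  (summable_upsTerm hμ t p).tsum_le_tsum (upsTerm_le μ t p) (summable_echoCoef hμ)

theorem upsTerm_le_Upsilon (hμ : μ < 1) (t : ℝ) (p : ℤ × ℝ) (l : ℤ) :
    upsTerm μ t p l ≤ Upsilon μ t p :=
  (summable_upsTerm hμ t p).le_tsum l fun _ _ => upsTerm_nonneg _ _ _ _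

/-- `M₁ + M₂ + M₃ + 1`, the multiplier without its exponential factor. -/
noncomputable def ghost (φ : ℝ → ℝ) (μ ν t : ℝ) (p : ℤ × ℝ) : ℝ := M₁ φ ν p + M₂ ν p + M₃ μ ν t p + 1

/-- The rate of exponential growth of `M`. -/
noncomputable def growth (δ₀ ν : ℝ) (p : ℤ × ℝ) : ℝ := if p.1 = 0 then 0 else δ₀ * ν ^ (1 / 3 : ℝ)

theorem M_eq (φ : ℝ → ℝ) (μ δ₀ ν t : ℝ) (p : ℤ × ℝ) :
    M φ μ δ₀ ν t p = Real.exp (growth δ₀ ν p * t) * ghost φ μ ν t p := by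
  unfold M growth ghost; congr 2; split_ifs <;> simp

theorem M₁_mem (hφ : IsProfile φ) (ν : ℝ) (p : ℤ × ℝ) : 0 ≤ M₁ φ ν p ∧ M₁ φ ν p ≤ 1 := by
  unfold M₁; split_ifs
  · norm_num
  · exact hφ.range _

theorem M₂_mem (ν : ℝ) (p : ℤ × ℝ) : 0 ≤ M₂ ν p ∧ M₂ ν p ≤ Real.pi := by
  unfold M₂; split_ifs
  · have h1 := Real.neg_pi_div_two_lt_arctan (p.2 / p.1)
    have h2 := Real.arctan_lt_pi_div_two (p.2 / p.1)
    exact ⟨by linarith, by linarith⟩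
  · exact ⟨le_rfl, Real.pi_pos.le⟩

theorem M₃_mem (hμ : μ < 1) (ν t : ℝ) (p : ℤ × ℝ) :
    0 ≤ M₃ μ ν t p ∧ M₃ μ ν t p ≤ Real.pi * echoSum μ := by
  rw [M₃_eq]; split_ifs
  · refine ⟨tsum_nonneg (echoTerm_nonneg μ t p), ?_⟩
    rw [echoSum, ← tsum_mul_left]
    exact (summable_echoTerm hμ t p).tsum_le_tsum (echoTerm_le μ t p) ((summable_echoCoef hμ).mul_left _)
  · exact ⟨le_rfl, mul_nonneg Real.pi_pos.le (echoSum_nonneg μ)⟩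

/-- An upper bound for `M₁ + M₂ + M₃ + 1`. -/
noncomputable def ghostBound (μ : ℝ) : ℝ := 2 + Real.pi + Real.pi * echoSum μ

theorem one_le_ghost (hφ : IsProfile φ) (hμ : μ < 1) (ν t : ℝ) (p : ℤ × ℝ) : 1 ≤ ghost φ μ ν t p := by
  unfold ghost
  linarith [(M₁_mem hφ ν p).1, (M₂_mem ν p).1, (M₃_mem hμ ν t p).1]

theorem ghost_le (hφ : IsProfile φ) (hμ : μ < 1) (ν t : ℝ) (p : ℤ × ℝ) :
    ghost φ μ ν t p ≤ ghostBound μ := by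
  unfold ghost ghostBound
  linarith [(M₁_mem hφ ν p).2, (M₂_mem ν p).2, (M₃_mem hμ ν t p).2]

theorem two_le_ghostBound (μ : ℝ) : 2 ≤ ghostBound μ := by
  unfold ghostBound
  have := mul_nonneg Real.pi_pos.le (echoSum_nonneg μ)
  linarith [Real.pi_pos]

theorem M_pos (hφ : IsProfile φ) (hμ : μ < 1) (δ₀ ν t : ℝ) (p : ℤ × ℝ) : 0 < M φ μ δ₀ ν t p := by
  rw [M_eq]; exact mul_pos (Real.exp_pos _) (by linarith [one_le_ghost hφ hμ ν t p])

/-! ### Derivatives along the characteristics -/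

/-- The decay of `M₁ + M₂ + M₃` along the characteristics `ξ = ζ - kt` of the Couette flow. -/
noncomputable def ghostDecay (φ : ℝ → ℝ) (μ ν t : ℝ) (p : ℤ × ℝ) : ℝ :=
  (if p.1 = 0 then 0 else ν ^ (1 / 3 : ℝ) * absDxThird p ^ 2 *
    deriv φ (ν ^ (1 / 3 : ℝ) * |(p.1 : ℝ)| ^ (-(1 / 3) : ℝ) * Real.sign p.1 * p.2)) +
  (if p.1 ≠ 0 ∧ |(p.1 : ℝ)| ≤ ν ^ (-(1 / 2) : ℝ) then (p.1 : ℝ) ^ 2 / absD p ^ 2 else 0) +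
  (if |(p.1 : ℝ)| ≤ ν ^ (-(1 / 2) : ℝ) then Upsilon μ t p else 0)

theorem sign_mul_self (x : ℝ) : Real.sign x * x = |x| := by
  rcases lt_trichotomy x 0 with h | h | h
  · rw [Real.sign_of_neg h, abs_of_neg h]; ring
  · simp [h]
  · rw [Real.sign_of_pos h, abs_of_pos h]; ring

theorem absD_sq (p : ℤ × ℝ) : absD p ^ 2 = (p.1 : ℝ) ^ 2 + p.2 ^ 2 := Real.sq_sqrt (by positivity)

theorem hasDerivAt_M₁_shear (hφ : IsProfile φ) (ν : ℝ) (p : ℤ × ℝ) (s : ℝ) :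
    HasDerivAt (fun s => M₁ φ ν (shear s p)) (-(if p.1 = 0 then 0 else
      ν ^ (1 / 3 : ℝ) * absDxThird p ^ 2 * deriv φ (ν ^ (1 / 3 : ℝ) * |(p.1 : ℝ)| ^ (-(1 / 3) : ℝ) *
        Real.sign p.1 * (p.2 - s * p.1)))) s := by
  unfold M₁
  simp only [shear_apply]
  by_cases hk : p.1 = 0
  · simp only [hk, if_true, neg_zero]; exact hasDerivAt_const _ _
  · simp only [hk, if_false]
    have hk' : (0 : ℝ) < |(p.1 : ℝ)| := by positivity
    have h1 : HasDerivAt (fun s => ν ^ (1 / 3 : ℝ) * |(p.1 : ℝ)| ^ (-(1 / 3) : ℝ) * Real.sign p.1 *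
        (p.2 - s * p.1)) (ν ^ (1 / 3 : ℝ) * |(p.1 : ℝ)| ^ (-(1 / 3) : ℝ) * Real.sign p.1 *
          (-(1 * (p.1 : ℝ)))) s :=
      (((hasDerivAt_id s).mul_const _).const_sub _).const_mul _
    have h2 := ((hφ.smooth.differentiable (by simp)) (ν ^ (1 / 3 : ℝ) *
      |(p.1 : ℝ)| ^ (-(1 / 3) : ℝ) * Real.sign p.1 * (p.2 - s * p.1))).hasDerivAt
    refine (h2.comp s h1).congr_deriv ?_
    have h3 : |(p.1 : ℝ)| ^ (-(1 / 3) : ℝ) * |(p.1 : ℝ)| = absDxThird p ^ 2 := by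
      unfold absDxThird
      rw [← Real.rpow_natCast, ← Real.rpow_mul hk'.le]
      nth_rewrite 2 [← Real.rpow_one |(p.1 : ℝ)|]
      rw [← Real.rpow_add hk']; norm_num
    rw [← h3, ← sign_mul_self (p.1 : ℝ)]
    ring

theorem hasDerivAt_M₂_shear (ν : ℝ) (p : ℤ × ℝ) (s : ℝ) :
    HasDerivAt (fun s => M₂ ν (shear s p)) (-(if p.1 ≠ 0 ∧ |(p.1 : ℝ)| ≤ ν ^ (-(1 / 2) : ℝ) then
      (p.1 : ℝ) ^ 2 / absD (shear s p) ^ 2 else 0)) s := by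
  unfold M₂
  simp only [absD_sq, shear_apply]
  by_cases h : p.1 ≠ 0 ∧ |(p.1 : ℝ)| ≤ ν ^ (-(1 / 2) : ℝ)
  · rw [if_pos h]
    refine HasDerivAt.congr_of_eventuallyEq (f := fun s => Real.pi / 2 +
      Real.arctan ((p.2 - s * p.1) / p.1)) ?_ (Filter.Eventually.of_forall fun s => if_pos h)
    have hk : (p.1 : ℝ) ≠ 0 := by exact_mod_cast h.1
    have h1 : HasDerivAt (fun s => (p.2 - s * p.1) / (p.1 : ℝ)) (-(1 * (p.1 : ℝ)) / p.1) s :=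
      (((hasDerivAt_id s).mul_const _).const_sub _).div_const _
    refine (h1.arctan.const_add _).congr_deriv ?_
    have : (p.1 : ℝ) ^ 2 + (p.2 - s * p.1) ^ 2 ≠ 0 := by positivity
    field_simp
  · rw [if_neg h, neg_zero]
    exact (hasDerivAt_const s (0 : ℝ)).congr_of_eventuallyEq
      (Filter.Eventually.of_forall fun s => if_neg h)

theorem hasDerivAt_echoTerm_shear (μ : ℝ) (p : ℤ × ℝ) (l : ℤ) (s : ℝ) :
    HasDerivAt (fun s => echoTerm μ s (shear s p) l) (-upsTerm μ s (shear s p) l) s := by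
  unfold echoTerm upsTerm
  simp only [shear_apply]
  split_ifs with h
  · rw [neg_zero]; exact hasDerivAt_const _ _
  · have hl : (0 : ℝ) < |(l : ℝ)| := by positivity
    set A := 1 + |(p.1 : ℝ) - l| + |(l : ℝ)| with hA
    have hA0 : 0 < A := by positivity
    have h1 : HasDerivAt (fun s : ℝ => (p.2 - s * p.1 + s * ((p.1 : ℝ) - l)) / A)
        ((-(1 * (p.1 : ℝ)) + 1 * ((p.1 : ℝ) - l)) / A) s :=
      ((((hasDerivAt_id s).mul_const _).const_sub _).add ((hasDerivAt_id s).mul_const _)).div_const _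
    refine (((h1.arctan.const_mul _).add_const _).const_mul _).congr_deriv ?_
    have h2 : Real.sign l * (1 / (1 + ((p.2 - s * p.1 + s * ((p.1 : ℝ) - l)) / A) ^ 2) *
        ((-(1 * (p.1 : ℝ)) + 1 * ((p.1 : ℝ) - l)) / A)) =
        -(|(l : ℝ)| * (A / (A ^ 2 + (p.2 - s * p.1 + s * ((p.1 : ℝ) - l)) ^ 2))) := by
      rw [← sign_mul_self (l : ℝ)]
      have : A ^ 2 + (p.2 - s * p.1 + s * ((p.1 : ℝ) - l)) ^ 2 ≠ 0 := by positivity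
      field_simp
      ring
    rw [h2]
    field_simp

theorem hasDerivAt_M₃_shear (hμ : μ < 1) (ν : ℝ) (p : ℤ × ℝ) (s : ℝ) :
    HasDerivAt (fun s => M₃ μ ν s (shear s p)) (-(if |(p.1 : ℝ)| ≤ ν ^ (-(1 / 2) : ℝ) then
      Upsilon μ s (shear s p) else 0)) s := by
  simp only [M₃_eq, Upsilon_eq, shear_apply]
  split_ifs with h
  · have := hasDerivAt_tsum (g := fun l s => echoTerm μ s (shear s p) l)
      (g' := fun l s => -upsTerm μ s (shear s p) l) (summable_echoCoef hμ)
      (fun l s => hasDerivAt_echoTerm_shear μ p l s)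
      (fun l s => by
        rw [norm_neg, Real.norm_of_nonneg (upsTerm_nonneg _ _ _ _)]; exact upsTerm_le _ _ _ _)
      (y₀ := 0) (summable_echoTerm hμ _ _) s
    simpa only [tsum_neg, shear_apply] using this
  · rw [neg_zero]; exact hasDerivAt_const _ _

theorem hasDerivAt_ghost_shear (hφ : IsProfile φ) (hμ : μ < 1) (ν : ℝ) (p : ℤ × ℝ) (s : ℝ) :
    HasDerivAt (fun s => ghost φ μ ν s (shear s p)) (-ghostDecay φ μ ν s (shear s p)) s := by
  refine ((((hasDerivAt_M₁_shear hφ ν p s).add (hasDerivAt_M₂_shear ν p s)).add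
    (hasDerivAt_M₃_shear hμ ν p s)).add_const 1).congr_deriv ?_
  unfold ghostDecay
  simp only [shear_apply, absDxThird]
  ring_nf

/-- The derivative of `M` along the characteristics. -/
noncomputable def MDeriv (φ : ℝ → ℝ) (μ δ₀ ν t : ℝ) (p : ℤ × ℝ) : ℝ :=
  Real.exp (growth δ₀ ν p * t) * (growth δ₀ ν p * ghost φ μ ν t p - ghostDecay φ μ ν t p)

theorem hasDerivAt_M_shear (hφ : IsProfile φ) (hμ : μ < 1) (δ₀ ν : ℝ) (p : ℤ × ℝ) (s : ℝ) :
    HasDerivAt (fun s => M φ μ δ₀ ν s (shear s p)) (MDeriv φ μ δ₀ ν s (shear s p)) s := by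
  simp only [M_eq]
  have hg : growth δ₀ ν (shear s p) = growth δ₀ ν p := rfl
  have h1 : HasDerivAt (fun s => Real.exp (growth δ₀ ν p * s))
      (Real.exp (growth δ₀ ν p * s) * (growth δ₀ ν p * 1)) s :=
    ((hasDerivAt_id s).const_mul _).exp
  refine (h1.mul (hasDerivAt_ghost_shear hφ hμ ν p s)).congr_deriv ?_
  simp only [MDeriv, hg]
  ring_nf

/-! ### Coercivity -/

/-- The symbol of the dissipation that acts on the vorticity: viscosity, enhanced dissipation,
inviscid damping, and echo suppression. -/
noncomputable def dissip (μ ν t : ℝ) (p : ℤ × ℝ) : ℝ :=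
  ν * absD p ^ 2 + ν ^ (1 / 3 : ℝ) * absDxThird p ^ 2 + (p.1 : ℝ) ^ 2 / absD p ^ 2 + Upsilon μ t p

/-- The coercivity constant. -/
noncomputable def coer (μ : ℝ) : ℝ := 1 / (24 * (1 + echoSum μ) * ghostBound μ)

theorem coer_pos (μ : ℝ) : 0 < coer μ := by
  unfold coer
  have := echoSum_nonneg μ
  have := two_le_ghostBound μ
  positivity

theorem coer_mul_ghostBound (μ : ℝ) : coer μ * ghostBound μ = 1 / (24 * (1 + echoSum μ)) := by
  unfold coer
  have := echoSum_nonneg μ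
  have := two_le_ghostBound μ
  field_simp

/-- Enhanced dissipation: where the derivative of the cut-off is not available, viscosity is at
least as strong as `ν^{1/3} |k|^{2/3}`. -/
theorem enhanced_le (hφ : IsProfile φ) (hν : 0 < ν) (p : ℤ × ℝ) :
    ν ^ (1 / 3 : ℝ) * absDxThird p ^ 2 / 4 ≤ (if p.1 = 0 then 0 else ν ^ (1 / 3 : ℝ) * absDxThird p ^ 2 *
      deriv φ (ν ^ (1 / 3 : ℝ) * |(p.1 : ℝ)| ^ (-(1 / 3) : ℝ) * Real.sign p.1 * p.2)) +
      ν * absD p ^ 2 := by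
  by_cases hk : p.1 = 0
  · simp only [hk, if_true, absDxThird]
    simp only [Int.cast_zero, abs_zero]
    rw [Real.zero_rpow (by norm_num)]
    have : 0 ≤ ν * absD p ^ 2 := by positivity
    linarith
  · simp only [hk, if_false]
    have hk' : (0 : ℝ) < |(p.1 : ℝ)| := by positivity
    set h := ν ^ (1 / 3 : ℝ) with hh
    set κ := absDxThird p with hκ
    have hh0 : 0 < h := by positivity
    have hκ0 : 0 < κ := by rw [hκ]; unfold absDxThird; positivity
    have hν3 : ν = h ^ 3 := by
      rw [hh, ← Real.rpow_natCast, ← Real.rpow_mul hν.le]; norm_num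
    have hκinv : |(p.1 : ℝ)| ^ (-(1 / 3) : ℝ) = κ⁻¹ := by
      rw [hκ]; unfold absDxThird; rw [Real.rpow_neg hk'.le]
    rw [hκinv]
    set z := h * κ⁻¹ * Real.sign p.1 * p.2 with hz
    by_cases hzz : |z| ≤ 1
    · rw [hφ.deriv_eq z (abs_le.1 hzz)]
      have : 0 ≤ ν * absD p ^ 2 := by positivity
      linarith
    · have h1 : 1 < z ^ 2 := by
        rw [← sq_abs]; exact one_lt_pow₀ (not_le.1 hzz) (by norm_num)
      have hs : Real.sign (p.1 : ℝ) ^ 2 = 1 := by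
        rcases lt_or_gt_of_ne (show (p.1 : ℝ) ≠ 0 by exact_mod_cast hk) with h' | h'
        · rw [Real.sign_of_neg h']; norm_num
        · rw [Real.sign_of_pos h']; norm_num
      have h2 : κ ^ 2 < h ^ 2 * p.2 ^ 2 := by
        have : z ^ 2 = h ^ 2 * p.2 ^ 2 / κ ^ 2 := by
          rw [hz, mul_pow, mul_pow, mul_pow, hs]; field_simp
        rw [this, lt_div_iff₀ (by positivity)] at h1
        linarith
      have h3 : h * κ ^ 2 ≤ ν * absD p ^ 2 := by
        rw [absD_sq, hν3]
        nlinarith [mul_lt_mul_of_pos_left h2 hh0, mul_nonneg (pow_nonneg hh0.le 3) (sq_nonneg (p.1 : ℝ))]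
      have h4 : 0 ≤ h * κ ^ 2 * deriv φ z := mul_nonneg (by positivity) (hφ.deriv_range z).1
      have : 0 ≤ h * κ ^ 2 := by positivity
      linarith

theorem sq_div_absD_le_one (p : ℤ × ℝ) : (p.1 : ℝ) ^ 2 / absD p ^ 2 ≤ 1 := by
  rw [absD_sq]
  exact div_le_one_of_le₀ (by nlinarith [sq_nonneg p.2]) (by positivity)

/-- Beyond the frequency cut-off, viscosity is of order one. -/
theorem one_le_viscosity (hν : 0 < ν) {p : ℤ × ℝ} (h : ¬ |(p.1 : ℝ)| ≤ ν ^ (-(1 / 2) : ℝ)) :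
    1 ≤ ν * absD p ^ 2 := by
  rw [not_le] at h
  have h0 : 0 < ν ^ (-(1 / 2) : ℝ) := by positivity
  have h1 : (ν ^ (-(1 / 2) : ℝ)) ^ 2 ≤ (p.1 : ℝ) ^ 2 := by
    rw [← sq_abs (p.1 : ℝ)]; gcongr
  have h2 : (ν ^ (-(1 / 2) : ℝ)) ^ 2 = ν⁻¹ := by
    rw [← Real.rpow_natCast, ← Real.rpow_mul hν.le]; norm_num [Real.rpow_neg_one]
  rw [h2] at h1
  calc 1 = ν * ν⁻¹ := (mul_inv_cancel₀ hν.ne').symm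
    _ ≤ ν * absD p ^ 2 := by
      rw [absD_sq]; gcongr; nlinarith [sq_nonneg p.2]

/-- The derivative of `M` along the characteristics, together with the viscous term, is bounded by
minus a multiple of the whole dissipation. This is what the multiplier is made for: each of its
summands decreases at the rate of one part of `dissip`, and since `1 ≤ M₁ + M₂ + M₃ + 1 ≤ ghostBound μ`
these rates are comparable with the same rates times `M`. -/
theorem coercivity (hφ : IsProfile φ) (hμ : μ < 1) (hδ' : δ₀ ≤ coer μ) (hν : 0 < ν)
    (t : ℝ) (p : ℤ × ℝ) :
    MDeriv φ μ δ₀ ν t p - 2 * (ν * absD p ^ 2) * M φ μ δ₀ ν t p ≤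
      -(coer μ * dissip μ ν t p * M φ μ δ₀ ν t p) := by
  have hN1 := one_le_ghost hφ hμ ν t p
  have hN2 := ghost_le hφ hμ ν t p
  have hB := two_le_ghostBound μ
  have hσ := echoSum_nonneg μ
  have hU0 := Upsilon_nonneg μ t p
  have hU1 := Upsilon_le hμ t p
  rw [M_eq]
  unfold MDeriv
  set e := Real.exp (growth δ₀ ν p * t) with he
  have he0 : 0 < e := Real.exp_pos _
  set N := ghost φ μ ν t p with hN
  set σ := 1 + echoSum μ with hσ'
  set B := ghostBound μ with hB'
  set D1 := ν * absD p ^ 2 with hD1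
  set D2 := ν ^ (1 / 3 : ℝ) * absDxThird p ^ 2 with hD2
  set D3 := (p.1 : ℝ) ^ 2 / absD p ^ 2 with hD3
  set U := Upsilon μ t p with hU
  have hD10 : 0 ≤ D1 := by positivity
  have hD20 : 0 ≤ D2 := by positivity
  have hD30 : 0 ≤ D3 := by positivity
  have hD31 : D3 ≤ 1 := sq_div_absD_le_one p
  -- the growth rate is absorbed by the enhanced dissipation
  have hg : growth δ₀ ν p * N ≤ 1 / (24 * σ) * D2 := by
    unfold growth
    split_ifs with hk
    · rw [zero_mul]; positivity
    · have hc0 := (coer_pos μ).le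
      have h1 : ν ^ (1 / 3 : ℝ) ≤ D2 := by
        have : 1 ≤ absDxThird p ^ 2 := by
          apply one_le_pow₀
          unfold absDxThird
          apply Real.one_le_rpow _ (by norm_num)
          have : (1 : ℤ) ≤ |p.1| := Int.one_le_abs hk
          exact_mod_cast this
        have h0 : 0 < ν ^ (1 / 3 : ℝ) := by positivity
        nlinarith
      have h2 : coer μ * B = 1 / (24 * σ) := coer_mul_ghostBound μ
      calc δ₀ * ν ^ (1 / 3 : ℝ) * N ≤ coer μ * D2 * B := by
            gcongr
        _ = coer μ * B * D2 := by ring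
        _ = _ := by rw [h2]
  -- the decay of the multipliers together with viscosity controls everything
  have hdec : 1 / (12 * σ) * (D2 + D3 + U) ≤ ghostDecay φ μ ν t p + D1 := by
    unfold ghostDecay
    have a1 := enhanced_le hφ hν p
    set P1 := (if p.1 = 0 then 0 else ν ^ (1 / 3 : ℝ) * absDxThird p ^ 2 *
      deriv φ (ν ^ (1 / 3 : ℝ) * |(p.1 : ℝ)| ^ (-(1 / 3) : ℝ) * Real.sign p.1 * p.2)) with hP1
    have a1' : 0 ≤ P1 := by
      rw [hP1]; split_ifs
      · exact le_rfl
      · exact mul_nonneg hD20 (hφ.deriv_range _).1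
    have a2 : D3 ≤ (if p.1 ≠ 0 ∧ |(p.1 : ℝ)| ≤ ν ^ (-(1 / 2) : ℝ) then D3 else 0) + D1 := by
      split_ifs with h
      · linarith
      · by_cases hk : p.1 = 0
        · have : D3 = 0 := by rw [hD3, hk]; simp
          linarith
        · have := one_le_viscosity hν fun h' => h ⟨hk, h'⟩
          linarith
    have a3 : U / σ ≤ (if |(p.1 : ℝ)| ≤ ν ^ (-(1 / 2) : ℝ) then U else 0) + D1 := by
      split_ifs with h
      · have : U / σ ≤ U := div_le_self hU0 (by linarith)
        linarith
      · have := one_le_viscosity hν h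
        have : U / σ ≤ 1 := div_le_one_of_le₀ (by linarith) (by linarith)
        linarith
    set P2 := (if p.1 ≠ 0 ∧ |(p.1 : ℝ)| ≤ ν ^ (-(1 / 2) : ℝ) then D3 else 0)
    set P3 := (if |(p.1 : ℝ)| ≤ ν ^ (-(1 / 2) : ℝ) then U else 0)
    have a2' : 0 ≤ P2 := by simp only [P2]; split_ifs <;> linarith
    have a3' : 0 ≤ P3 := by simp only [P3]; split_ifs <;> linarith
    have hσ1 : 1 ≤ σ := by linarith
    have hle : ∀ x : ℝ, 0 ≤ x → 1 / (12 * σ) * x ≤ x / 12 := fun x hx => by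
      rw [div_mul_eq_mul_div, one_mul]
      gcongr; linarith
    have b1 := hle D2 hD20
    have b2 := hle D3 hD30
    have b3 : 1 / (12 * σ) * U = U / σ / 12 := by field_simp
    rw [mul_add, mul_add, b3]
    linarith
  have hc : coer μ * N ≤ 1 / (24 * σ) := by
    have h2 : coer μ * B = 1 / (24 * σ) := coer_mul_ghostBound μ
    rw [← h2]; gcongr; exact (coer_pos μ).le
  have hc1 : coer μ ≤ 1 := by
    unfold coer
    rw [div_le_one (by positivity)]
    nlinarith
  have hsum : 1 / (12 * σ) * (D2 + D3 + U) = 1 / (24 * σ) * (D2 + D3 + U) + 1 / (24 * σ) * (D2 + D3 + U) := by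
    field_simp; ring
  have h1 : coer μ * N * (D2 + D3 + U) ≤ 1 / (24 * σ) * (D2 + D3 + U) := by gcongr
  have h2 : coer μ * N * D1 ≤ N * D1 := by
    have : 0 ≤ N * D1 := by positivity
    nlinarith
  have h3 : D1 ≤ N * D1 := by nlinarith
  have h4 : 1 / (24 * σ) * D2 ≤ 1 / (24 * σ) * (D2 + D3 + U) := by gcongr; linarith
  have main : growth δ₀ ν p * N - ghostDecay φ μ ν t p - 2 * D1 * N ≤
      -(coer μ * (D1 + D2 + D3 + U) * N) := by
    nlinarith
  unfold dissip
  calc e * (growth δ₀ ν p * N - ghostDecay φ μ ν t p) - 2 * D1 * (e * N)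
      = e * (growth δ₀ ν p * N - ghostDecay φ μ ν t p - 2 * D1 * N) := by ring
    _ ≤ e * (-(coer μ * (D1 + D2 + D3 + U) * N)) := by gcongr
    _ = _ := by ring

end

/-! ### Measurability and growth of the weights -/

section
variable {φ : ℝ → ℝ} {μ δ₀ ν m t : ℝ}

theorem IsProfile.continuous (hφ : IsProfile φ) : Continuous φ := hφ.smooth.continuous

theorem IsProfile.continuous_deriv (hφ : IsProfile φ) : Continuous (deriv φ) :=
  hφ.smooth.continuous_deriv (by simp)

theorem measurable_M₁ (hφ : IsProfile φ) (ν : ℝ) : Measurable (M₁ φ ν) :=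
  measurable_of_continuous_section fun k => by
    have := hφ.continuous
    unfold M₁; by_cases hk : k = 0 <;> simp only [hk, if_true, if_false] <;> fun_prop

theorem measurable_M₂ (ν : ℝ) : Measurable (M₂ ν) :=
  measurable_of_continuous_section fun k => by
    unfold M₂
    by_cases hk : k ≠ 0 ∧ |(k : ℝ)| ≤ ν ^ (-(1 / 2) : ℝ)
    · simp only [hk, and_self, if_true, ne_eq, not_false_eq_true]
      exact continuous_const.add (Real.continuous_arctan.comp (continuous_id.div_const _))
    · exact (continuous_const (y := (0 : ℝ))).congr fun ξ => (if_neg hk).symm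

theorem continuous_echoTerm (μ t : ℝ) (k l : ℤ) : Continuous fun ξ => echoTerm μ t (k, ξ) l := by
  by_cases hl : l = 0
  · simp only [echoTerm, hl, if_true]
    exact continuous_const
  · simp only [echoTerm, hl, if_false]
    have := Real.continuous_arctan
    fun_prop

theorem continuous_upsTerm (μ t : ℝ) (k l : ℤ) : Continuous fun ξ => upsTerm μ t (k, ξ) l := by
  by_cases hl : l = 0
  · simp only [upsTerm, hl, if_true]
    exact continuous_const
  · simp only [upsTerm, hl, if_false]
    have h : ∀ ξ : ℝ, (1 + |(k : ℝ) - l| + |(l : ℝ)|) ^ 2 + (ξ + t * ((k : ℝ) - l)) ^ 2 ≠ 0 :=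
      fun ξ => by positivity
    fun_prop (disch := exact h)

theorem measurable_M₃ (hμ : μ < 1) (ν t : ℝ) : Measurable (M₃ μ ν t) :=
  measurable_of_continuous_section fun k => by
    simp only [M₃_eq]
    split_ifs
    · exact continuous_tsum (fun l => continuous_echoTerm μ t k l)
        ((summable_echoCoef hμ).mul_left Real.pi) fun l ξ => by
          rw [Real.norm_of_nonneg (echoTerm_nonneg _ _ _ _)]; exact echoTerm_le _ _ _ _
    · exact continuous_const

theorem measurable_Upsilon (hμ : μ < 1) (t : ℝ) : Measurable (Upsilon μ t) :=
  measurable_of_continuous_section fun k => by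
    simp only [Upsilon_eq]
    exact continuous_tsum (fun l => continuous_upsTerm μ t k l) (summable_echoCoef hμ) fun l ξ => by
      rw [Real.norm_of_nonneg (upsTerm_nonneg _ _ _ _)]; exact upsTerm_le _ _ _ _

theorem measurable_ghost (hφ : IsProfile φ) (hμ : μ < 1) (ν t : ℝ) : Measurable (ghost φ μ ν t) :=
  (((measurable_M₁ hφ ν).add (measurable_M₂ ν)).add (measurable_M₃ hμ ν t)).add_const 1

theorem measurable_of_fst {β : Type*} [MeasurableSpace β] (g : ℤ → β) :
    Measurable fun p : ℤ × ℝ => g p.1 := (measurable_of_countable g).comp measurable_fst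

theorem measurable_growth (δ₀ ν : ℝ) : Measurable (growth δ₀ ν) :=
  measurable_of_fst fun k => if k = 0 then 0 else δ₀ * ν ^ (1 / 3 : ℝ)

theorem measurable_M (hφ : IsProfile φ) (hμ : μ < 1) (δ₀ ν t : ℝ) : Measurable (M φ μ δ₀ ν t) := by
  have : M φ μ δ₀ ν t = fun p => Real.exp (growth δ₀ ν p * t) * ghost φ μ ν t p :=
    funext fun p => M_eq ..
  rw [this]
  exact (((measurable_growth δ₀ ν).mul_const t).exp).mul (measurable_ghost hφ hμ ν t)

theorem measurable_absDxThird : Measurable absDxThird :=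
  measurable_of_fst fun k : ℤ => |(k : ℝ)| ^ (1 / 3 : ℝ)

theorem measurable_absD : Measurable absD :=
  measurable_of_continuous_section fun k => by unfold absD; fun_prop

theorem measurable_angX : Measurable angX := measurable_of_fst fun k : ℤ => Real.sqrt (1 + (k : ℝ) ^ 2)

theorem measurable_Lam (t : ℝ) : Measurable (Lam t) :=
  measurable_of_continuous_section fun k => by unfold Lam; fun_prop

theorem measurable_ghostDecay (hφ : IsProfile φ) (hμ : μ < 1) (ν t : ℝ) :
    Measurable (ghostDecay φ μ ν t) := by
  have hU := measurable_Upsilon hμ t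
  have hd := hφ.continuous_deriv
  unfold ghostDecay
  refine ((Measurable.add ?_ ?_).add ?_)
  · exact measurable_of_continuous_section fun k => by
      by_cases hk : k = 0 <;> simp only [hk, if_true, if_false, absDxThird] <;> fun_prop
  · refine Measurable.ite ?_ (((measurable_fst_cast).pow_const 2).div (measurable_absD.pow_const 2))
      measurable_const
    exact measurable_fst (Set.to_countable
      {k : ℤ | k ≠ 0 ∧ |(k : ℝ)| ≤ ν ^ (-(1 / 2) : ℝ)}).measurableSet
  · refine Measurable.ite ?_ hU measurable_const
    exact measurable_fst (Set.to_countable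
      {k : ℤ | |(k : ℝ)| ≤ ν ^ (-(1 / 2) : ℝ)}).measurableSet

theorem measurable_MDeriv (hφ : IsProfile φ) (hμ : μ < 1) (δ₀ ν t : ℝ) :
    Measurable (MDeriv φ μ δ₀ ν t) :=
  (((measurable_growth δ₀ ν).mul_const t).exp).mul
    (((measurable_growth δ₀ ν).mul (measurable_ghost hφ hμ ν t)).sub (measurable_ghostDecay hφ hμ ν t))

theorem measurable_wt (hφ : IsProfile φ) (hμ : μ < 1) (δ₀ ν m t : ℝ) :
    Measurable (wt φ μ δ₀ ν m t) :=
  (measurable_M hφ hμ δ₀ ν t).sqrt.mul ((measurable_Lam t).pow_const m)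

theorem wt_sq (hφ : IsProfile φ) (hμ : μ < 1) (δ₀ ν m t : ℝ) (p : ℤ × ℝ) :
    wt φ μ δ₀ ν m t p ^ 2 = M φ μ δ₀ ν t p * (Lam t p ^ m) ^ 2 := by
  unfold wt; rw [mul_pow, Real.sq_sqrt (M_pos hφ hμ δ₀ ν t p).le]

theorem one_le_Lam (t : ℝ) (p : ℤ × ℝ) : 1 ≤ Lam t p := by
  unfold Lam
  rw [Real.one_le_sqrt]
  nlinarith [sq_nonneg (p.1 : ℝ), sq_nonneg (p.2 + t * p.1)]

theorem Lam_pos (t : ℝ) (p : ℤ × ℝ) : 0 < Lam t p := zero_lt_one.trans_le (one_le_Lam t p)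

theorem Lam_sq (t : ℝ) (p : ℤ × ℝ) : Lam t p ^ 2 = 1 + (p.1 : ℝ) ^ 2 + (p.2 + t * p.1) ^ 2 :=
  Real.sq_sqrt (by positivity)

theorem Lam_eq (t : ℝ) (p : ℤ × ℝ) : Lam t p = Real.sqrt (bracket ((shear t).symm p)) := rfl

theorem Lam_shear (s : ℝ) (p : ℤ × ℝ) : Lam s (shear s p) = Real.sqrt (bracket p) := by
  rw [Lam_eq, MeasurableEquiv.symm_apply_apply]

theorem sqrt_bracket_rpow_sq_le (m : ℝ) (p : ℤ × ℝ) :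
    (Real.sqrt (bracket p) ^ m) ^ 2 ≤ bracket p ^ ⌈m⌉₊ := by
  have hJ := bracket_pos p
  rw [Real.sqrt_eq_rpow, ← Real.rpow_mul hJ.le, ← Real.rpow_natCast, ← Real.rpow_mul hJ.le,
    ← Real.rpow_natCast]
  apply Real.rpow_le_rpow_of_exponent_le (one_le_bracket p)
  have := Nat.le_ceil m
  push_cast
  linarith

theorem growth_nonneg (hδ : 0 ≤ δ₀) (hν : 0 < ν) (p : ℤ × ℝ) : 0 ≤ growth δ₀ ν p := by
  unfold growth; split_ifs <;> positivity

theorem growth_le (hδ : 0 ≤ δ₀) (hν : 0 < ν) (p : ℤ × ℝ) : growth δ₀ ν p ≤ δ₀ * ν ^ (1 / 3 : ℝ) := by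
  unfold growth; split_ifs
  · positivity
  · exact le_rfl

theorem absDxThird_nonneg (p : ℤ × ℝ) : 0 ≤ absDxThird p := by unfold absDxThird; positivity

theorem absDxThird_pow_three (p : ℤ × ℝ) : absDxThird p ^ 3 = |(p.1 : ℝ)| := by
  unfold absDxThird
  rw [← Real.rpow_natCast, ← Real.rpow_mul (abs_nonneg _)]; norm_num

theorem absDxThird_sq_le (p : ℤ × ℝ) : absDxThird p ^ 2 ≤ bracket p := by
  have h0 := absDxThird_nonneg p
  have h3 := absDxThird_pow_three p
  have h6 : absDxThird p ^ 6 = (p.1 : ℝ) ^ 2 := by rw [← sq_abs, ← h3]; ring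
  unfold bracket
  rw [← h6]
  nlinarith [sq_nonneg p.2, sq_nonneg (absDxThird p ^ 2 - 1), sq_nonneg (absDxThird p),
    mul_nonneg (sq_nonneg (absDxThird p)) (sq_nonneg (absDxThird p ^ 2 - 1)), sq_nonneg (absDxThird p ^ 3)]

theorem ghostDecay_nonneg (hφ : IsProfile φ) (hν : 0 < ν) (t : ℝ) (p : ℤ × ℝ) :
    0 ≤ ghostDecay φ μ ν t p := by
  unfold ghostDecay
  have := Upsilon_nonneg μ t p
  refine add_nonneg (add_nonneg ?_ ?_) ?_
  · split_ifs
    · exact le_rfl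
    · exact mul_nonneg (by positivity) (hφ.deriv_range _).1
  · split_ifs <;> positivity
  · split_ifs <;> positivity

theorem ghostDecay_le (hφ : IsProfile φ) (hμ : μ < 1) (hν : 0 < ν) (t : ℝ) (p : ℤ × ℝ) :
    ghostDecay φ μ ν t p ≤ ν ^ (1 / 3 : ℝ) * absDxThird p ^ 2 + 1 + echoSum μ := by
  unfold ghostDecay
  have hU := Upsilon_le hμ t p
  have hσ := echoSum_nonneg μ
  have h0 : 0 ≤ ν ^ (1 / 3 : ℝ) * absDxThird p ^ 2 := by positivity
  refine add_le_add (add_le_add ?_ ?_) ?_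
  · split_ifs
    · exact h0
    · have := (hφ.deriv_range (ν ^ (1 / 3 : ℝ) * |(p.1 : ℝ)| ^ (-(1 / 3) : ℝ) * Real.sign p.1 * p.2)).2
      nlinarith
  · split_ifs
    · exact sq_div_absD_le_one p
    · norm_num
  · split_ifs
    · exact hU
    · exact hσ

/-- The energy with weight `χ(k) √𝓜 Λ^m` is differentiable along solutions of `∂ₜf + y∂ₓf = g`. The
symbol `Λ_t` is constant along the characteristics, so only `M` is differentiated. -/
theorem hasDerivAt_weighted_energy (hφ : IsProfile φ) (hμ : μ < 1) (hδ : 0 ≤ δ₀) (hν : 0 < ν)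
    {T : ℝ} {f : ℝ → ℝ → ℝ → ℝ} {F G : ℝ → ℤ × ℝ → ℂ}
    (hf : IsRegular T f F) (hG : ∀ a b : ℝ, 0 < a → b < T → RapidOn (Icc a b) G)
    (heq : ∀ t ∈ Ioo 0 T, ∀ x y, ((dt f t x y + y * dx (f t) x y : ℝ) : ℂ) = invFourier (G t) x y)
    {χ : ℤ → ℝ} (hχ : ∃ (C : ℝ) (i : ℕ), ∀ p : ℤ × ℝ, χ p.1 ^ 2 ≤ C * bracket p ^ i)
    (ht : t ∈ Ioo 0 T) :
    HasDerivAt (fun s => ∫ p, χ p.1 ^ 2 * wt φ μ δ₀ ν m s p ^ 2 * ‖F s p‖ ^ 2 ∂freqMeasure)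
      (∫ p, χ p.1 ^ 2 * (MDeriv φ μ δ₀ ν t p * (Lam t p ^ m) ^ 2) * ‖F t p‖ ^ 2 ∂freqMeasure +
        2 * ∫ p, χ p.1 ^ 2 * wt φ μ δ₀ ν m t p ^ 2 *
          ((starRingEnd ℂ) (F t p) * G t p).re ∂freqMeasure) t := by
  obtain ⟨C, i, hχ⟩ := hχ
  have hC : 0 ≤ C := by
    have := (sq_nonneg (χ 0)).trans (hχ (0, 0))
    simpa [bracket] using this
  have hχm : Measurable fun p : ℤ × ℝ => χ p.1 ^ 2 := measurable_of_fst fun k => χ k ^ 2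
  set g := δ₀ * ν ^ (1 / 3 : ℝ) with hg
  have hg0 : 0 ≤ g := by positivity
  set B := ghostBound μ with hB
  have hB2 := two_le_ghostBound μ
  have hσ := echoSum_nonneg μ
  set e := Real.exp (g * (t + 1)) with he
  set Q := g * B + (ν ^ (1 / 3 : ℝ) + 1 + echoSum μ) + B with hQ
  have hQ0 : 0 ≤ Q := by positivity
  have hexp : ∀ s ∈ Metric.ball t 1, ∀ p : ℤ × ℝ, Real.exp (growth δ₀ ν p * s) ≤ e := by
    intro s hs p
    rw [Real.ball_eq_Ioo] at hs
    apply Real.exp_le_exp.2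
    calc growth δ₀ ν p * s ≤ growth δ₀ ν p * (t + 1) := by
          gcongr
          · exact growth_nonneg hδ hν p
          · exact hs.2.le
      _ ≤ _ := by
          gcongr
          · linarith [ht.1]
          · exact growth_le hδ hν p
  have hpow : ∀ p : ℤ × ℝ, (C * bracket p ^ i) * (e * (Q * bracket p) * bracket p ^ ⌈m⌉₊) =
      C * e * Q * bracket p ^ (i + 1 + ⌈m⌉₊) := fun p => by ring
  refine hasDerivAt_integral_transport hf hG heq (r₀ := 1) (A := C * e * Q) (j := i + 1 + ⌈m⌉₊)
    (β' := fun s p => χ p.1 ^ 2 * (MDeriv φ μ δ₀ ν s p * (Lam s p ^ m) ^ 2)) ht (by positivity)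
    one_pos (fun s => hχm.mul ((measurable_wt hφ hμ δ₀ ν m s).pow_const 2))
    (hχm.mul ((measurable_MDeriv hφ hμ δ₀ ν t).mul (((measurable_Lam t).pow_const m).pow_const 2)))
    ?_ ?_ ?_
  · intro p s
    simp only [wt_sq hφ hμ, Lam_shear]
    exact ((hasDerivAt_M_shear hφ hμ δ₀ ν p s).mul_const _).const_mul (χ p.1 ^ 2)
  · intro s hs p
    simp only [wt_sq hφ hμ, Lam_shear]
    have hJ := bracket_pos p
    have hJ1 := one_le_bracket p
    have hM0 := (M_pos hφ hμ δ₀ ν s (shear s p)).le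
    have hM : M φ μ δ₀ ν s (shear s p) ≤ e * (Q * bracket p) := by
      rw [M_eq]
      have h1 := ghost_le hφ hμ ν s (shear s p)
      have h2 := hexp s hs (shear s p)
      have h3 : ghost φ μ ν s (shear s p) ≤ Q * bracket p := by
        calc _ ≤ B := h1
          _ ≤ Q := by
            have : 0 ≤ g * B := by positivity
            have : 0 ≤ ν ^ (1 / 3 : ℝ) := by positivity
            linarith
          _ ≤ _ := le_mul_of_one_le_right hQ0 hJ1
      have := one_le_ghost hφ hμ ν s (shear s p)
      gcongr
    rw [abs_of_nonneg (by positivity), ← hpow]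
    gcongr
    · exact hχ (shear s p |>.1, p.2)
    · exact sqrt_bracket_rpow_sq_le m p
  · intro s hs p
    simp only [Lam_shear]
    have hJ := bracket_pos p
    have hJ1 := one_le_bracket p
    have hM : |MDeriv φ μ δ₀ ν s (shear s p)| ≤ e * (Q * bracket p) := by
      unfold MDeriv
      have h1 := ghost_le hφ hμ ν s (shear s p)
      have h1' := one_le_ghost hφ hμ ν s (shear s p)
      have h2 := hexp s hs (shear s p)
      have h4 := ghostDecay_nonneg (μ := μ) hφ hν s (shear s p)
      have h5 := ghostDecay_le hφ hμ hν s (shear s p)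
      have h6 : absDxThird (shear s p) ^ 2 ≤ bracket p := absDxThird_sq_le p
      have h7 := growth_nonneg hδ hν (shear s p)
      have h8 := growth_le hδ hν (shear s p)
      rw [abs_mul, abs_of_pos (Real.exp_pos _)]
      gcongr
      have h9 : growth δ₀ ν (shear s p) * ghost φ μ ν s (shear s p) ≤ g * B := by gcongr
      have h10 : 0 ≤ growth δ₀ ν (shear s p) * ghost φ μ ν s (shear s p) :=
        mul_nonneg h7 (by linarith)
      have h11 : ν ^ (1 / 3 : ℝ) * absDxThird (shear s p) ^ 2 ≤ ν ^ (1 / 3 : ℝ) * bracket p := by gcongr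
      have h12 : 0 ≤ g * B := by positivity
      calc _ ≤ g * B + ghostDecay φ μ ν s (shear s p) := by
            rw [abs_le]; constructor <;> linarith
        _ ≤ g * B * bracket p + (ν ^ (1 / 3 : ℝ) * bracket p + 1 * bracket p + echoSum μ * bracket p) := by
            have : g * B ≤ g * B * bracket p := le_mul_of_one_le_right h12 hJ1
            have : echoSum μ ≤ echoSum μ * bracket p := le_mul_of_one_le_right hσ hJ1
            linarith
        _ ≤ _ := by
            rw [hQ]
            have : 0 ≤ B * bracket p := by positivity
            linarith
    rw [abs_mul, abs_mul, abs_of_nonneg (sq_nonneg (χ _)), 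
      abs_of_nonneg (sq_nonneg (Real.sqrt (bracket p) ^ m)), ← hpow]
    gcongr
    · exact hχ (shear s p |>.1, p.2)
    · exact sqrt_bracket_rpow_sq_le m p

end

/-! ### Pointwise kernel bounds -/

section
variable {φ : ℝ → ℝ} {μ δ₀ ν m t : ℝ}

/-- The square root `e^{δ₀ν^{1/3}t/2}` of the exponential factor of `M`. -/
noncomputable def expHalf (δ₀ ν t : ℝ) (p : ℤ × ℝ) : ℝ := Real.exp (growth δ₀ ν p * t / 2)

/-- The square root of the symbol of the dissipation. -/
noncomputable def dis (μ ν t : ℝ) (p : ℤ × ℝ) : ℝ := Real.sqrt (dissip μ ν t p)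

/-- The decaying weight `Λ_t^{1-m}`. -/
noncomputable def lamDecay (m t : ℝ) (p : ℤ × ℝ) : ℝ := Lam t p ^ (1 - m)

theorem dissip_nonneg (hν : 0 < ν) (t : ℝ) (p : ℤ × ℝ) : 0 ≤ dissip μ ν t p := by
  have := Upsilon_nonneg μ t p
  unfold dissip; positivity

theorem dis_nonneg (μ ν t : ℝ) (p : ℤ × ℝ) : 0 ≤ dis μ ν t p := Real.sqrt_nonneg _

theorem dis_sq (hν : 0 < ν) (t : ℝ) (p : ℤ × ℝ) : dis μ ν t p ^ 2 = dissip μ ν t p :=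
  Real.sq_sqrt (dissip_nonneg hν t p)

theorem lamDecay_pos (m t : ℝ) (p : ℤ × ℝ) : 0 < lamDecay m t p := Real.rpow_pos_of_pos (Lam_pos t p) _

theorem Lam_rpow_mul_lamDecay (m t : ℝ) (p : ℤ × ℝ) : Lam t p ^ m * lamDecay m t p = Lam t p := by
  unfold lamDecay
  rw [← Real.rpow_add (Lam_pos t p)]; simp

theorem one_le_expHalf (hδ : 0 ≤ δ₀) (hν : 0 < ν) (ht : 0 ≤ t) (p : ℤ × ℝ) : 1 ≤ expHalf δ₀ ν t p := by
  unfold expHalf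
  apply Real.one_le_exp
  have := growth_nonneg hδ hν p
  positivity

theorem expHalf_sq (δ₀ ν t : ℝ) (p : ℤ × ℝ) : expHalf δ₀ ν t p ^ 2 = Real.exp (growth δ₀ ν p * t) := by
  unfold expHalf; rw [← Real.exp_nat_mul]; congr 1; push_cast; ring

/-- The exponential factor takes only two values, of which the zero mode has the smaller one. -/
theorem expHalf_le_of_ne (hδ : 0 ≤ δ₀) (hν : 0 < ν) (ht : 0 ≤ t) (a : ℤ × ℝ) {b : ℤ × ℝ} (hb : b.1 ≠ 0) :
    expHalf δ₀ ν t a ≤ expHalf δ₀ ν t b := by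
  unfold expHalf
  apply Real.exp_le_exp.2
  have : growth δ₀ ν b = δ₀ * ν ^ (1 / 3 : ℝ) := if_neg hb
  have := growth_le hδ hν a
  gcongr
  linarith

theorem expHalf_mul_Lam_le_wt (hφ : IsProfile φ) (hμ : μ < 1) (δ₀ ν m t : ℝ) (p : ℤ × ℝ) :
    expHalf δ₀ ν t p * Lam t p ^ m ≤ wt φ μ δ₀ ν m t p := by
  unfold wt
  have hL := Lam_pos t p
  gcongr
  apply Real.le_sqrt_of_sq_le
  rw [expHalf_sq, M_eq]
  exact le_mul_of_one_le_right (Real.exp_pos _).le (one_le_ghost hφ hμ ν t p)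

theorem wt_le (hφ : IsProfile φ) (hμ : μ < 1) (δ₀ ν m t : ℝ) (p : ℤ × ℝ) :
    wt φ μ δ₀ ν m t p ≤ ghostBound μ * (expHalf δ₀ ν t p * Lam t p ^ m) := by
  unfold wt
  have hL := Lam_pos t p
  have hE : 0 < expHalf δ₀ ν t p := Real.exp_pos _
  have hB := two_le_ghostBound μ
  rw [← mul_assoc]
  gcongr
  rw [Real.sqrt_le_left (by positivity), mul_pow, expHalf_sq, M_eq, mul_comm]
  gcongr
  have h1 := ghost_le hφ hμ ν t p
  nlinarith

theorem wt_nonneg (φ : ℝ → ℝ) (μ δ₀ ν m t : ℝ) (p : ℤ × ℝ) : 0 ≤ wt φ μ δ₀ ν m t p := by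
  unfold wt
  have := Lam_pos t p
  positivity

theorem abs_fst_le_Lam (t : ℝ) (p : ℤ × ℝ) : |(p.1 : ℝ)| ≤ Lam t p := by
  apply Real.le_sqrt_of_sq_le
  rw [sq_abs]; nlinarith [sq_nonneg (p.2 + t * p.1)]

theorem abs_snd_le_Lam (t : ℝ) (p : ℤ × ℝ) : |p.2 + t * p.1| ≤ Lam t p := by
  apply Real.le_sqrt_of_sq_le
  rw [sq_abs]; nlinarith [sq_nonneg (p.1 : ℝ)]

theorem Lam_le_add (t : ℝ) (b c : ℤ × ℝ) : Lam t (b + c) ≤ Lam t b + Lam t c := by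
  have hb := Lam_pos t b
  have hc := Lam_pos t c
  have hb2 := Lam_sq t b
  have hc2 := Lam_sq t c
  have ha2 := Lam_sq t (b + c)
  simp only [Prod.fst_add, Prod.snd_add, Int.cast_add] at ha2
  set x := (b.1 : ℝ); set y := b.2 + t * b.1; set x' := (c.1 : ℝ); set y' := c.2 + t * c.1
  have hy : b.2 + c.2 + t * (x + x') = y + y' := by ring
  rw [hy] at ha2
  have hcs : x * x' + y * y' ≤ Lam t b * Lam t c := by
    refine le_of_sq_le_sq ?_ (by positivity)
    rw [mul_pow, hb2, hc2]
    nlinarith [sq_nonneg (x * y' - y * x'), sq_nonneg x, sq_nonneg y, sq_nonneg x', sq_nonneg y']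
  refine le_of_sq_le_sq ?_ (by positivity)
  rw [show (Lam t b + Lam t c) ^ 2 = Lam t b ^ 2 + Lam t c ^ 2 + 2 * (Lam t b * Lam t c) by ring,
    ha2, hb2, hc2]
  nlinarith

theorem rpow_le_of_le_add {x y z m : ℝ} (hx : 0 ≤ x) (hy : 0 ≤ y) (hyz : y ≤ z) (hm : 0 ≤ m)
    (h : x ≤ y + z) : x ^ m ≤ 2 ^ m * z ^ m := by
  rw [← Real.mul_rpow (by norm_num) (by linarith)]
  exact Real.rpow_le_rpow hx (by linarith) hm

theorem absD_nonneg (p : ℤ × ℝ) : 0 ≤ absD p := Real.sqrt_nonneg _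

theorem one_le_absD {p : ℤ × ℝ} (hp : p.1 ≠ 0) : 1 ≤ absD p := by
  have : (1 : ℝ) ≤ (p.1 : ℝ) ^ 2 := by
    have h1 : (1 : ℤ) ≤ |p.1| := Int.one_le_abs hp
    have h2 : (1 : ℝ) ≤ |(p.1 : ℝ)| := by exact_mod_cast h1
    rw [← sq_abs]; exact one_le_pow₀ h2
  unfold absD
  rw [Real.one_le_sqrt]
  nlinarith [sq_nonneg p.2]

theorem one_le_abs_cast {k : ℤ} (hk : k ≠ 0) : (1 : ℝ) ≤ |(k : ℝ)| := by
  have h1 : (1 : ℤ) ≤ |k| := Int.one_le_abs hk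
  exact_mod_cast h1

theorem abs_snd_le_absD (p : ℤ × ℝ) : |p.2| ≤ absD p := by
  apply Real.le_sqrt_of_sq_le; rw [sq_abs]; nlinarith [sq_nonneg (p.1 : ℝ)]

theorem abs_fst_le_absD (p : ℤ × ℝ) : |(p.1 : ℝ)| ≤ absD p := by
  apply Real.le_sqrt_of_sq_le; rw [sq_abs]; nlinarith [sq_nonneg p.2]

/-! ### Lower bounds for the dissipation, in terms of `h = ν^{1/6}` -/

theorem viscous_le_dis {h : ℝ} (hh : 0 < h) (hν : ν = h ^ 6) (t : ℝ) (p : ℤ × ℝ) :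
    h ^ 3 * absD p ≤ dis μ ν t p := by
  apply Real.le_sqrt_of_sq_le
  have hν0 : 0 < ν := by rw [hν]; positivity
  have := Upsilon_nonneg μ t p
  have h1 : (h ^ 3 * absD p) ^ 2 = ν * absD p ^ 2 := by rw [hν]; ring
  rw [h1]; unfold dissip
  have h2 : 0 ≤ ν ^ (1 / 3 : ℝ) * absDxThird p ^ 2 := by positivity
  have h3 : 0 ≤ (p.1 : ℝ) ^ 2 / absD p ^ 2 := by positivity
  linarith

theorem rpow_third_eq {h : ℝ} (hh : 0 < h) (hν : ν = h ^ 6) : ν ^ (1 / 3 : ℝ) = h ^ 2 := by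
  rw [hν, ← Real.rpow_natCast, ← Real.rpow_natCast, ← Real.rpow_mul hh.le]; norm_num

theorem enhanced_le_dis {h : ℝ} (hh : 0 < h) (hν : ν = h ^ 6) (t : ℝ) (p : ℤ × ℝ) :
    h * absDxThird p ≤ dis μ ν t p := by
  apply Real.le_sqrt_of_sq_le
  have hν0 : 0 < ν := by rw [hν]; positivity
  have := Upsilon_nonneg μ t p
  have h1 : (h * absDxThird p) ^ 2 = ν ^ (1 / 3 : ℝ) * absDxThird p ^ 2 := by
    rw [rpow_third_eq hh hν]; ring
  rw [h1]; unfold dissip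
  have h2 : 0 ≤ ν * absD p ^ 2 := by positivity
  have h3 : 0 ≤ (p.1 : ℝ) ^ 2 / absD p ^ 2 := by positivity
  linarith

theorem one_le_absDxThird {p : ℤ × ℝ} (hp : p.1 ≠ 0) : 1 ≤ absDxThird p :=
  Real.one_le_rpow (one_le_abs_cast hp) (by norm_num)

theorem le_dis_of_ne {h : ℝ} (hh : 0 < h) (hν : ν = h ^ 6) (t : ℝ) {p : ℤ × ℝ} (hp : p.1 ≠ 0) :
    h ≤ dis μ ν t p :=
  (le_mul_of_one_le_right hh.le (one_le_absDxThird hp)).trans (enhanced_le_dis hh hν t p)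

theorem damping_le_dis (hν : 0 < ν) (t : ℝ) (p : ℤ × ℝ) : |(p.1 : ℝ)| / absD p ≤ dis μ ν t p := by
  apply Real.le_sqrt_of_sq_le
  have := Upsilon_nonneg μ t p
  rw [div_pow, sq_abs]; unfold dissip
  have h1 : 0 ≤ ν ^ (1 / 3 : ℝ) * absDxThird p ^ 2 := by positivity
  have h2 : 0 ≤ ν * absD p ^ 2 := by positivity
  linarith

theorem sqrt_Upsilon_le_dis (hν : 0 < ν) (t : ℝ) (p : ℤ × ℝ) :
    Real.sqrt (Upsilon μ t p) ≤ dis μ ν t p := by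
  apply Real.sqrt_le_sqrt
  unfold dissip
  have h1 : 0 ≤ ν ^ (1 / 3 : ℝ) * absDxThird p ^ 2 := by positivity
  have h2 : 0 ≤ ν * absD p ^ 2 := by positivity
  have h3 : 0 ≤ (p.1 : ℝ) ^ 2 / absD p ^ 2 := by positivity
  linarith

/-- Interpolation between viscosity and enhanced dissipation. -/
theorem interpolation_le_dis_sq {h : ℝ} (hh : 0 < h) (hν : ν = h ^ 6) (t : ℝ) (p : ℤ × ℝ) :
    h ^ 3 * |(p.1 : ℝ)| ≤ dis μ ν t p ^ 2 := by
  have h1 := viscous_le_dis (μ := μ) hh hν t p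
  have h2 := enhanced_le_dis (μ := μ) hh hν t p
  have h3 := abs_fst_le_absD p
  have h4 := absDxThird_pow_three p
  have h5 := absDxThird_nonneg p
  set κ := absDxThird p
  set x := h * κ with hx
  have hx0 : 0 ≤ x := by positivity
  have h6 : h ^ 3 * |(p.1 : ℝ)| = x ^ 3 := by rw [← h4]; ring
  have h7 : x ^ 3 ≤ dis μ ν t p := by
    rw [← h6]
    exact (mul_le_mul_of_nonneg_left h3 (by positivity)).trans h1
  rw [h6]
  rcases le_total x 1 with hx1 | hx1
  · calc x ^ 3 ≤ x ^ 2 := pow_le_pow_of_le_one hx0 hx1 (by norm_num)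
      _ ≤ _ := by gcongr
  · calc x ^ 3 ≤ (x ^ 3) ^ 2 := by
          rw [← pow_mul]; exact pow_le_pow_right₀ hx1 (by norm_num)
      _ ≤ _ := by gcongr

/-- The symbol `(|η| |k-l| + |l| |ξ-η|) / (l² + η²)` that bounds the transport of vorticity at
frequency `c = (k-l, ξ-η)` by the velocity at frequency `b = (l, η)`. -/
noncomputable def advSymbol (b c : ℤ × ℝ) : ℝ :=
  (|b.2| * |(c.1 : ℝ)| + |(b.1 : ℝ)| * |c.2|) / absD b ^ 2

/-- The three ways to place the dissipation on two of the three frequencies. -/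
noncomputable def disPairs (μ ν t : ℝ) (b c : ℤ × ℝ) : ℝ :=
  dis μ ν t (b + c) * dis μ ν t b + dis μ ν t b * dis μ ν t c + dis μ ν t (b + c) * dis μ ν t c

/-- Inviscid damping: `|l| / |b|` is of size `1/t`, up to one power of `Λ_t`, and `t ≥ h⁻¹`. This is
where the lower bound on the time is used. -/
theorem inviscid_damping {h : ℝ} (ht : 1 ≤ h * t) (hh : 0 < h) {b : ℤ × ℝ} (hb : b.1 ≠ 0) :
    |(b.1 : ℝ)| ≤ 2 * h * Lam t b * absD b := by
  have h1 := one_le_absD hb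
  have h2 := one_le_Lam t b
  have h3 := abs_snd_le_Lam t b
  have h4 := abs_snd_le_absD b
  have ht0 : 0 < t := by
    by_contra hn
    nlinarith
  have h5 : t * |(b.1 : ℝ)| ≤ Lam t b + absD b := by
    calc t * |(b.1 : ℝ)| = |(b.2 + t * b.1) - b.2| := by
          rw [add_sub_cancel_left, abs_mul, abs_of_pos ht0]
      _ ≤ |b.2 + t * b.1| + |b.2| := abs_sub _ _
      _ ≤ _ := add_le_add h3 h4
  have h6 : Lam t b + absD b ≤ 2 * (Lam t b * absD b) := by nlinarith
  calc |(b.1 : ℝ)| = 1 * |(b.1 : ℝ)| := (one_mul _).symm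
    _ ≤ h * t * |(b.1 : ℝ)| := by gcongr
    _ = h * (t * |(b.1 : ℝ)|) := by ring
    _ ≤ h * (2 * (Lam t b * absD b)) :=
        mul_le_mul_of_nonneg_left (h5.trans h6) hh.le
    _ = _ := by ring

/-- Bound for the symbol when the velocity is at the lower frequency. -/
theorem advSymbol_le_of_low {h : ℝ} (hh : 0 < h) (hh1 : h ≤ 1) (hν : ν = h ^ 6) (ht : 1 ≤ h * t)
    {b c : ℤ × ℝ} (hb : b.1 ≠ 0) :
    h ^ 2 * advSymbol b c ≤ 6 * (Lam t b * disPairs μ ν t b c) := by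
  have hν0 : 0 < ν := by rw [hν]; positivity
  have hP := one_le_absD hb
  have hL := one_le_Lam t b
  have hl := one_le_abs_cast hb
  have hdamp := inviscid_damping ht hh hb
  have hda := dis_nonneg μ ν t (b + c)
  have hdb := dis_nonneg μ ν t b
  have hdc := dis_nonneg μ ν t c
  have hlb := damping_le_dis (μ := μ) hν0 t b
  have hζ : h ^ 3 * |c.2| ≤ dis μ ν t c :=
    (mul_le_mul_of_nonneg_left (abs_snd_le_absD c) (by positivity)).trans (viscous_le_dis hh hν t c)
  have hPinv : (absD b)⁻¹ ≤ 2 * h * Lam t b / |(b.1 : ℝ)| := by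
    rw [inv_le_iff_one_le_mul₀ (by positivity), div_mul_eq_mul_div, le_div_iff₀ (by positivity)]
    linarith
  have hPinv' : (absD b)⁻¹ ≤ 2 * h * Lam t b :=
    hPinv.trans (div_le_self (by positivity) hl)
  set da := dis μ ν t (b + c) with hda'
  set db := dis μ ν t b
  set dc := dis μ ν t c
  -- the vertical velocity
  have hu2 : h ^ 2 * (|(b.1 : ℝ)| * |c.2| / absD b ^ 2) ≤ 2 * (Lam t b * (db * dc)) := by
    calc h ^ 2 * (|(b.1 : ℝ)| * |c.2| / absD b ^ 2)
        = h ^ 2 * |c.2| * (|(b.1 : ℝ)| / absD b) * (absD b)⁻¹ := by field_simp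
      _ ≤ h ^ 2 * |c.2| * db * (2 * h * Lam t b) := by gcongr
      _ = 2 * (Lam t b * (db * (h ^ 3 * |c.2|))) := by ring
      _ ≤ _ := by gcongr
  -- the horizontal velocity
  have hu1 : h ^ 2 * (|b.2| * |(c.1 : ℝ)| / absD b ^ 2) ≤
      4 * (Lam t b * (db * dc + da * dc)) := by
    have h0 : h ^ 2 * (|b.2| * |(c.1 : ℝ)| / absD b ^ 2) ≤
        2 * h ^ 3 * Lam t b * (|(c.1 : ℝ)| / |(b.1 : ℝ)|) := by
      calc h ^ 2 * (|b.2| * |(c.1 : ℝ)| / absD b ^ 2)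
          ≤ h ^ 2 * (absD b * |(c.1 : ℝ)| / absD b ^ 2) := by gcongr; exact abs_snd_le_absD b
        _ = h ^ 2 * |(c.1 : ℝ)| * (absD b)⁻¹ := by field_simp
        _ ≤ h ^ 2 * |(c.1 : ℝ)| * (2 * h * Lam t b / |(b.1 : ℝ)|) := by gcongr
        _ = _ := by ring
    refine h0.trans ?_
    by_cases hn : c.1 = 0
    · rw [hn]; simp; positivity
    have hdc1 : h ≤ dc := le_dis_of_ne hh hν t hn
    have hdb1 : h ≤ db := le_dis_of_ne hh hν t hb
    by_cases hnl : |(c.1 : ℝ)| ≤ 2 * |(b.1 : ℝ)|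
    · calc 2 * h ^ 3 * Lam t b * (|(c.1 : ℝ)| / |(b.1 : ℝ)|) ≤ 2 * h ^ 3 * Lam t b * 2 := by
            gcongr; rw [div_le_iff₀ (by positivity)]; exact hnl
        _ = 4 * (Lam t b * (h * h * h)) := by ring
        _ ≤ 4 * (Lam t b * (db * dc * 1)) := by gcongr
        _ ≤ _ := by gcongr; nlinarith
    · -- both neighbouring frequencies are large: interpolate the dissipation
      have ha1 : |(c.1 : ℝ)| ≤ 2 * |((b + c).1 : ℝ)| := by
        have : |(c.1 : ℝ)| ≤ |((b + c).1 : ℝ)| + |(b.1 : ℝ)| := by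
          calc |(c.1 : ℝ)| = |((b + c).1 : ℝ) - (b.1 : ℝ)| := by
                rw [Prod.fst_add]; push_cast; congr 1; ring
            _ ≤ _ := abs_sub _ _
        linarith
      have i1 := interpolation_le_dis_sq (μ := μ) hh hν t c
      have i2 := interpolation_le_dis_sq (μ := μ) hh hν t (b + c)
      have i3 : h ^ 3 * |(c.1 : ℝ)| ≤ 2 * (da * dc) := by
        refine le_of_sq_le_sq ?_ (by positivity)
        calc (h ^ 3 * |(c.1 : ℝ)|) ^ 2 = (h ^ 3 * |(c.1 : ℝ)|) * (h ^ 3 * |(c.1 : ℝ)|) := by ring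
          _ ≤ dc ^ 2 * (h ^ 3 * (2 * |((b + c).1 : ℝ)|)) := by gcongr
          _ = 2 * (dc ^ 2 * (h ^ 3 * |((b + c).1 : ℝ)|)) := by ring
          _ ≤ 2 * (dc ^ 2 * da ^ 2) := by gcongr
          _ ≤ (2 * (da * dc)) ^ 2 := by nlinarith [mul_nonneg (sq_nonneg dc) (sq_nonneg da)]
      calc 2 * h ^ 3 * Lam t b * (|(c.1 : ℝ)| / |(b.1 : ℝ)|) ≤ 2 * h ^ 3 * Lam t b * |(c.1 : ℝ)| := by
            gcongr; exact div_le_self (abs_nonneg _) hl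
        _ = 2 * (Lam t b * (h ^ 3 * |(c.1 : ℝ)|)) := by ring
        _ ≤ 2 * (Lam t b * (2 * (da * dc))) := by gcongr
        _ = 4 * (Lam t b * (da * dc)) := by ring
        _ ≤ _ := by gcongr; nlinarith
  unfold advSymbol disPairs
  rw [add_div, mul_add]
  have : 0 ≤ Lam t b * (da * db) := by positivity
  have : 0 ≤ Lam t b * (db * dc) := by positivity
  have : 0 ≤ Lam t b * (da * dc) := by positivity
  linarith

/-- The weight `|l|^{-(1+μ)/2}`, which is square summable. -/
noncomputable def lowWeight (μ : ℝ) (b : ℤ × ℝ) : ℝ := |(b.1 : ℝ)| ^ (-(1 + μ) / 2)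

/-- The polynomial inequality behind the echo bound. -/
theorem echo_polynomial {n L r X Y η P : ℝ} (hn : 1 ≤ n) (hL : 1 ≤ L) (hr : 1 ≤ r) (hX0 : 0 ≤ X)
    (hYle : Y ^ 2 ≤ 2 * η ^ 2 + 2 * X ^ 2) (hPL : P = L ^ 2 + η ^ 2) :
    n ^ 2 * ((1 + n + L) ^ 2 + Y ^ 2) * L ^ 2 ≤
      6 * (P * (1 + n + L) * (L * r * n ^ 2 + n * (n + X) ^ 2)) := by
  obtain ⟨A, hA⟩ : ∃ A, A = 1 + n + L := ⟨_, rfl⟩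
  rw [← hA]
  have hP0 : 0 ≤ P := by rw [hPL]; positivity
  have hA0 : 0 < A := by rw [hA]; positivity
  have hAn : A ≤ 2 * n + L := by linarith
  have hAn' : n ≤ A := by linarith
  have hAL : L ≤ A := by linarith
  have hP2 : L ^ 2 ≤ P := by rw [hPL]; nlinarith [sq_nonneg η]
  have hη : η ^ 2 ≤ P := by rw [hPL]; nlinarith [sq_nonneg L]
  have hS1 : n ^ 2 * L ≤ L * r * n ^ 2 := by
    calc n ^ 2 * L = L * 1 * n ^ 2 := by ring
      _ ≤ _ := by gcongr
  have hS2 : n ^ 3 ≤ n * (n + X) ^ 2 := by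
    calc n ^ 3 = n * n ^ 2 := by ring
      _ ≤ _ := by gcongr; linarith
  have hS3 : n * X ^ 2 ≤ n * (n + X) ^ 2 := by gcongr; linarith
  have hS0 : 0 ≤ L * r * n ^ 2 := by positivity
  have hS0' : 0 ≤ n * (n + X) ^ 2 := by positivity
  have t1 : n ^ 2 * A ^ 2 * L ^ 2 ≤ 2 * (P * A * (L * r * n ^ 2 + n * (n + X) ^ 2)) := by
    calc n ^ 2 * A ^ 2 * L ^ 2 = L ^ 2 * A * (n ^ 2 * A) := by ring
      _ ≤ P * A * (n ^ 2 * (2 * n + L)) := by gcongr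
      _ = P * A * (2 * n ^ 3 + n ^ 2 * L) := by ring
      _ ≤ P * A * (2 * (L * r * n ^ 2 + n * (n + X) ^ 2)) := by gcongr; linarith
      _ = _ := by ring
  have t2 : n ^ 2 * η ^ 2 * L ^ 2 ≤ P * A * (L * r * n ^ 2 + n * (n + X) ^ 2) := by
    calc n ^ 2 * η ^ 2 * L ^ 2 = η ^ 2 * L * (n ^ 2 * L) := by ring
      _ ≤ P * A * (L * r * n ^ 2 + n * (n + X) ^ 2) := by gcongr; linarith
  have t3 : n ^ 2 * X ^ 2 * L ^ 2 ≤ P * A * (L * r * n ^ 2 + n * (n + X) ^ 2) := by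
    calc n ^ 2 * X ^ 2 * L ^ 2 = L ^ 2 * n * (n * X ^ 2) := by ring
      _ ≤ P * A * (L * r * n ^ 2 + n * (n + X) ^ 2) := by gcongr; linarith
  calc n ^ 2 * (A ^ 2 + Y ^ 2) * L ^ 2 ≤ n ^ 2 * (A ^ 2 + (2 * η ^ 2 + 2 * X ^ 2)) * L ^ 2 := by gcongr
    _ = n ^ 2 * A ^ 2 * L ^ 2 + 2 * (n ^ 2 * η ^ 2 * L ^ 2) + 2 * (n ^ 2 * X ^ 2 * L ^ 2) := by ring
    _ ≤ _ := by linarith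

/-- The symbol `Υ` controls echoes: a velocity at the critical frequency `η ≈ 0` that interacts with
a low frequency `c` is paid for by `Υ` at the outgoing frequency. -/
theorem echo_bound (hμ0 : 0 ≤ μ) (hμ : μ < 1) (t : ℝ) {b c : ℤ × ℝ} (hb : b.1 ≠ 0) (hc : c.1 ≠ 0) :
    |(c.1 : ℝ)| / absD b ≤ 3 * Real.sqrt (Upsilon μ t (b + c)) *
      (|(c.1 : ℝ)| + 2 * (lowWeight μ b * Real.sqrt |(c.1 : ℝ)| * Lam t c)) := by
  have hL := one_le_abs_cast hb
  have hn := one_le_abs_cast hc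
  have hP := one_le_absD hb
  have hterm := upsTerm_le_Upsilon hμ t (b + c) b.1
  have hnL := abs_fst_le_Lam t c
  have hXL := abs_snd_le_Lam t c
  have hlw : lowWeight μ b ^ 2 = (|(b.1 : ℝ)| * |(b.1 : ℝ)| ^ μ)⁻¹ := by
    unfold lowWeight
    rw [← Real.rpow_natCast, ← Real.rpow_mul (abs_nonneg _)]
    nth_rewrite 2 [← Real.rpow_one |(b.1 : ℝ)|]
    rw [← Real.rpow_add (by positivity), ← Real.rpow_neg (abs_nonneg _)]
    congr 1; push_cast; ring
  have hlw0 : 0 ≤ lowWeight μ b := by unfold lowWeight; positivity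
  have hr : 1 ≤ |(b.1 : ℝ)| ^ μ := Real.one_le_rpow hL hμ0
  have hPsq := absD_sq b
  unfold upsTerm at hterm
  rw [if_neg hb] at hterm
  simp only [Prod.fst_add, Prod.snd_add, Int.cast_add, add_sub_cancel_left] at hterm
  set L := |(b.1 : ℝ)| with hLdef
  set n := |(c.1 : ℝ)| with hndef
  set r := L ^ μ with hrdef
  set X := |c.2 + t * c.1| with hX
  set U := Upsilon μ t (b + c) with hU
  set A := 1 + n + L with hA
  set Y := b.2 + c.2 + t * (c.1 : ℝ) with hY
  have hX0 : 0 ≤ X := abs_nonneg _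
  have hYle : Y ^ 2 ≤ 2 * b.2 ^ 2 + 2 * X ^ 2 := by
    have : Y = b.2 + (c.2 + t * c.1) := by rw [hY]; ring
    rw [this, hX, sq_abs]
    nlinarith [sq_nonneg (b.2 - (c.2 + t * c.1))]
  have hPL : absD b ^ 2 = L ^ 2 + b.2 ^ 2 := by rw [hPsq, hLdef, sq_abs]
  have hU0 : 0 ≤ U := Upsilon_nonneg _ _ _
  have hpoly : n ^ 2 * (A ^ 2 + Y ^ 2) * L ^ 2 ≤
      6 * (absD b ^ 2 * A * (L * r * n ^ 2 + n * (n + X) ^ 2)) :=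
    echo_polynomial hn hL hr hX0 hYle hPL
  have hsq : (n / absD b) ^ 2 ≤ 6 * U * (n ^ 2 + lowWeight μ b ^ 2 * n * (n + X) ^ 2) := by
    have hD : 0 < A ^ 2 + Y ^ 2 := by positivity
    calc (n / absD b) ^ 2 ≤ 6 * (r / L * (A / (A ^ 2 + Y ^ 2))) *
          (n ^ 2 + lowWeight μ b ^ 2 * n * (n + X) ^ 2) := by
          rw [hlw]
          have e1 : 6 * (r / L * (A / (A ^ 2 + Y ^ 2))) * (n ^ 2 + (L * r)⁻¹ * n * (n + X) ^ 2) =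
              6 * (A * (L * r * n ^ 2 + n * (n + X) ^ 2)) / ((A ^ 2 + Y ^ 2) * L ^ 2) := by
            field_simp
          rw [e1, div_pow, div_le_div_iff₀ (by positivity) (by positivity)]
          linarith
      _ ≤ _ := by gcongr
  have hns := Real.sq_sqrt (show 0 ≤ n by linarith)
  have hUs := Real.sq_sqrt hU0
  have hLc := Lam_pos t c
  refine le_of_sq_le_sq (hsq.trans ?_) (by positivity)
  calc 6 * U * (n ^ 2 + lowWeight μ b ^ 2 * n * (n + X) ^ 2)
      ≤ 6 * U * (n ^ 2 + lowWeight μ b ^ 2 * n * (2 * Lam t c) ^ 2) := by gcongr; linarith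
    _ = 6 * U * (n ^ 2 + (2 * (lowWeight μ b * Real.sqrt n * Lam t c)) ^ 2) := by
        rw [show (2 * (lowWeight μ b * Real.sqrt n * Lam t c)) ^ 2 =
          lowWeight μ b ^ 2 * (Real.sqrt n ^ 2) * (2 * Lam t c) ^ 2 by ring, hns]
    _ ≤ 9 * U * (n + 2 * (lowWeight μ b * Real.sqrt n * Lam t c)) ^ 2 := by
        have hz0 : 0 ≤ 2 * (lowWeight μ b * Real.sqrt n * Lam t c) := by positivity
        generalize 2 * (lowWeight μ b * Real.sqrt n * Lam t c) = z at hz0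
        have hz : n ^ 2 + z ^ 2 ≤ (n + z) ^ 2 := by nlinarith
        calc 6 * U * (n ^ 2 + z ^ 2) ≤ 6 * U * (n + z) ^ 2 :=
              mul_le_mul_of_nonneg_left hz (by positivity)
          _ ≤ 9 * U * (n + z) ^ 2 := by
              have : 0 ≤ U * (n + z) ^ 2 := by positivity
              linarith
    _ = (3 * Real.sqrt U * (n + 2 * (lowWeight μ b * Real.sqrt n * Lam t c))) ^ 2 := by
        generalize n + 2 * (lowWeight μ b * Real.sqrt n * Lam t c) = z
        linear_combination (-(9 * z ^ 2)) * hUs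

/-- Bound for the symbol when the velocity is at the higher frequency. -/
theorem advSymbol_le_of_high {h : ℝ} (hh : 0 < h) (hh1 : h ≤ 1) (hν : ν = h ^ 6) (ht : 0 ≤ t)
    (hμ0 : 0 ≤ μ) (hμ : μ < 1) (hδ : 0 < δ₀) {b c : ℤ × ℝ} (hb : b.1 ≠ 0) :
    h ^ 2 * advSymbol b c ≤ (2 + 12 / δ₀) * (expHalf δ₀ ν t c *
      (Lam t c + lowWeight μ b * (Real.sqrt |(c.1 : ℝ)| * Lam t c)) * disPairs μ ν t b c) := by
  have hν0 : 0 < ν := by rw [hν]; positivity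
  have hP := one_le_absD hb
  have hL := one_le_Lam t c
  have hl := one_le_abs_cast hb
  have hE := one_le_expHalf hδ.le hν0 ht c
  have hda := dis_nonneg μ ν t (b + c)
  have hdb := dis_nonneg μ ν t b
  have hdc := dis_nonneg μ ν t c
  have hlb := damping_le_dis (μ := μ) hν0 t b
  have hlw : 0 ≤ lowWeight μ b := by unfold lowWeight; positivity
  have hdb1 : h ≤ dis μ ν t b := le_dis_of_ne hh hν t hb
  have hXL := abs_snd_le_Lam t c
  have hnL := abs_fst_le_Lam t c
  have hU := sqrt_Upsilon_le_dis (μ := μ) hν0 t (b + c)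
  have hPP : |b.2| ≤ absD b := abs_snd_le_absD b
  set da := dis μ ν t (b + c) with hda'
  set db := dis μ ν t b
  set dc := dis μ ν t c
  set E := expHalf δ₀ ν t c
  set Q := Lam t c + lowWeight μ b * (Real.sqrt |(c.1 : ℝ)| * Lam t c) with hQ
  have hQL : Lam t c ≤ Q := by
    have : 0 ≤ lowWeight μ b * (Real.sqrt |(c.1 : ℝ)| * Lam t c) := by positivity
    linarith
  have hQ0 : 0 ≤ Q := by linarith
  have hh2 : h ^ 2 ≤ h := by nlinarith
  have hPi : (absD b)⁻¹ ≤ 1 := inv_le_one_of_one_le₀ hP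
  have hinv : (absD b)⁻¹ ≤ db := by
    calc (absD b)⁻¹ = 1 / absD b := (one_div _).symm
      _ ≤ |(b.1 : ℝ)| / absD b := by gcongr
      _ ≤ db := hlb
  have hQE : Lam t c ≤ E * Q := by nlinarith
  -- a term that costs one power of `Λ` at the low frequency
  have hmild : ∀ d, h ≤ d → h ^ 2 * (Lam t c * db) ≤ E * Q * (db * d) := fun d hd => by
    calc h ^ 2 * (Lam t c * db) ≤ d * (E * Q * db) :=
          mul_le_mul (hh2.trans hd) (mul_le_mul_of_nonneg_right hQE hdb) (by positivity)
            (hh.le.trans hd)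
      _ = _ := by ring
  have hlP : ∀ x, 0 ≤ x → |(b.1 : ℝ)| * x / absD b ^ 2 ≤ x * db := fun x hx => by
    calc |(b.1 : ℝ)| * x / absD b ^ 2 = x * (|(b.1 : ℝ)| / absD b) * (absD b)⁻¹ := by field_simp
      _ ≤ x * db * 1 := by gcongr
      _ = _ := mul_one _
  unfold advSymbol disPairs
  by_cases hn : c.1 = 0
  · have ha1 : h ≤ da := le_dis_of_ne hh hν t (by rw [Prod.fst_add, hn, add_zero]; exact hb)
    have hζ : |c.2| ≤ Lam t c := by simpa [hn] using hXL
    calc h ^ 2 * ((|b.2| * |(c.1 : ℝ)| + |(b.1 : ℝ)| * |c.2|) / absD b ^ 2)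
        = h ^ 2 * (|(b.1 : ℝ)| * |c.2| / absD b ^ 2) := by rw [hn]; simp
      _ ≤ h ^ 2 * (Lam t c * db) := by
          gcongr
          exact (hlP _ (abs_nonneg _)).trans (by gcongr)
      _ ≤ E * Q * (db * da) := hmild da ha1
      _ ≤ 2 * (E * Q * (da * db + db * dc + da * dc)) := by
          have : 0 ≤ E * Q * (db * dc) := by positivity
          have : 0 ≤ E * Q * (da * dc) := by positivity
          have : 0 ≤ E * Q * (db * da) := by positivity
          nlinarith
      _ ≤ _ := by
          gcongr
          have : 0 < 12 / δ₀ := by positivity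
          linarith
  · have hc1 : h ≤ dc := le_dis_of_ne hh hν t hn
    have hu1 : h ^ 2 * (|b.2| * |(c.1 : ℝ)| / absD b ^ 2) ≤ E * Q * (db * dc) := by
      calc h ^ 2 * (|b.2| * |(c.1 : ℝ)| / absD b ^ 2)
          ≤ h ^ 2 * (absD b * Lam t c / absD b ^ 2) := by gcongr
        _ = h ^ 2 * (Lam t c * (absD b)⁻¹) := by field_simp
        _ ≤ h ^ 2 * (Lam t c * db) := by gcongr
        _ ≤ _ := hmild dc hc1
    have hζ : |c.2| ≤ Lam t c + t * |(c.1 : ℝ)| := by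
      calc |c.2| = |(c.2 + t * c.1) - t * c.1| := by rw [add_sub_cancel_right]
        _ ≤ |c.2 + t * c.1| + |t * c.1| := abs_sub _ _
        _ ≤ _ := by rw [abs_mul, abs_of_nonneg ht]; gcongr
    have hexp : t * h ^ 2 ≤ 2 / δ₀ * E := by
      have hg : growth δ₀ ν c = δ₀ * h ^ 2 := by
        unfold growth; rw [if_neg hn, rpow_third_eq hh hν]
      have h1 : δ₀ * h ^ 2 * t / 2 ≤ E := by
        have := Real.add_one_le_exp (growth δ₀ ν c * t / 2)
        rw [hg] at this
        have h2 : E = Real.exp (δ₀ * h ^ 2 * t / 2) := by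
          simp only [E]; unfold expHalf; rw [hg]
        rw [h2]; linarith
      rw [div_mul_eq_mul_div, le_div_iff₀ hδ]
      linarith
    have hecho := echo_bound hμ0 hμ t hb hn
    have hmain : h ^ 2 * (|(b.1 : ℝ)| * (t * |(c.1 : ℝ)|) / absD b ^ 2) ≤
        12 / δ₀ * (E * Q * (da * db)) := by
      calc h ^ 2 * (|(b.1 : ℝ)| * (t * |(c.1 : ℝ)|) / absD b ^ 2)
          = (t * h ^ 2) * (|(b.1 : ℝ)| / absD b) * (|(c.1 : ℝ)| / absD b) := by field_simp
        _ ≤ (2 / δ₀ * E) * db * (3 * da *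
            (Lam t c + 2 * (lowWeight μ b * Real.sqrt |(c.1 : ℝ)| * Lam t c))) := by
            gcongr
            refine hecho.trans ?_
            gcongr
        _ ≤ (2 / δ₀ * E) * db * (3 * da * (2 * Q)) := by
            gcongr
            rw [hQ]
            have := Lam_pos t c
            nlinarith
        _ = _ := by ring
    calc h ^ 2 * ((|b.2| * |(c.1 : ℝ)| + |(b.1 : ℝ)| * |c.2|) / absD b ^ 2)
        ≤ h ^ 2 * ((|b.2| * |(c.1 : ℝ)| + |(b.1 : ℝ)| * (Lam t c + t * |(c.1 : ℝ)|)) / absD b ^ 2) := by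
          gcongr
      _ = h ^ 2 * (|b.2| * |(c.1 : ℝ)| / absD b ^ 2) + h ^ 2 * (|(b.1 : ℝ)| * Lam t c / absD b ^ 2) +
          h ^ 2 * (|(b.1 : ℝ)| * (t * |(c.1 : ℝ)|) / absD b ^ 2) := by ring
      _ ≤ E * Q * (db * dc) + E * Q * (db * dc) + 12 / δ₀ * (E * Q * (da * db)) := by
          refine add_le_add (add_le_add hu1 ?_) hmain
          exact (mul_le_mul_of_nonneg_left (hlP _ (by linarith)) (by positivity)).trans (hmild dc hc1)
      _ ≤ _ := by
          have p1 : 0 ≤ E * Q * (da * db) := by positivity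
          have p2 : 0 ≤ 12 / δ₀ * (E * Q * (db * dc)) := by positivity
          have p3 : 0 ≤ (2 + 12 / δ₀) * (E * Q * (da * dc)) := by positivity
          have p4 : (2 + 12 / δ₀) * (E * Q * (da * db + db * dc + da * dc)) =
              2 * (E * Q * (da * db)) + 12 / δ₀ * (E * Q * (da * db)) + 2 * (E * Q * (db * dc)) +
              12 / δ₀ * (E * Q * (db * dc)) + (2 + 12 / δ₀) * (E * Q * (da * dc)) := by ring
          rw [p4]; linarith

/-- The kernel that remains in the trilinear estimate. Each of its terms is square integrable over
`b + c = a`, uniformly in `a`. -/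
noncomputable def advKernel (μ m t : ℝ) (b c : ℤ × ℝ) : ℝ :=
  lamDecay m t b + lamDecay m t c +
    lowWeight μ b * (Real.sqrt |(c.1 : ℝ)| * lamDecay m t c)

/-- The bound for the interaction of the nonzero modes of the velocity with the vorticity. -/
theorem wt_mul_advSymbol_le (hφ : IsProfile φ) (hμ0 : 0 ≤ μ) (hμ : μ < 1) (hδ : 0 < δ₀)
    (hm : 0 ≤ m) {h : ℝ} (hh : 0 < h) (hh1 : h ≤ 1) (hν : ν = h ^ 6) (ht : 1 ≤ h * t)
    {b c : ℤ × ℝ} (hb : b.1 ≠ 0) :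
    wt φ μ δ₀ ν m t (b + c) * (h ^ 2 * advSymbol b c) ≤
      ghostBound μ * 2 ^ m * (6 + 12 / δ₀) * (wt φ μ δ₀ ν m t b * wt φ μ δ₀ ν m t c *
        advKernel μ m t b c * disPairs μ ν t b c) := by
  have hν0 : 0 < ν := by rw [hν]; positivity
  have ht0 : 0 < t := by
    by_contra hn
    nlinarith
  have hB := two_le_ghostBound μ
  have hEb := one_le_expHalf hδ.le hν0 ht0.le b
  have hEc := one_le_expHalf hδ.le hν0 ht0.le c
  have hEab := expHalf_le_of_ne hδ.le hν0 ht0.le (b + c) hb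
  have hwa := wt_le hφ hμ δ₀ ν m t (b + c)
  have hwb := expHalf_mul_Lam_le_wt hφ hμ δ₀ ν m t b
  have hwc := expHalf_mul_Lam_le_wt hφ hμ δ₀ ν m t c
  have hLa := Lam_le_add t b c
  have hLb0 := Lam_pos t b
  have hLc0 := Lam_pos t c
  have hLa0 := Lam_pos t (b + c)
  have hDb := Lam_rpow_mul_lamDecay m t b
  have hDc := Lam_rpow_mul_lamDecay m t c
  have hlb := (lamDecay_pos m t b).le
  have hlc := (lamDecay_pos m t c).le
  have hlw : 0 ≤ lowWeight μ b := by unfold lowWeight; positivity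
  have hpair : 0 ≤ disPairs μ ν t b c := by
    have hda := dis_nonneg μ ν t (b + c)
    have hdb := dis_nonneg μ ν t b
    have hdc := dis_nonneg μ ν t c
    unfold disPairs; positivity
  have hwb0 := wt_nonneg φ μ δ₀ ν m t b
  have hwc0 := wt_nonneg φ μ δ₀ ν m t c
  have hadv : 0 ≤ advSymbol b c := by unfold advSymbol; positivity
  set B := ghostBound μ
  set P := disPairs μ ν t b c
  set w := wt φ μ δ₀ ν m t
  set E := expHalf δ₀ ν t
  have h12 : 0 < 12 / δ₀ := by positivity
  have hk1 : lamDecay m t b ≤ advKernel μ m t b c := by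
    have : 0 ≤ lowWeight μ b * (Real.sqrt |(c.1 : ℝ)| * lamDecay m t c) := by positivity
    unfold advKernel; linarith
  have hk2 : lamDecay m t c + lowWeight μ b * (Real.sqrt |(c.1 : ℝ)| * lamDecay m t c) ≤
      advKernel μ m t b c := by
    unfold advKernel; linarith
  rcases le_total (Lam t b) (Lam t c) with hbc | hbc
  · have h1 := rpow_le_of_le_add hLa0.le hLb0.le hbc hm hLa
    have h2 := advSymbol_le_of_low (μ := μ) hh hh1 hν ht (c := c) hb
    calc w (b + c) * (h ^ 2 * advSymbol b c)
        ≤ (B * (E b * (2 ^ m * Lam t c ^ m))) * (6 * (Lam t b * P)) := by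
          gcongr
          exact hwa.trans (by gcongr)
      _ = B * 2 ^ m * 6 * ((E b * Lam t b ^ m) * (1 * Lam t c ^ m) * lamDecay m t b * P) := by
          linear_combination (-(B * 2 ^ m * 6 * E b * Lam t c ^ m * P)) * hDb
      _ ≤ B * 2 ^ m * (6 + 12 / δ₀) * (w b * w c * advKernel μ m t b c * P) := by
          gcongr
          · linarith
          · exact le_trans (by gcongr) hwc
  · have h1 := rpow_le_of_le_add hLa0.le hLc0.le hbc hm (hLa.trans_eq (add_comm _ _))
    have h2 := advSymbol_le_of_high (μ := μ) (c := c) hh hh1 hν ht0.le hμ0 hμ hδ hb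
    calc w (b + c) * (h ^ 2 * advSymbol b c)
        ≤ (B * (E b * (2 ^ m * Lam t b ^ m))) * ((2 + 12 / δ₀) * (E c *
            (Lam t c + lowWeight μ b * (Real.sqrt |(c.1 : ℝ)| * Lam t c)) * P)) := by
          gcongr
          exact hwa.trans (by gcongr)
      _ = B * 2 ^ m * (2 + 12 / δ₀) * ((E b * Lam t b ^ m) * (E c * Lam t c ^ m) *
            (lamDecay m t c + lowWeight μ b * (Real.sqrt |(c.1 : ℝ)| * lamDecay m t c)) * P) := by
          linear_combination (-(B * 2 ^ m * (2 + 12 / δ₀) * E b * Lam t b ^ m * E c * P *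
            (1 + lowWeight μ b * Real.sqrt |(c.1 : ℝ)|))) * hDc
      _ ≤ B * 2 ^ m * (6 + 12 / δ₀) * (w b * w c * advKernel μ m t b c * P) := by
          gcongr
          linarith

end

/-! ### The commutator with the transport by the shear flow `(u₁)₀` -/

section
variable {φ : ℝ → ℝ} {μ δ₀ ν m t : ℝ}

theorem abs_arctan_sub_arctan_le (x y : ℝ) : |Real.arctan x - Real.arctan y| ≤ |x - y| := by
  have h := Convex.norm_image_sub_le_of_norm_hasDerivWithin_le (f := Real.arctan)
    (f' := fun x => 1 / (1 + x ^ 2)) (C := 1) (s := univ) (x := y) (y := x)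
    (fun x _ => (Real.hasDerivAt_arctan x).hasDerivWithinAt)
    (fun x _ => by
      rw [Real.norm_of_nonneg (by positivity), div_le_one (by positivity)]
      nlinarith [sq_nonneg x]) convex_univ (mem_univ _) (mem_univ _)
  simpa using h

theorem IsProfile.abs_sub_le (hφ : IsProfile φ) (x y : ℝ) : |φ x - φ y| ≤ 1 / 4 * |x - y| := by
  have h := Convex.norm_image_sub_le_of_norm_deriv_le (f := φ) (C := 1 / 4) (s := univ)
    (x := y) (y := x) (fun x _ => hφ.smooth.differentiable (by simp) x)
    (fun x _ => by rw [Real.norm_of_nonneg (hφ.deriv_range x).1]; exact (hφ.deriv_range x).2)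
    convex_univ (mem_univ _) (mem_univ _)
  simpa using h

theorem abs_fst_mul_M₁_sub_le (hφ : IsProfile φ) (hν : 0 < ν) {k : ℤ} (hk : k ≠ 0) (x y : ℝ) :
    |(k : ℝ)| * |M₁ φ ν (k, x) - M₁ φ ν (k, y)| ≤
      ν ^ (1 / 3 : ℝ) * absDxThird (k, x) ^ 2 * |x - y| := by
  have hk0 : (0 : ℝ) < |(k : ℝ)| := by positivity
  have hs : |Real.sign (k : ℝ)| ≤ 1 := by
    rcases Real.sign_apply_eq (k : ℝ) with h | h | h <;> rw [h] <;> norm_num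
  have hκ : |(k : ℝ)| * |(k : ℝ)| ^ (-(1 / 3) : ℝ) = absDxThird (k, x) ^ 2 := by
    unfold absDxThird
    nth_rewrite 1 [← Real.rpow_one |(k : ℝ)|]
    rw [← Real.rpow_add hk0, ← Real.rpow_natCast, ← Real.rpow_mul hk0.le]; norm_num
  simp only [M₁, if_neg hk]
  calc _ ≤ |(k : ℝ)| * (1 / 4 * |ν ^ (1 / 3 : ℝ) * |(k : ℝ)| ^ (-(1 / 3) : ℝ) * Real.sign k * x -
        ν ^ (1 / 3 : ℝ) * |(k : ℝ)| ^ (-(1 / 3) : ℝ) * Real.sign k * y|) := by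
        gcongr; exact hφ.abs_sub_le _ _
    _ = 1 / 4 * (ν ^ (1 / 3 : ℝ) * (|(k : ℝ)| * |(k : ℝ)| ^ (-(1 / 3) : ℝ)) *
        |Real.sign (k : ℝ)| * |x - y|) := by
        rw [← mul_sub, abs_mul, abs_mul, abs_mul, abs_of_pos (Real.rpow_pos_of_pos hν _),
          abs_of_pos (Real.rpow_pos_of_pos hk0 _)]
        ring
    _ ≤ 1 * (ν ^ (1 / 3 : ℝ) * (|(k : ℝ)| * |(k : ℝ)| ^ (-(1 / 3) : ℝ)) * 1 * |x - y|) := by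
        gcongr; norm_num
    _ = _ := by rw [hκ]; ring

theorem abs_fst_mul_M₂_sub_le (ν : ℝ) {k : ℤ} (hk : k ≠ 0) (x y : ℝ) :
    |(k : ℝ)| * |M₂ ν (k, x) - M₂ ν (k, y)| ≤ |x - y| := by
  have hk0 : (0 : ℝ) < |(k : ℝ)| := by positivity
  unfold M₂
  dsimp only
  split_ifs
  · rw [add_sub_add_left_eq_sub]
    calc _ ≤ |(k : ℝ)| * |x / k - y / k| := 
          mul_le_mul_of_nonneg_left (abs_arctan_sub_arctan_le _ _) hk0.le
      _ = |x - y| := by rw [← sub_div, abs_div]; field_simp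
  · simp

theorem abs_fst_mul_echoTerm_sub_le (μ t : ℝ) (k l : ℤ) (x y : ℝ) :
    |(k : ℝ)| * |echoTerm μ t (k, x) l - echoTerm μ t (k, y) l| ≤ echoCoef μ l * |x - y| := by
  unfold echoTerm echoCoef
  dsimp only
  split_ifs
  · simp
  set A := 1 + |(k : ℝ) - l| + |(l : ℝ)| with hA
  have hA0 : 0 < A := by positivity
  have hkA : |(k : ℝ)| ≤ A := by
    have : |(k : ℝ)| ≤ |(k : ℝ) - l| + |(l : ℝ)| := by
      calc |(k : ℝ)| = |((k : ℝ) - l) + l| := by rw [sub_add_cancel]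
        _ ≤ _ := abs_add_le _ _
    linarith
  have hs : |Real.sign (l : ℝ)| ≤ 1 := by
    rcases Real.sign_apply_eq (l : ℝ) with h | h | h <;> rw [h] <;> norm_num
  have hd : |Real.arctan ((x + t * (k - l)) / A) - Real.arctan ((y + t * (k - l)) / A)| ≤
      |x - y| / A := by
    refine (abs_arctan_sub_arctan_le _ _).trans_eq ?_
    rw [← sub_div, abs_div, abs_of_pos hA0, add_sub_add_right_eq_sub]
  rw [← mul_sub, add_sub_add_right_eq_sub, ← mul_sub, abs_mul, abs_mul,
    abs_of_nonneg (show 0 ≤ |(l : ℝ)| ^ μ / |(l : ℝ)| ^ 2 by positivity)]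
  calc _ ≤ A * (|(l : ℝ)| ^ μ / |(l : ℝ)| ^ 2 * (1 * (|x - y| / A))) := by gcongr
    _ = _ := by field_simp

theorem abs_fst_mul_M₃_sub_le (hμ : μ < 1) (ν t : ℝ) (k : ℤ) (x y : ℝ) :
    |(k : ℝ)| * |M₃ μ ν t (k, x) - M₃ μ ν t (k, y)| ≤ echoSum μ * |x - y| := by
  rw [M₃_eq, M₃_eq]
  dsimp only
  split_ifs
  · rw [← (summable_echoTerm hμ t (k, x)).tsum_sub (summable_echoTerm hμ t (k, y)),
      ← abs_of_nonneg (abs_nonneg (k : ℝ)), ← abs_mul, ← tsum_mul_left, ← Real.norm_eq_abs]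
    refine tsum_of_norm_bounded ((summable_echoCoef hμ).hasSum.mul_right _) fun l => ?_
    rw [Real.norm_eq_abs, abs_mul, abs_abs]
    simpa using abs_fst_mul_echoTerm_sub_le μ t k l x y
  · simp only [sub_self, abs_zero, mul_zero]
    have := echoSum_nonneg μ
    positivity

theorem abs_fst_mul_ghost_sub_le (hφ : IsProfile φ) (hμ : μ < 1) (hν : 0 < ν) (t : ℝ) {k : ℤ}
    (hk : k ≠ 0) (x y : ℝ) :
    |(k : ℝ)| * |ghost φ μ ν t (k, x) - ghost φ μ ν t (k, y)| ≤
      (ν ^ (1 / 3 : ℝ) * absDxThird (k, x) ^ 2 + (1 + echoSum μ)) * |x - y| := by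
  have h1 := abs_fst_mul_M₁_sub_le hφ hν hk x y
  have h2 := abs_fst_mul_M₂_sub_le ν hk x y
  have h3 := abs_fst_mul_M₃_sub_le hμ ν t k x y
  have e : ghost φ μ ν t (k, x) - ghost φ μ ν t (k, y) =
      (M₁ φ ν (k, x) - M₁ φ ν (k, y)) + (M₂ ν (k, x) - M₂ ν (k, y)) +
      (M₃ μ ν t (k, x) - M₃ μ ν t (k, y)) := by unfold ghost; ring
  rw [e]
  have h4 := mul_le_mul_of_nonneg_left (abs_add_three (M₁ φ ν (k, x) - M₁ φ ν (k, y))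
    (M₂ ν (k, x) - M₂ ν (k, y)) (M₃ μ ν t (k, x) - M₃ μ ν t (k, y))) (abs_nonneg (k : ℝ))
  linarith

theorem rpow_sub_rpow_le {x z q : ℝ} (hz : 0 < z) (hzx : z ≤ x) (hq : 1 ≤ q) :
    x ^ q - z ^ q ≤ q * x ^ (q - 1) * (x - z) := by
  have hx : 0 < x := hz.trans_le hzx
  have hb := one_add_mul_self_le_rpow_one_add (s := z / x - 1) (p := q)
    (by have : 0 < z / x := by positivity
        linarith) hq
  rw [add_sub_cancel, Real.div_rpow hz.le hx.le, le_div_iff₀ (by positivity)] at hb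
  have hxq : x ^ q = x ^ (q - 1) * x := by
    rw [← Real.rpow_add_one hx.ne']; congr 1; ring
  have : (1 + q * (z / x - 1)) * x ^ q = x ^ q - q * x ^ (q - 1) * (x - z) := by
    rw [hxq]; field_simp; ring
  linarith

theorem abs_Lam_sub_le {t : ℝ} {b c : ℤ × ℝ} (hb : b.1 = 0) : |Lam t (b + c) - Lam t c| ≤ |b.2| := by
  have hc := Lam_pos t c
  have ha := Lam_pos t (b + c)
  have hcs := Lam_sq t c
  have has := Lam_sq t (b + c)
  have hy := abs_snd_le_Lam t c
  have hy' := abs_snd_le_Lam t (b + c)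
  simp only [Prod.fst_add, Prod.snd_add, hb, zero_add] at has hy'
  set z := Lam t c
  set x := Lam t (b + c)
  have e : (x - z) * (x + z) = b.2 * ((b.2 + c.2 + t * c.1) + (c.2 + t * c.1)) := by
    linear_combination has - hcs
  have h1 : |x - z| * (x + z) ≤ |b.2| * (x + z) := by
    calc |x - z| * (x + z) = |(x - z) * (x + z)| := by rw [abs_mul, abs_of_pos (by linarith : 0 < x + z)]
      _ = |b.2| * |(b.2 + c.2 + t * c.1) + (c.2 + t * c.1)| := by rw [e, abs_mul]
      _ ≤ |b.2| * (x + z) := by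
        gcongr; exact (abs_add_le _ _).trans (add_le_add hy' hy)
  exact le_of_mul_le_mul_right h1 (by linarith)

/-- The kernel that remains in the commutator estimate. Each of its terms is a square integrable
function of one of the three frequencies. -/
noncomputable def commKernel (m t : ℝ) (b c : ℤ × ℝ) : ℝ :=
  lamDecay m t (b + c) + lamDecay m t b + lamDecay m t c

/-- A product estimate for `x^{m-1} z`: as `x ≤ z + β`, the powers of `x` fall on the larger of `z`
and `β`, and the smaller one keeps the decaying factor `β^{1-m}` or `z^{1-m}`. -/
theorem rpow_interp {x z β m : ℝ} (hz : 1 ≤ z) (hβ : 1 ≤ β) (hx : 0 < x) (hx2 : x ≤ z + β)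
    (hm : 1 ≤ m) :
    x ^ (m - 1) * z ≤ 2 ^ (m - 1) * (z ^ m * β ^ m * (β ^ (1 - m) + z ^ (1 - m))) := by
  have hz0 : 0 < z := by linarith
  have hβ0 : 0 < β := by linarith
  have eβ : β ^ m * β ^ (1 - m) = β := by rw [← Real.rpow_add hβ0]; simp
  have ez : z ^ m * z ^ (1 - m) = z := by rw [← Real.rpow_add hz0]; simp
  have e : z ^ m * β ^ m * (β ^ (1 - m) + z ^ (1 - m)) = z ^ m * β + β ^ m * z := by
    linear_combination z ^ m * eβ + β ^ m * ez
  rw [e]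
  have hzm : 0 < z ^ m := by positivity
  have hβm : 0 < β ^ m := by positivity
  have h2 : (0 : ℝ) < 2 ^ (m - 1) := by positivity
  rcases le_total z β with h | h
  · have h1 := rpow_le_of_le_add hx.le hz0.le h (by linarith : 0 ≤ m - 1) hx2
    have h3 : β ^ (m - 1) ≤ β ^ m := Real.rpow_le_rpow_of_exponent_le hβ (by linarith)
    calc x ^ (m - 1) * z ≤ 2 ^ (m - 1) * β ^ m * z := by
          gcongr; exact h1.trans (by gcongr)
      _ = 2 ^ (m - 1) * (β ^ m * z) := by ring
      _ ≤ _ := by gcongr; nlinarith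
  · have h1 := rpow_le_of_le_add hx.le hβ0.le h (by linarith : 0 ≤ m - 1) (by linarith)
    have h3 : z ^ (m - 1) * z = z ^ m := by rw [← Real.rpow_add_one hz0.ne']; congr 1; ring
    calc x ^ (m - 1) * z ≤ 2 ^ (m - 1) * z ^ (m - 1) * z := by gcongr
      _ = 2 ^ (m - 1) * (z ^ m * 1) := by rw [mul_assoc, h3, mul_one]
      _ ≤ 2 ^ (m - 1) * (z ^ m * β) := by gcongr
      _ ≤ _ := by gcongr; nlinarith

/-- The commutator bound in abstract form: the weight `g x^{2m}` is compared at the two frequencies,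
of which `x` is the larger one, and one derivative `k` is traded for `s`. -/
theorem weight_sq_sub_le {x z β m g g' κ s S B d : ℝ} (hz : 1 ≤ z) (hβ : 1 ≤ β) (hzx : z ≤ x)
    (hx2 : x ≤ z + β) (hm : 1 ≤ m) (hs : 0 ≤ s) (hxs : x - z ≤ s) (hκ : 0 ≤ κ) (hκz : κ ≤ z)
    (hg0 : 0 ≤ g) (hgB : g ≤ B) (hgg : κ * |g - g'| ≤ S * s) (hB : 0 ≤ B) {h : ℝ}
    (hd : h ^ 2 ≤ d) (hSd : h ^ 2 * S ≤ d * B) :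
    h ^ 2 * (κ * |g * (x ^ m) ^ 2 - g' * (z ^ m) ^ 2|) ≤
      (1 + 2 * m * 2 ^ (m - 1)) * B * (d * s * (x ^ m * z ^ m * β ^ m * (β ^ (1 - m) + z ^ (1 - m)))) := by
  have hx0 : 0 < x := by linarith
  have hz0 : 0 < z := by linarith
  have hβ0 : 0 < β := by linarith
  set K := β ^ m * (β ^ (1 - m) + z ^ (1 - m)) with hK
  have eβ : β ^ m * β ^ (1 - m) = β := by rw [← Real.rpow_add hβ0]; simp
  have hK1 : 1 ≤ K := by
    have : 0 < β ^ m * z ^ (1 - m) := by positivity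
    rw [hK, mul_add, eβ]; linarith
  have hzm : 0 < z ^ m := by positivity
  have hxm : 0 < x ^ m := by positivity
  have hzxm : z ^ m ≤ x ^ m := Real.rpow_le_rpow hz0.le hzx (by linarith)
  have hd0 : 0 ≤ d := (sq_nonneg h).trans hd
  have e1 : g * (x ^ m) ^ 2 - g' * (z ^ m) ^ 2 =
      (g - g') * (z ^ m) ^ 2 + g * ((x ^ m) ^ 2 - (z ^ m) ^ 2) := by ring
  have h0 : 0 ≤ (x ^ m) ^ 2 - (z ^ m) ^ 2 := by nlinarith
  have h1 : (x ^ m) ^ 2 - (z ^ m) ^ 2 ≤ 2 * m * (x ^ m * x ^ (m - 1)) * s := by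
    have := rpow_sub_rpow_le hz0 hzx (show 1 ≤ 2 * m by linarith)
    have e2 : ∀ u : ℝ, 0 < u → u ^ (2 * m) = (u ^ m) ^ 2 := fun u hu => by
      rw [← Real.rpow_natCast, ← Real.rpow_mul hu.le]; congr 1; push_cast; ring
    rw [e2 x hx0, e2 z hz0] at this
    have e3 : x ^ (2 * m - 1) = x ^ m * x ^ (m - 1) := by
      rw [← Real.rpow_add hx0]; congr 1; ring
    rw [e3] at this
    refine this.trans ?_
    gcongr
  have hin := rpow_interp hz hβ hx0 hx2 hm
  rw [mul_assoc, ← hK] at hin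
  have hP : x ^ m * z ^ m * β ^ m * (β ^ (1 - m) + z ^ (1 - m)) = x ^ m * z ^ m * K := by
    rw [hK]; ring
  rw [hP]
  have hA : h ^ 2 * (κ * (|g - g'| * (z ^ m) ^ 2)) ≤ B * (d * s * (x ^ m * z ^ m * K)) := by
    calc h ^ 2 * (κ * (|g - g'| * (z ^ m) ^ 2)) = h ^ 2 * (κ * |g - g'|) * (z ^ m) ^ 2 := by ring
      _ ≤ h ^ 2 * (S * s) * (z ^ m) ^ 2 := by gcongr
      _ = (h ^ 2 * S) * s * (z ^ m * z ^ m * 1) := by ring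
      _ ≤ (d * B) * s * (x ^ m * z ^ m * K) := by gcongr
      _ = _ := by ring
  have hC : h ^ 2 * (κ * (g * ((x ^ m) ^ 2 - (z ^ m) ^ 2))) ≤
      2 * m * 2 ^ (m - 1) * B * (d * s * (x ^ m * z ^ m * K)) := by
    calc h ^ 2 * (κ * (g * ((x ^ m) ^ 2 - (z ^ m) ^ 2)))
        ≤ d * (z * (B * (2 * m * (x ^ m * x ^ (m - 1)) * s))) := by gcongr
      _ = 2 * m * B * d * s * x ^ m * (x ^ (m - 1) * z) := by ring
      _ ≤ 2 * m * B * d * s * x ^ m * (2 ^ (m - 1) * (z ^ m * K)) := by gcongr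
      _ = _ := by ring
  calc h ^ 2 * (κ * |g * (x ^ m) ^ 2 - g' * (z ^ m) ^ 2|)
      ≤ h ^ 2 * (κ * (|g - g'| * (z ^ m) ^ 2 + g * ((x ^ m) ^ 2 - (z ^ m) ^ 2))) := by
        rw [e1]
        gcongr
        refine (abs_add_le _ _).trans_eq ?_
        rw [abs_mul, abs_mul, abs_of_nonneg h0, abs_of_nonneg hg0,
          abs_of_nonneg (sq_nonneg (z ^ m))]
    _ = h ^ 2 * (κ * (|g - g'| * (z ^ m) ^ 2)) + h ^ 2 * (κ * (g * ((x ^ m) ^ 2 - (z ^ m) ^ 2))) := by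
        ring
    _ ≤ _ := by linarith

/-- The bound for the interaction of the zero mode of the velocity with the transported quantity,
after symmetrization. -/
theorem wt_sq_sub_le (hφ : IsProfile φ) (hμ : μ < 1) (hδ : 0 ≤ δ₀) (hm : 1 ≤ m) {h : ℝ} (hh : 0 < h)
    (hh1 : h ≤ 1) (hν : ν = h ^ 6) (ht : 0 ≤ t) {b c : ℤ × ℝ} (hb : b.1 = 0) :
    h ^ 2 * (|(c.1 : ℝ)| * |wt φ μ δ₀ ν m t (b + c) ^ 2 - wt φ μ δ₀ ν m t c ^ 2|) ≤
      (1 + 2 * m * 2 ^ (m - 1)) * ghostBound μ *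
        (|b.2| * (wt φ μ δ₀ ν m t (b + c) * wt φ μ δ₀ ν m t b * wt φ μ δ₀ ν m t c *
          commKernel m t b c * (dis μ ν t (b + c) * dis μ ν t c))) := by
  have hν0 : 0 < ν := by rw [hν]; positivity
  have hB := two_le_ghostBound μ
  have hda := dis_nonneg μ ν t (b + c)
  have hdc := dis_nonneg μ ν t c
  have hwa0 := wt_nonneg φ μ δ₀ ν m t (b + c)
  have hwb0 := wt_nonneg φ μ δ₀ ν m t b
  have hwc0 := wt_nonneg φ μ δ₀ ν m t c
  have hlb := lamDecay_pos m t b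
  have hlc := lamDecay_pos m t c
  have hla := lamDecay_pos m t (b + c)
  have hK0 : 0 ≤ commKernel m t b c := by unfold commKernel; positivity
  have hab : (b + c).1 = c.1 := by rw [Prod.fst_add, hb, zero_add]
  by_cases hc : c.1 = 0
  · rw [hc]; simp only [Int.cast_zero, abs_zero, zero_mul, mul_zero]; positivity
  have ha : (b + c).1 ≠ 0 := by rwa [hab]
  have hca : absDxThird (b + c) = absDxThird c := by unfold absDxThird; rw [hab]
  have e1 := enhanced_le_dis (μ := μ) hh hν t c
  have e2 := enhanced_le_dis (μ := μ) hh hν t (b + c)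
  rw [hca] at e2
  have hκ1 := one_le_absDxThird hc
  set κ := absDxThird c with hκ
  set d := dis μ ν t (b + c) * dis μ ν t c with hd
  have hκd : h ^ 2 * κ ^ 2 ≤ d := by
    calc h ^ 2 * κ ^ 2 = (h * κ) * (h * κ) := by ring
      _ ≤ _ := mul_le_mul e2 e1 (by positivity) hda
  have hhd : h ^ 2 ≤ d := by
    refine le_trans ?_ hκd
    have : 1 ≤ κ ^ 2 := one_le_pow₀ hκ1
    nlinarith [sq_nonneg h]
  have hLb : 1 ≤ Lam t b := one_le_Lam t b
  have hE : expHalf δ₀ ν t (b + c) = expHalf δ₀ ν t c := by unfold expHalf growth; rw [hab]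
  have hwa := expHalf_mul_Lam_le_wt hφ hμ δ₀ ν m t (b + c)
  have hwb := expHalf_mul_Lam_le_wt hφ hμ δ₀ ν m t b
  have hwc := expHalf_mul_Lam_le_wt hφ hμ δ₀ ν m t c
  have hEb := one_le_expHalf hδ hν0 ht b
  have hEc := one_le_expHalf hδ hν0 ht c
  have hsq : ∀ p, wt φ μ δ₀ ν m t p ^ 2 =
      expHalf δ₀ ν t p ^ 2 * (ghost φ μ ν t p * (Lam t p ^ m) ^ 2) := fun p => by
    rw [wt_sq hφ hμ, M_eq, expHalf_sq]; ring
  have hdL := abs_Lam_sub_le (t := t) (b := b) (c := c) hb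
  have hLac := Lam_le_add t b c
  have hLca : Lam t c ≤ Lam t (b + c) + Lam t b := by
    have h1 : |b.2| ≤ Lam t b := by
      have := abs_snd_le_Lam t b; rwa [hb, Int.cast_zero, mul_zero, add_zero] at this
    have := (abs_le.1 hdL).1
    linarith
  have hgg : |(c.1 : ℝ)| * |ghost φ μ ν t (b + c) - ghost φ μ ν t c| ≤
      (h ^ 2 * κ ^ 2 + (1 + echoSum μ)) * |b.2| := by
    have := abs_fst_mul_ghost_sub_le hφ hμ hν0 t hc (b + c).2 c.2
    rw [rpow_third_eq hh hν, Prod.snd_add, add_sub_cancel_right] at this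
    have e : b + c = (c.1, b.2 + c.2) := Prod.ext hab rfl
    rw [e]; exact this
  have hS : h ^ 2 * (h ^ 2 * κ ^ 2 + (1 + echoSum μ)) ≤ d * ghostBound μ := by
    have hs := echoSum_nonneg μ
    have hd0 : 0 ≤ d := by positivity
    have hB' : 2 + echoSum μ ≤ ghostBound μ := by
      unfold ghostBound; nlinarith [Real.pi_gt_three]
    have hh2 : h ^ 2 ≤ 1 := pow_le_one₀ hh.le hh1
    calc h ^ 2 * (h ^ 2 * κ ^ 2 + (1 + echoSum μ))
        = h ^ 2 * (h ^ 2 * κ ^ 2) + h ^ 2 * (1 + echoSum μ) := by ring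
      _ ≤ 1 * d + d * (1 + echoSum μ) := by gcongr
      _ = d * (2 + echoSum μ) := by ring
      _ ≤ _ := by gcongr
  have hga := one_le_ghost hφ hμ ν t (b + c)
  have hgc := one_le_ghost hφ hμ ν t c
  have hga' := ghost_le hφ hμ ν t (b + c)
  have hgc' := ghost_le hφ hμ ν t c
  have hκa : |(c.1 : ℝ)| ≤ Lam t (b + c) := by
    have := abs_fst_le_Lam t (b + c); rwa [hab] at this
  -- both orderings of the frequencies reduce to the same bound without the exponential factor
  have hmain : h ^ 2 * (|(c.1 : ℝ)| * |ghost φ μ ν t (b + c) * (Lam t (b + c) ^ m) ^ 2 -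
      ghost φ μ ν t c * (Lam t c ^ m) ^ 2|) ≤ (1 + 2 * m * 2 ^ (m - 1)) * ghostBound μ *
      (d * |b.2| * (Lam t (b + c) ^ m * Lam t c ^ m * Lam t b ^ m * commKernel m t b c)) := by
    have hx0 := Lam_pos t (b + c)
    have hz0 := Lam_pos t c
    rcases le_total (Lam t c) (Lam t (b + c)) with hle | hle
    · refine (weight_sq_sub_le (one_le_Lam t c) hLb hle (by linarith) hm (abs_nonneg _)
        ((le_abs_self _).trans hdL) (abs_nonneg _) (abs_fst_le_Lam t c) (by linarith) hga' hgg
        (by linarith) hhd hS).trans ?_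
      gcongr
      unfold commKernel lamDecay at *; linarith
    · rw [abs_sub_comm]
      rw [abs_sub_comm] at hgg
      refine (weight_sq_sub_le (one_le_Lam t (b + c)) hLb hle (by linarith) hm (abs_nonneg _)
        ((le_abs_self _).trans (by rwa [abs_sub_comm] at hdL)) (abs_nonneg _) hκa (by linarith) hgc' hgg
        (by linarith) hhd hS).trans ?_
      rw [mul_comm (Lam t c ^ m) (Lam t (b + c) ^ m)]
      gcongr
      unfold commKernel lamDecay at *; linarith
  rw [hsq, hsq, hE, ← mul_sub, abs_mul, abs_of_nonneg (sq_nonneg (expHalf δ₀ ν t c))]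
  rw [hE] at hwa
  have hwb' : 1 * Lam t b ^ m ≤ wt φ μ δ₀ ν m t b := le_trans (by gcongr) hwb
  have hd0 : 0 ≤ d := by positivity
  set E := expHalf δ₀ ν t c
  calc _ = E ^ 2 * (h ^ 2 * (|(c.1 : ℝ)| * |ghost φ μ ν t (b + c) * (Lam t (b + c) ^ m) ^ 2 -
      ghost φ μ ν t c * (Lam t c ^ m) ^ 2|)) := by ring
    _ ≤ E ^ 2 * ((1 + 2 * m * 2 ^ (m - 1)) * ghostBound μ *
      (d * |b.2| * (Lam t (b + c) ^ m * Lam t c ^ m * Lam t b ^ m * commKernel m t b c))) := by gcongr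
    _ = (1 + 2 * m * 2 ^ (m - 1)) * ghostBound μ * (|b.2| * ((E * Lam t (b + c) ^ m) *
        (1 * Lam t b ^ m) * (E * Lam t c ^ m) * commKernel m t b c * d)) := by ring
    _ ≤ _ := by
      have hx0 := Lam_pos t (b + c)
      have hz0 := Lam_pos t c
      have hb0 := Lam_pos t b
      gcongr

end

/-! ### Trilinear estimates -/

/-- The `L²` norm of a nonnegative function of the frequency. -/
noncomputable def l2E (A : ℤ × ℝ → ℝ≥0∞) : ℝ≥0∞ := (∫⁻ p, A p ^ 2 ∂freqMeasure) ^ (1 / 2 : ℝ)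

theorem l2E_sq (A : ℤ × ℝ → ℝ≥0∞) : l2E A ^ 2 = ∫⁻ p, A p ^ 2 ∂freqMeasure := by
  unfold l2E
  rw [← ENNReal.rpow_natCast, ← ENNReal.rpow_mul]; norm_num

theorem ennreal_le_of_sq_le_sq {x y : ℝ≥0∞} (h : x ^ 2 ≤ y ^ 2) : x ≤ y := by
  by_contra hn
  exact absurd h (not_le.2 (ENNReal.pow_lt_pow_left two_ne_zero (not_le.1 hn)))

/-- The trilinear form with kernel `k (b, a - b)` is bounded on `L² × L² × L²` by `S`. -/
def IsTrilinear (k : ℤ × ℝ → ℤ × ℝ → ℝ) (S : ℝ≥0∞) : Prop :=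
  ∀ A B C : ℤ × ℝ → ℝ≥0∞, AEMeasurable A freqMeasure → AEMeasurable B freqMeasure →
    AEMeasurable C freqMeasure →
    ∫⁻ q : (ℤ × ℝ) × (ℤ × ℝ), A q.1 * B q.2 * C (q.1 - q.2) * ENNReal.ofReal (k q.2 (q.1 - q.2))
      ∂(freqMeasure.prod freqMeasure) ≤ S * (l2E A * l2E B * l2E C)

theorem aemeasurable_comp_fst {A : ℤ × ℝ → ℝ≥0∞} (hA : AEMeasurable A freqMeasure) :
    AEMeasurable (fun q : (ℤ × ℝ) × (ℤ × ℝ) => A q.1) (freqMeasure.prod freqMeasure) :=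
  hA.comp_quasiMeasurePreserving Measure.quasiMeasurePreserving_fst

theorem aemeasurable_comp_snd {A : ℤ × ℝ → ℝ≥0∞} (hA : AEMeasurable A freqMeasure) :
    AEMeasurable (fun q : (ℤ × ℝ) × (ℤ × ℝ) => A q.2) (freqMeasure.prod freqMeasure) :=
  hA.comp_quasiMeasurePreserving Measure.quasiMeasurePreserving_snd

theorem aemeasurable_comp_sub {A : ℤ × ℝ → ℝ≥0∞} (hA : AEMeasurable A freqMeasure) :
    AEMeasurable (fun q : (ℤ × ℝ) × (ℤ × ℝ) => A (q.1 - q.2)) (freqMeasure.prod freqMeasure) := by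
  simpa using aemeasurable_conv_integrand (F := fun _ => 1) aemeasurable_const hA

theorem lintegral_prod_sq_mul_sub {B C : ℤ × ℝ → ℝ≥0∞} (hB : AEMeasurable B freqMeasure)
    (hC : AEMeasurable C freqMeasure) :
    ∫⁻ q : (ℤ × ℝ) × (ℤ × ℝ), (B q.2 * C (q.1 - q.2)) ^ 2 ∂(freqMeasure.prod freqMeasure) =
      (l2E B * l2E C) ^ 2 := by
  rw [lintegral_prod_symm _ ((aemeasurable_conv_integrand hB hC).pow_const 2), mul_pow, l2E_sq, l2E_sq,
    ← lintegral_mul_const'' _ (hB.pow_const 2)]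
  refine lintegral_congr fun b => ?_
  simp only [mul_pow]
  rw [lintegral_const_mul'']
  · rw [lintegral_sub_right_eq_self (fun a => C a ^ 2) b]
  · exact ((hC.comp_quasiMeasurePreserving
      (measurePreserving_sub_right freqMeasure b).quasiMeasurePreserving)).pow_const 2

/-- A kernel that is square integrable over `b + c = a`, uniformly in `a`, is bounded by one
application of the Cauchy-Schwarz inequality on pairs of frequencies. -/
theorem IsTrilinear.of_sections {k : ℤ × ℝ → ℤ × ℝ → ℝ} {S : ℝ≥0∞}
    (hk : Measurable fun q : (ℤ × ℝ) × (ℤ × ℝ) => k q.2 (q.1 - q.2))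
    (hS : ∀ a, ∫⁻ b, ENNReal.ofReal (k b (a - b)) ^ 2 ∂freqMeasure ≤ S ^ 2) : IsTrilinear k S := by
  intro A B C hA hB hC
  have hkE : Measurable fun q : (ℤ × ℝ) × (ℤ × ℝ) => ENNReal.ofReal (k q.2 (q.1 - q.2)) := hk.ennreal_ofReal
  apply ennreal_le_of_sq_le_sq
  calc _ = (∫⁻ q : (ℤ × ℝ) × (ℤ × ℝ), (A q.1 * ENNReal.ofReal (k q.2 (q.1 - q.2))) *
        (B q.2 * C (q.1 - q.2)) ∂(freqMeasure.prod freqMeasure)) ^ 2 := by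
        congr 2; funext q; ring
    _ ≤ _ := sq_lintegral_mul_le ((aemeasurable_comp_fst hA).mul hkE.aemeasurable)
        (aemeasurable_conv_integrand hB hC)
    _ ≤ (l2E A ^ 2 * S ^ 2) * (l2E B * l2E C) ^ 2 := by
        rw [lintegral_prod_sq_mul_sub hB hC]
        gcongr
        have hm : AEMeasurable (fun q : (ℤ × ℝ) × (ℤ × ℝ) =>
            (A q.1 * ENNReal.ofReal (k q.2 (q.1 - q.2))) ^ 2) (freqMeasure.prod freqMeasure) :=
          ((aemeasurable_comp_fst hA).mul hkE.aemeasurable).pow_const 2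
        rw [lintegral_prod _ hm, l2E_sq,
          ← lintegral_mul_const'' _ (hA.pow_const 2)]
        refine lintegral_mono fun a => ?_
        simp only [mul_pow]
        rw [lintegral_const_mul]
        · gcongr; exact hS a
        · exact (hkE.comp (measurable_prodMk_left (x := a))).pow_const 2
    _ = _ := by ring

/-- A square integrable function of the outgoing frequency is a bounded kernel. -/
theorem IsTrilinear.of_output {g : ℤ × ℝ → ℝ} {S : ℝ≥0∞} (hg : Measurable g)
    (hS : ∫⁻ a, ENNReal.ofReal (g a) ^ 2 ∂freqMeasure ≤ S ^ 2) :
    IsTrilinear (fun b c => g (b + c)) S := by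
  intro A B C hA hB hC
  have hgE : Measurable fun a => ENNReal.ofReal (g a) := hg.ennreal_ofReal
  apply ennreal_le_of_sq_le_sq
  calc _ = (∫⁻ q : (ℤ × ℝ) × (ℤ × ℝ), (A q.1 * B q.2) *
        (ENNReal.ofReal (g q.1) * C (q.1 - q.2)) ∂(freqMeasure.prod freqMeasure)) ^ 2 := by
        congr 2; funext q
        dsimp only; rw [add_sub_cancel]; ring
    _ ≤ _ := sq_lintegral_mul_le ((aemeasurable_comp_fst hA).mul (aemeasurable_comp_snd hB))
        (((aemeasurable_comp_fst hgE.aemeasurable)).mul (aemeasurable_comp_sub hC))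
    _ ≤ (l2E A ^ 2 * l2E B ^ 2) * (S ^ 2 * l2E C ^ 2) := by
        gcongr
        · simp only [mul_pow]
          rw [lintegral_prod_mul (hA.pow_const 2) (hB.pow_const 2), l2E_sq, l2E_sq]
        · have hm : AEMeasurable (fun q : (ℤ × ℝ) × (ℤ × ℝ) =>
              (ENNReal.ofReal (g q.1) * C (q.1 - q.2)) ^ 2) (freqMeasure.prod freqMeasure) :=
            ((aemeasurable_comp_fst hgE.aemeasurable).mul (aemeasurable_comp_sub hC)).pow_const 2
          rw [lintegral_prod _ hm]
          calc _ = ∫⁻ a, ENNReal.ofReal (g a) ^ 2 * l2E C ^ 2 ∂freqMeasure := by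
                refine lintegral_congr fun a => ?_
                simp only [mul_pow]
                rw [lintegral_const_mul'', l2E_sq, lintegral_sub_left_eq_self (fun b => C b ^ 2) a]
                exact (hC.comp_quasiMeasurePreserving
                  (Measure.measurePreserving_sub_left freqMeasure a).quasiMeasurePreserving).pow_const 2
            _ ≤ _ := by
                rw [lintegral_mul_const _ (hgE.pow_const 2)]
                gcongr
    _ = _ := by ring

theorem IsTrilinear.add {k k' : ℤ × ℝ → ℤ × ℝ → ℝ} {S S' : ℝ≥0∞} (h : IsTrilinear k S)
    (h' : IsTrilinear k' S')
    (hk : Measurable fun q : (ℤ × ℝ) × (ℤ × ℝ) => k q.2 (q.1 - q.2)) :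
    IsTrilinear (fun b c => k b c + k' b c) (S + S') := by
  intro A B C hA hB hC
  rw [add_mul]
  refine le_trans ?_ (add_le_add (h A B C hA hB hC) (h' A B C hA hB hC))
  rw [← lintegral_add_left']
  · refine lintegral_mono fun q => ?_
    rw [← mul_add]
    gcongr
    exact ENNReal.ofReal_add_le
  · exact (((aemeasurable_comp_fst hA).mul (aemeasurable_comp_snd hB)).mul
      (aemeasurable_comp_sub hC)).mul hk.ennreal_ofReal.aemeasurable

theorem aemeasurable_ofReal {A : ℤ × ℝ → ℝ} (hA : AEStronglyMeasurable A freqMeasure) :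
    AEMeasurable (fun p => ENNReal.ofReal (A p)) freqMeasure := hA.aemeasurable.ennreal_ofReal

theorem l2E_ofReal {A : ℤ × ℝ → ℝ} (hA0 : ∀ p, 0 ≤ A p)
    (hA2 : Integrable (fun p => A p ^ 2) freqMeasure) :
    l2E (fun p => ENNReal.ofReal (A p)) = ENNReal.ofReal (Real.sqrt (∫ p, A p ^ 2 ∂freqMeasure)) := by
  unfold l2E
  have : ∫⁻ p, ENNReal.ofReal (A p) ^ 2 ∂freqMeasure = ENNReal.ofReal (∫ p, A p ^ 2 ∂freqMeasure) := by
    rw [ofReal_integral_eq_lintegral_ofReal hA2 (Filter.Eventually.of_forall fun p => sq_nonneg _)]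
    exact lintegral_congr fun p => (ENNReal.ofReal_pow (hA0 p) 2).symm
  rw [this, Real.sqrt_eq_rpow, ENNReal.ofReal_rpow_of_nonneg (integral_nonneg fun p => sq_nonneg _)
    (by norm_num)]

/-- A function on pairs of frequencies that is dominated by a trilinear expression is integrable, with
the corresponding bound. -/
theorem IsTrilinear.integral_le {k : ℤ × ℝ → ℤ × ℝ → ℝ} {S : ℝ≥0∞} (h : IsTrilinear k S) (hS : S ≠ ∞)
    {A B C : ℤ × ℝ → ℝ} (hA : AEStronglyMeasurable A freqMeasure)
    (hB : AEStronglyMeasurable B freqMeasure) (hC : AEStronglyMeasurable C freqMeasure)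
    (hA0 : ∀ p, 0 ≤ A p) (hB0 : ∀ p, 0 ≤ B p) (hC0 : ∀ p, 0 ≤ C p)
    (hA2 : Integrable (fun p => A p ^ 2) freqMeasure)
    (hB2 : Integrable (fun p => B p ^ 2) freqMeasure)
    (hC2 : Integrable (fun p => C p ^ 2) freqMeasure)
    {E : Type*} [NormedAddCommGroup E] [NormedSpace ℝ E]
    {f : (ℤ × ℝ) × (ℤ × ℝ) → E} (hf : AEStronglyMeasurable f (freqMeasure.prod freqMeasure))
    (hle : ∀ᵐ q ∂(freqMeasure.prod freqMeasure),
      ‖f q‖ ≤ A q.1 * B q.2 * C (q.1 - q.2) * k q.2 (q.1 - q.2)) :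
    Integrable f (freqMeasure.prod freqMeasure) ∧
      ‖∫ q, f q ∂(freqMeasure.prod freqMeasure)‖ ≤ S.toReal * (Real.sqrt (∫ p, A p ^ 2 ∂freqMeasure) *
        Real.sqrt (∫ p, B p ^ 2 ∂freqMeasure) * Real.sqrt (∫ p, C p ^ 2 ∂freqMeasure)) := by
  have hb : ∫⁻ q, ‖f q‖ₑ ∂(freqMeasure.prod freqMeasure) ≤
      ENNReal.ofReal (S.toReal * (Real.sqrt (∫ p, A p ^ 2 ∂freqMeasure) *
        Real.sqrt (∫ p, B p ^ 2 ∂freqMeasure) * Real.sqrt (∫ p, C p ^ 2 ∂freqMeasure))) := by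
    calc ∫⁻ q, ‖f q‖ₑ ∂(freqMeasure.prod freqMeasure)
        ≤ ∫⁻ q : (ℤ × ℝ) × (ℤ × ℝ), ENNReal.ofReal (A q.1) * ENNReal.ofReal (B q.2) *
            ENNReal.ofReal (C (q.1 - q.2)) * ENNReal.ofReal (k q.2 (q.1 - q.2))
            ∂(freqMeasure.prod freqMeasure) := by
          refine lintegral_mono_ae (hle.mono fun q hq => ?_)
          rw [← ENNReal.ofReal_mul (hA0 _), ← ENNReal.ofReal_mul (mul_nonneg (hA0 _) (hB0 _)),
            ← ENNReal.ofReal_mul (mul_nonneg (mul_nonneg (hA0 _) (hB0 _)) (hC0 _)), ← ofReal_norm]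
          exact ENNReal.ofReal_le_ofReal hq
      _ ≤ _ := h (fun p => ENNReal.ofReal (A p)) (fun p => ENNReal.ofReal (B p))
          (fun p => ENNReal.ofReal (C p)) (aemeasurable_ofReal hA)
          (aemeasurable_ofReal hB) (aemeasurable_ofReal hC)
      _ = _ := by
          rw [l2E_ofReal hA0 hA2, l2E_ofReal hB0 hB2, l2E_ofReal hC0 hC2,
            ENNReal.ofReal_mul ENNReal.toReal_nonneg, ENNReal.ofReal_toReal hS,
            ENNReal.ofReal_mul (by positivity), ENNReal.ofReal_mul (by positivity)]
  refine ⟨⟨hf, hb.trans_lt ENNReal.ofReal_lt_top⟩, ?_⟩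
  have h1 := (enorm_integral_le_lintegral_enorm f).trans hb
  rw [← ofReal_norm] at h1
  exact (ENNReal.ofReal_le_ofReal_iff (by positivity)).1 h1

/-! ### The kernels are square integrable -/

section
variable {μ m t : ℝ}

/-- `‖Λ_t^{1-m}‖²_{L²}`, which does not depend on `t`. -/
noncomputable def decayE (m : ℝ) : ℝ≥0∞ := ∫⁻ p, ENNReal.ofReal (bracket p ^ (-(m - 1))) ∂freqMeasure

theorem decayE_ne_top (hm : 2 < m) : decayE m ≠ ∞ :=
  (lintegral_bracket_rpow_lt_top (by linarith)).ne

theorem measurable_lamDecay (m t : ℝ) : Measurable (lamDecay m t) :=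
  (measurable_Lam t).pow_const _

theorem lintegral_lamDecay_sq (m t : ℝ) :
    ∫⁻ p, ENNReal.ofReal (lamDecay m t p) ^ 2 ∂freqMeasure = decayE m := by
  have hmp := (measurePreserving_shear t).symm
  unfold decayE
  rw [← hmp.lintegral_comp_emb (shear t).symm.measurableEmbedding
    (fun p => ENNReal.ofReal (bracket p ^ (-(m - 1))))]
  refine lintegral_congr fun p => ?_
  rw [← ENNReal.ofReal_pow (lamDecay_pos m t p).le]
  congr 1
  unfold lamDecay
  rw [Lam_eq, Real.sqrt_eq_rpow, ← Real.rpow_mul (bracket_pos _).le, ← Real.rpow_natCast,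
    ← Real.rpow_mul (bracket_pos _).le]
  congr 1; push_cast; ring

theorem rpow_half_sq (x : ℝ≥0∞) : (x ^ (1 / 2 : ℝ)) ^ 2 = x := by
  rw [← ENNReal.rpow_natCast, ← ENNReal.rpow_mul]; norm_num

theorem isTrilinear_lamDecay_fst (m t : ℝ) :
    IsTrilinear (fun b _ => lamDecay m t b) (decayE m ^ (1 / 2 : ℝ)) :=
  .of_sections ((measurable_lamDecay m t).comp measurable_snd) fun a => by
    rw [rpow_half_sq, lintegral_lamDecay_sq]

theorem isTrilinear_lamDecay_snd (m t : ℝ) :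
    IsTrilinear (fun _ c => lamDecay m t c) (decayE m ^ (1 / 2 : ℝ)) :=
  .of_sections ((measurable_lamDecay m t).comp (measurable_fst.sub measurable_snd)) fun a => by
    rw [rpow_half_sq, lintegral_sub_left_eq_self (fun b => ENNReal.ofReal (lamDecay m t b) ^ 2) a,
      lintegral_lamDecay_sq]

theorem isTrilinear_lamDecay_add (m t : ℝ) :
    IsTrilinear (fun b c => lamDecay m t (b + c)) (decayE m ^ (1 / 2 : ℝ)) :=
  .of_output (measurable_lamDecay m t) (by rw [rpow_half_sq, lintegral_lamDecay_sq])

/-- The bound of the square integral of the part of `advKernel` that comes from echoes: the sum of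
`|l|^{-(1+μ)}` times an integral in the second variable, which is finite for `m > 2`. -/
noncomputable def echoE (μ m : ℝ) : ℝ≥0∞ :=
  (∑' l : ℤ, ENNReal.ofReal (|(l : ℝ)| ^ (-(1 + μ)))) *
    ∫⁻ x : ℝ, ENNReal.ofReal ((1 + ‖x‖ ^ 2) ^ (-(2 * m - 3) / 2))

theorem echoE_ne_top (hμ : 0 < μ) (hm : 2 < m) : echoE μ m ≠ ∞ := by
  refine ENNReal.mul_ne_top ?_ ?_
  · exact Summable.tsum_ofReal_ne_top (Real.summable_abs_int_rpow (by linarith))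
  · exact ((integrable_rpow_neg_one_add_norm_sq (E := ℝ) (μ := volume) (r := 2 * m - 3)
      (by simp; linarith)).lintegral_lt_top).ne

theorem measurable_lowWeight (μ : ℝ) : Measurable (lowWeight μ) := by
  unfold lowWeight; exact (measurable_fst_cast.abs).pow_const _

theorem abs_fst_mul_lamDecay_sq_le (hm : 2 < m) (t : ℝ) (c : ℤ × ℝ) :
    |(c.1 : ℝ)| * lamDecay m t c ^ 2 ≤ (1 + ‖c.2 + t * c.1‖ ^ 2) ^ (-(2 * m - 3) / 2) := by
  have hL := Lam_pos t c
  have h2 := Lam_sq t c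
  calc |(c.1 : ℝ)| * lamDecay m t c ^ 2 ≤ Lam t c * lamDecay m t c ^ 2 := by
        gcongr; exact abs_fst_le_Lam t c
    _ = (Lam t c ^ 2) ^ (-(2 * m - 3) / 2) := by
        unfold lamDecay
        nth_rewrite 1 [← Real.rpow_one (Lam t c)]
        rw [← Real.rpow_natCast, ← Real.rpow_natCast, ← Real.rpow_mul hL.le, ← Real.rpow_mul hL.le,
          ← Real.rpow_add hL]
        congr 1; push_cast; ring
    _ ≤ _ := by
        apply Real.rpow_le_rpow_of_nonpos (by positivity)
        · rw [h2, Real.norm_eq_abs, sq_abs]; nlinarith [sq_nonneg (c.1 : ℝ)]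
        · linarith

/-- The kernel of the echoes is only square summable in `l` and square integrable in the second
variable, separately. -/
theorem isTrilinear_echo (hm : 2 < m) (μ t : ℝ) :
    IsTrilinear (fun b c => lowWeight μ b * (Real.sqrt |(c.1 : ℝ)| * lamDecay m t c))
      (echoE μ m ^ (1 / 2 : ℝ)) := by
  have hmeas : Measurable fun q : (ℤ × ℝ) × (ℤ × ℝ) => lowWeight μ q.2 *
      (Real.sqrt |((q.1 - q.2).1 : ℝ)| * lamDecay m t (q.1 - q.2)) :=
    ((measurable_lowWeight μ).comp measurable_snd).mul
      (((measurable_fst_cast.abs.sqrt).comp (measurable_fst.sub measurable_snd)).mul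
        ((measurable_lamDecay m t).comp (measurable_fst.sub measurable_snd)))
  refine .of_sections hmeas fun a => ?_
  have hma : Measurable fun b : ℤ × ℝ => ENNReal.ofReal (lowWeight μ b *
      (Real.sqrt |((a - b).1 : ℝ)| * lamDecay m t (a - b))) ^ 2 :=
    (hmeas.comp (measurable_prodMk_left (x := a))).ennreal_ofReal.pow_const 2
  rw [rpow_half_sq, lintegral_freq hma.aemeasurable]
  unfold echoE
  rw [← ENNReal.tsum_mul_right]
  refine ENNReal.tsum_le_tsum fun l => ?_
  set g : ℝ → ℝ≥0∞ := fun x => ENNReal.ofReal ((1 + ‖x‖ ^ 2) ^ (-(2 * m - 3) / 2)) with hg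
  rw [← lintegral_sub_left_eq_self g (a.2 + t * ((a.1 : ℝ) - l)), ← lintegral_const_mul']
  swap; · exact ENNReal.ofReal_ne_top
  refine lintegral_mono fun η => ?_
  have hD := lamDecay_pos m t (a - (l, η))
  have hlw : 0 ≤ lowWeight μ (l, η) := by unfold lowWeight; positivity
  rw [← ENNReal.ofReal_pow (by positivity), hg]
  dsimp only
  rw [← ENNReal.ofReal_mul (by positivity)]
  apply ENNReal.ofReal_le_ofReal
  rw [mul_pow, mul_pow, Real.sq_sqrt (abs_nonneg _)]
  have h1 := abs_fst_mul_lamDecay_sq_le hm t (a - (l, η))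
  have h2 : (a - (l, η)).2 + t * ((a - (l, η)).1 : ℝ) = a.2 + t * ((a.1 : ℝ) - l) - η := by
    simp only [Prod.snd_sub, Prod.fst_sub, Int.cast_sub]; ring
  have h3 : lowWeight μ (l, η) ^ 2 = |(l : ℝ)| ^ (-(1 + μ)) := by
    unfold lowWeight
    rw [← Real.rpow_natCast, ← Real.rpow_mul (abs_nonneg _)]; congr 1; push_cast; ring
  rw [h2] at h1
  rw [h3]
  gcongr

/-- The bound of the trilinear form of `advKernel`. -/
noncomputable def advBound (μ m : ℝ) : ℝ≥0∞ :=
  decayE m ^ (1 / 2 : ℝ) + decayE m ^ (1 / 2 : ℝ) + echoE μ m ^ (1 / 2 : ℝ)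

/-- The bound of the trilinear form of `commKernel`. -/
noncomputable def commBound (m : ℝ) : ℝ≥0∞ :=
  decayE m ^ (1 / 2 : ℝ) + decayE m ^ (1 / 2 : ℝ) + decayE m ^ (1 / 2 : ℝ)

theorem advBound_ne_top (hμ : 0 < μ) (hm : 2 < m) : advBound μ m ≠ ∞ := by
  have h1 := ENNReal.rpow_ne_top_of_nonneg (show (0 : ℝ) ≤ 1 / 2 by norm_num) (decayE_ne_top hm)
  have h2 := ENNReal.rpow_ne_top_of_nonneg (show (0 : ℝ) ≤ 1 / 2 by norm_num) (echoE_ne_top hμ hm)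
  exact ENNReal.add_ne_top.2 ⟨ENNReal.add_ne_top.2 ⟨h1, h1⟩, h2⟩

theorem commBound_ne_top (hm : 2 < m) : commBound m ≠ ∞ := by
  have h1 := ENNReal.rpow_ne_top_of_nonneg (show (0 : ℝ) ≤ 1 / 2 by norm_num) (decayE_ne_top hm)
  exact ENNReal.add_ne_top.2 ⟨ENNReal.add_ne_top.2 ⟨h1, h1⟩, h1⟩

theorem isTrilinear_advKernel (hm : 2 < m) (μ t : ℝ) :
    IsTrilinear (advKernel μ m t) (advBound μ m) := by
  have h1 : Measurable fun q : (ℤ × ℝ) × (ℤ × ℝ) => lamDecay m t q.2 :=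
    (measurable_lamDecay m t).comp measurable_snd
  have h2 : Measurable fun q : (ℤ × ℝ) × (ℤ × ℝ) => lamDecay m t (q.1 - q.2) :=
    (measurable_lamDecay m t).comp (measurable_fst.sub measurable_snd)
  exact ((isTrilinear_lamDecay_fst m t).add (isTrilinear_lamDecay_snd m t) h1).add
    (isTrilinear_echo hm μ t) (h1.add h2)

theorem isTrilinear_commKernel (m t : ℝ) : IsTrilinear (commKernel m t) (commBound m) := by
  have h1 : Measurable fun q : (ℤ × ℝ) × (ℤ × ℝ) => lamDecay m t q.2 :=
    (measurable_lamDecay m t).comp measurable_snd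
  have h0 : Measurable fun q : (ℤ × ℝ) × (ℤ × ℝ) => lamDecay m t (q.2 + (q.1 - q.2)) :=
    (measurable_lamDecay m t).comp (measurable_snd.add (measurable_fst.sub measurable_snd))
  exact ((isTrilinear_lamDecay_add m t).add (isTrilinear_lamDecay_fst m t) h0).add
    (isTrilinear_lamDecay_snd m t) (h0.add h1)

end

/-! ### Weights of polynomial growth -/

/-- A measurable weight of at most polynomial growth. -/
structure PolyBdd (β : ℤ × ℝ → ℝ) : Prop where
  measurable : Measurable β
  bound : ∃ (C : ℝ) (j : ℕ), ∀ p, |β p| ≤ C * bracket p ^ j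

section
variable {β γ : ℤ × ℝ → ℝ} {F G U V : ℤ × ℝ → ℂ}

theorem PolyBdd.mul (hβ : PolyBdd β) (hγ : PolyBdd γ) : PolyBdd fun p => β p * γ p := by
  obtain ⟨hβm, C, i, hC⟩ := hβ
  obtain ⟨hγm, D, j, hD⟩ := hγ
  refine ⟨hβm.mul hγm, C * D, i + j, fun p => ?_⟩
  rw [abs_mul, pow_add]
  calc |β p| * |γ p| ≤ (C * bracket p ^ i) * (D * bracket p ^ j) :=
        mul_le_mul (hC p) (hD p) (abs_nonneg _) ((abs_nonneg _).trans (hC p))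
    _ = _ := by ring

theorem PolyBdd.pow (hβ : PolyBdd β) (n : ℕ) : PolyBdd fun p => β p ^ n := by
  obtain ⟨hβm, C, i, hC⟩ := hβ
  refine ⟨hβm.pow_const n, C ^ n, i * n, fun p => ?_⟩
  rw [abs_pow, pow_mul, ← mul_pow]
  exact pow_le_pow_left₀ (abs_nonneg _) (hC p) n

theorem PolyBdd.rapid (hβ : PolyBdd β) (hF : Rapid F) : Rapid fun p => (β p : ℂ) * F p := by
  obtain ⟨C, j, hC⟩ := hβ.bound
  refine RapidOn.mul_poly (I := (univ : Set Unit)) (F := fun _ => F) (m := fun _ p => (β p : ℂ)) hF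
    (fun _ _ => (Complex.measurable_ofReal.comp hβ.measurable).aestronglyMeasurable)
    ⟨C, j, fun _ _ p => ?_⟩
  rw [Complex.norm_real, Real.norm_eq_abs]; exact hC p

theorem PolyBdd.integrable_sq (hβ : PolyBdd β) (hF : Rapid F) :
    Integrable (fun p => (β p * ‖F p‖) ^ 2) freqMeasure := by
  have := Rapid.integrable_sq (hβ.rapid hF) 0
  refine this.congr (Filter.Eventually.of_forall fun p => ?_)
  simp [mul_pow]

theorem PolyBdd.aesm (hβ : PolyBdd β) (hF : Rapid F) :
    AEStronglyMeasurable (fun p => β p * ‖F p‖) freqMeasure :=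
  hβ.measurable.aestronglyMeasurable.mul hF.aesm.norm

theorem Rapid.integrable_mul (hF : Rapid F) (hG : Rapid G) :
    Integrable (fun p => (starRingEnd ℂ) (F p) * G p) freqMeasure := by
  have hF2 := Rapid.integrable_sq hF 0
  have hG2 := Rapid.integrable_sq hG 0
  simp only [pow_zero, one_mul] at hF2 hG2
  refine (hF2.add hG2).mono ((Complex.continuous_conj.comp_aestronglyMeasurable hF.aesm).mul hG.aesm)
    (Filter.Eventually.of_forall fun p => ?_)
  simp only [Pi.add_apply, norm_mul, RCLike.norm_conj]
  rw [Real.norm_of_nonneg (by positivity)]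
  nlinarith [sq_nonneg (‖F p‖ - ‖G p‖), sq_nonneg (‖F p‖), sq_nonneg (‖G p‖)]

theorem PolyBdd.integrable_pair (hβ : PolyBdd β) (hF : Rapid F) (hG : Rapid G) :
    Integrable (fun p => β p * ((starRingEnd ℂ) (F p) * G p).re) freqMeasure := by
  refine (Rapid.integrable_mul hF (hβ.rapid hG)).re.congr (Filter.Eventually.of_forall fun p => ?_)
  simp only [RCLike.re_to_complex]
  rw [mul_left_comm, Complex.re_ofReal_mul]

/-- At `m = 3` and `t = 0` the trilinear bound has a kernel that only costs one power of `bracket`,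
which rapidly decaying functions afford. -/
theorem lamDecay_three_zero (p : ℤ × ℝ) : bracket p * lamDecay 3 0 p = 1 := by
  have h1 : lamDecay 3 0 p = (Lam 0 p ^ 2)⁻¹ := by
    unfold lamDecay
    rw [← Real.rpow_natCast, ← Real.rpow_neg (Lam_pos 0 p).le]; norm_num
  have h2 : Lam 0 p ^ 2 = bracket p := by rw [Lam_sq]; simp [bracket]
  rw [h1, h2, mul_inv_cancel₀ (bracket_pos p).ne']

/-- The trilinear form `∫∫ β(a) conj F(a) U(b) V(a-b)` converges absolutely. -/
theorem PolyBdd.integrable_conv (hβ : PolyBdd β) (hF : Rapid F) (hU : Rapid U) (hV : Rapid V) :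
    Integrable (fun q : (ℤ × ℝ) × (ℤ × ℝ) =>
      (β q.1 : ℂ) * (starRingEnd ℂ) (F q.1) * (U q.2 * V (q.1 - q.2)))
      (freqMeasure.prod freqMeasure) := by
  have hS := ENNReal.rpow_ne_top_of_nonneg (show (0 : ℝ) ≤ 1 / 2 by norm_num)
    (decayE_ne_top (m := 3) (by norm_num))
  have hb : PolyBdd bracket := ⟨measurable_bracket, 1, 1, fun p => by
    rw [abs_of_pos (bracket_pos p)]; simp⟩
  have h1 : PolyBdd fun _ => 1 := ⟨measurable_const, 1, 0, fun p => by simp⟩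
  have hm : AEStronglyMeasurable (fun q : (ℤ × ℝ) × (ℤ × ℝ) =>
      (β q.1 : ℂ) * (starRingEnd ℂ) (F q.1) * (U q.2 * V (q.1 - q.2)))
      (freqMeasure.prod freqMeasure) := by
    refine AEStronglyMeasurable.mul ?_ (aestronglyMeasurable_conv_integrand hU.aesm hV.aesm)
    exact ((Complex.measurable_ofReal.comp hβ.measurable).aestronglyMeasurable.mul
      (Complex.continuous_conj.comp_aestronglyMeasurable hF.aesm)).comp_fst
  refine (IsTrilinear.integral_le (isTrilinear_lamDecay_fst 3 0) hS
    (A := fun p => 1 * ‖(β p : ℂ) * F p‖) (B := fun p => bracket p * ‖U p‖) (C := fun p => 1 * ‖V p‖)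
    (h1.aesm (hβ.rapid hF)) (hb.aesm hU) (h1.aesm hV) (fun p => by positivity)
    (fun p => mul_nonneg (bracket_pos p).le (norm_nonneg _)) (fun p => by positivity)
    (h1.integrable_sq (hβ.rapid hF)) (hb.integrable_sq hU) (h1.integrable_sq hV) hm
    (Filter.Eventually.of_forall fun q => ?_)).1
  have := lamDecay_three_zero q.2
  simp only [norm_mul, RCLike.norm_conj, one_mul]
  apply le_of_eq
  linear_combination (-(‖(β q.1 : ℂ)‖ * ‖F q.1‖ * ‖U q.2‖ * ‖V (q.1 - q.2)‖)) * this

theorem PolyBdd.integral_conv (hβ : PolyBdd β) (hF : Rapid F) (hU : Rapid U) (hV : Rapid V) :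
    ∫ a, β a * ((starRingEnd ℂ) (F a) * conv U V a).re ∂freqMeasure =
      (2 * Real.pi)⁻¹ * (∫ q : (ℤ × ℝ) × (ℤ × ℝ),
        (β q.1 : ℂ) * (starRingEnd ℂ) (F q.1) * (U q.2 * V (q.1 - q.2))
          ∂(freqMeasure.prod freqMeasure)).re := by
  have hi := hβ.integrable_conv hF hU hV
  rw [integral_prod _ hi]
  have h1 : ∀ a, ∫ b, (β a : ℂ) * (starRingEnd ℂ) (F a) * (U b * V (a - b)) ∂freqMeasure =
      (2 * Real.pi : ℝ) * ((β a : ℂ) * ((starRingEnd ℂ) (F a) * conv U V a)) := by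
    intro a
    rw [integral_const_mul]
    unfold conv
    have : ((2 * Real.pi : ℝ) : ℂ) ≠ 0 := by
      rw [Complex.ofReal_ne_zero]; positivity
    field_simp
  have h2 := hi.integral_prod_left
  simp only [h1] at h2 ⊢
  rw [integral_const_mul, Complex.re_ofReal_mul, ← mul_assoc, inv_mul_cancel₀ (by positivity), one_mul]
  have h3 : Integrable (fun a => (β a : ℂ) * ((starRingEnd ℂ) (F a) * conv U V a)) freqMeasure := by
    have h4 := h2.const_mul (((2 * Real.pi : ℝ) : ℂ)⁻¹)
    refine h4.congr (Filter.Eventually.of_forall fun a => ?_)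
    have : ((2 * Real.pi : ℝ) : ℂ) ≠ 0 := by
      rw [Complex.ofReal_ne_zero]; positivity
    dsimp only
    rw [inv_mul_cancel_left₀ this]
  have h5 := integral_re h3
  simp only [RCLike.re_to_complex] at h5
  rw [← h5]
  refine integral_congr_ae (Filter.Eventually.of_forall fun a => ?_)
  simp only [Complex.re_ofReal_mul]

/-- The symmetry that exchanges the outgoing frequency `a` with `a - b` and reflects `b`; for real
functions it corresponds to integration by parts. -/
theorem measurePreserving_sub_neg :
    MeasurePreserving (fun q : (ℤ × ℝ) × (ℤ × ℝ) => (q.1 - q.2, -q.2))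
      (freqMeasure.prod freqMeasure) (freqMeasure.prod freqMeasure) := by
  have h1 := measurePreserving_prod_neg_add_swap freqMeasure freqMeasure
  have h2 := (Measure.measurePreserving_neg freqMeasure).prod (MeasurePreserving.id freqMeasure)
  have h3 := (Measure.measurePreserving_swap (μ := freqMeasure) (ν := freqMeasure)).comp (h2.comp h1)
  convert h3 using 1
  funext q
  simp [sub_eq_neg_add]

end

/-! ### The nonlinear terms -/

section
variable {φ : ℝ → ℝ} {μ δ₀ ν m t : ℝ} {F G U V V₁ V₂ : ℤ × ℝ → ℂ}

theorem Lam_le_bracket (t : ℝ) (p : ℤ × ℝ) : Lam t p ≤ (2 + 2 * t ^ 2) * bracket p := by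
  have h1 := one_le_Lam t p
  have h2 : Lam t p ^ 2 ≤ (2 + 2 * t ^ 2) * bracket p := by
    rw [Lam_sq]; unfold bracket
    nlinarith [sq_nonneg (p.2 - t * p.1), sq_nonneg (p.1 : ℝ), sq_nonneg p.2, sq_nonneg t,
      mul_nonneg (sq_nonneg t) (sq_nonneg p.2)]
  nlinarith

theorem polyBdd_wt (hφ : IsProfile φ) (hμ : μ < 1) (hδ : 0 ≤ δ₀) (hν : 0 < ν) (m : ℝ) (ht : 0 ≤ t) :
    PolyBdd (wt φ μ δ₀ ν m t) := by
  refine ⟨measurable_wt hφ hμ δ₀ ν m t, ghostBound μ * (Real.exp (δ₀ * ν ^ (1 / 3 : ℝ) * t / 2) *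
    (2 + 2 * t ^ 2) ^ ⌈m⌉₊), ⌈m⌉₊, fun p => ?_⟩
  rw [abs_of_nonneg (wt_nonneg _ _ _ _ _ _ _)]
  have hB := two_le_ghostBound μ
  have hL := Lam_pos t p
  calc wt φ μ δ₀ ν m t p ≤ ghostBound μ * (expHalf δ₀ ν t p * Lam t p ^ m) := wt_le hφ hμ δ₀ ν m t p
    _ ≤ ghostBound μ * (Real.exp (δ₀ * ν ^ (1 / 3 : ℝ) * t / 2) * (((2 + 2 * t ^ 2) * bracket p) ^ ⌈m⌉₊)) := by
        have h1 : expHalf δ₀ ν t p ≤ Real.exp (δ₀ * ν ^ (1 / 3 : ℝ) * t / 2) := by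
          unfold expHalf
          apply Real.exp_le_exp.2
          have := growth_le hδ hν p
          gcongr
        have h2 : Lam t p ^ m ≤ ((2 + 2 * t ^ 2) * bracket p) ^ ⌈m⌉₊ := by
          calc Lam t p ^ m ≤ Lam t p ^ (⌈m⌉₊ : ℝ) :=
                Real.rpow_le_rpow_of_exponent_le (one_le_Lam t p) (Nat.le_ceil m)
            _ = Lam t p ^ ⌈m⌉₊ := Real.rpow_natCast _ _
            _ ≤ _ := pow_le_pow_left₀ hL.le (Lam_le_bracket t p) _
        gcongr
    _ = _ := by rw [mul_pow]; ring

theorem dissip_le (hμ : μ < 1) (hν : 0 < ν) (t : ℝ) (p : ℤ × ℝ) :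
    dissip μ ν t p ≤ (ν + ν ^ (1 / 3 : ℝ) + 1 + echoSum μ) * bracket p := by
  have h1 := sq_div_absD_le_one p
  have h2 := Upsilon_le hμ t p
  have h3 := absDxThird_sq_le p
  have h4 : absD p ^ 2 ≤ bracket p := by rw [absD_sq]; unfold bracket; linarith
  have h5 := one_le_bracket p
  have h6 := echoSum_nonneg μ
  have h7 : echoSum μ ≤ echoSum μ * bracket p := le_mul_of_one_le_right h6 h5
  unfold dissip
  calc _ ≤ ν * bracket p + ν ^ (1 / 3 : ℝ) * bracket p + 1 * bracket p + echoSum μ * bracket p := by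
        gcongr <;> linarith
    _ = _ := by ring

theorem measurable_dissip (hμ : μ < 1) (ν t : ℝ) : Measurable (dissip μ ν t) :=
  (((measurable_absD.pow_const 2).const_mul ν).add ((measurable_absDxThird.pow_const 2).const_mul _)).add
    ((measurable_fst_cast.pow_const 2).div (measurable_absD.pow_const 2)) |>.add (measurable_Upsilon hμ t)

theorem polyBdd_dis (hμ : μ < 1) (hν : 0 < ν) (t : ℝ) : PolyBdd (dis μ ν t) := by
  refine ⟨(measurable_dissip hμ ν t).sqrt, 1 + (ν + ν ^ (1 / 3 : ℝ) + 1 + echoSum μ), 1, fun p => ?_⟩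
  rw [abs_of_nonneg (dis_nonneg μ ν t p), pow_one]
  have h1 := dissip_le hμ hν t p
  have h2 := dis_sq (μ := μ) hν t p
  have h3 := one_le_bracket p
  nlinarith [dis_nonneg μ ν t p, sq_nonneg (dis μ ν t p - 1)]

/-- The energy `‖√𝓜 Λ^m f‖²`. -/
noncomputable def wtEnergy (φ : ℝ → ℝ) (μ δ₀ ν m t : ℝ) (F : ℤ × ℝ → ℂ) : ℝ :=
  ∫ p, (wt φ μ δ₀ ν m t p * ‖F p‖) ^ 2 ∂freqMeasure

/-- The dissipation of the energy, with the symbol `dissip`. -/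
noncomputable def wtDissipation (φ : ℝ → ℝ) (μ δ₀ ν m t : ℝ) (F : ℤ × ℝ → ℂ) : ℝ :=
  ∫ p, (dis μ ν t p * wt φ μ δ₀ ν m t p * ‖F p‖) ^ 2 ∂freqMeasure

theorem wtDissipation_nonneg (φ : ℝ → ℝ) (μ δ₀ ν m t : ℝ) (F : ℤ × ℝ → ℂ) :
    0 ≤ wtDissipation φ μ δ₀ ν m t F := integral_nonneg fun _ => sq_nonneg _

/-- The constant in the bound for the nonzero modes of the velocity. -/
noncomputable def advConst (μ δ₀ m : ℝ) : ℝ :=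
  3 * (ghostBound μ * 2 ^ m * (6 + 12 / δ₀)) * (advBound μ m).toReal

/-- The constant in the bound for the zero mode of the velocity. -/
noncomputable def commConst (μ m : ℝ) : ℝ :=
  (1 + 2 * m * 2 ^ (m - 1)) * ghostBound μ * (commBound m).toReal

theorem advConst_nonneg (hδ : 0 < δ₀) : 0 ≤ advConst μ δ₀ m := by
  have := two_le_ghostBound μ
  unfold advConst; positivity

theorem commConst_nonneg (hm : 0 ≤ m) : 0 ≤ commConst μ m := by
  have := two_le_ghostBound μ
  unfold commConst; positivity

theorem IsTrilinear.integral_mul_le {k : ℤ × ℝ → ℤ × ℝ → ℝ} {S : ℝ≥0∞} (h : IsTrilinear k S)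
    (hS : S ≠ ∞) (hk : Measurable fun q : (ℤ × ℝ) × (ℤ × ℝ) => k q.2 (q.1 - q.2))
    (hk0 : ∀ b c, 0 ≤ k b c) {A B C : ℤ × ℝ → ℝ} (hA : AEStronglyMeasurable A freqMeasure)
    (hB : AEStronglyMeasurable B freqMeasure) (hC : AEStronglyMeasurable C freqMeasure)
    (hA0 : ∀ p, 0 ≤ A p) (hB0 : ∀ p, 0 ≤ B p) (hC0 : ∀ p, 0 ≤ C p)
    (hA2 : Integrable (fun p => A p ^ 2) freqMeasure)
    (hB2 : Integrable (fun p => B p ^ 2) freqMeasure)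
    (hC2 : Integrable (fun p => C p ^ 2) freqMeasure) :
    Integrable (fun q : (ℤ × ℝ) × (ℤ × ℝ) => A q.1 * B q.2 * C (q.1 - q.2) * k q.2 (q.1 - q.2))
      (freqMeasure.prod freqMeasure) ∧
    ∫ q : (ℤ × ℝ) × (ℤ × ℝ), A q.1 * B q.2 * C (q.1 - q.2) * k q.2 (q.1 - q.2)
      ∂(freqMeasure.prod freqMeasure) ≤ S.toReal * (Real.sqrt (∫ p, A p ^ 2 ∂freqMeasure) *
        Real.sqrt (∫ p, B p ^ 2 ∂freqMeasure) * Real.sqrt (∫ p, C p ^ 2 ∂freqMeasure)) := by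
  have := h.integral_le hS hA hB hC hA0 hB0 hC0 hA2 hB2 hC2
    (f := fun q => A q.1 * B q.2 * C (q.1 - q.2) * k q.2 (q.1 - q.2))
    (((hA.comp_fst.mul hB.comp_snd).mul (hC.comp_quasiMeasurePreserving
        (quasiMeasurePreserving_sub freqMeasure freqMeasure))).mul hk.aestronglyMeasurable)
    (Filter.Eventually.of_forall fun q => by
      rw [Real.norm_of_nonneg]
      exact mul_nonneg (mul_nonneg (mul_nonneg (hA0 _) (hB0 _)) (hC0 _)) (hk0 _ _))
  exact ⟨this.1, (le_abs_self _).trans this.2⟩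

/-- The transport of the vorticity by the nonzero modes of the velocity is controlled by the
dissipation. -/
theorem nonzero_transport_le (hφ : IsProfile φ) (hμ0 : 0 < μ) (hμ : μ < 1) (hδ : 0 < δ₀)
    (hm : 2 < m) {h : ℝ} (hh : 0 < h) (hh1 : h ≤ 1) (hν : ν = h ^ 6) (ht : 1 ≤ h * t)
    (hF : Rapid F) (hV₁ : Rapid V₁) (hV₂ : Rapid V₂)
    (hb₁ : ∀ᵐ p ∂freqMeasure, ‖V₁ p‖ * absD p ^ 2 ≤ |p.2| * ‖F p‖)
    (hb₂ : ∀ᵐ p ∂freqMeasure, ‖V₂ p‖ * absD p ^ 2 ≤ |(p.1 : ℝ)| * ‖F p‖)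
    (h₁ : ∀ p : ℤ × ℝ, p.1 = 0 → V₁ p = 0) (h₂ : ∀ p : ℤ × ℝ, p.1 = 0 → V₂ p = 0) :
    h ^ 2 * |∫ p, wt φ μ δ₀ ν m t p ^ 2 * ((starRingEnd ℂ) (F p) * conv V₁ (mulX F) p).re ∂freqMeasure +
      ∫ p, wt φ μ δ₀ ν m t p ^ 2 * ((starRingEnd ℂ) (F p) * conv V₂ (mulY F) p).re ∂freqMeasure| ≤
      advConst μ δ₀ m * (Real.sqrt (wtEnergy φ μ δ₀ ν m t F) * wtDissipation φ μ δ₀ ν m t F) := by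
  have hν0 : 0 < ν := by rw [hν]; positivity
  have ht0 : 0 < t := by
    by_contra hn
    nlinarith
  have hwt := polyBdd_wt hφ hμ hδ.le hν0 m ht0.le
  have hdwt := (polyBdd_dis hμ hν0 t).mul hwt
  have hXF : Rapid (mulX F) := RapidOn.mulX hF
  have hYF : Rapid (mulY F) := RapidOn.mulY hF
  have hi1 := (hwt.pow 2).integrable_conv hF hV₁ hXF
  have hi2 := (hwt.pow 2).integrable_conv hF hV₂ hYF
  rw [(hwt.pow 2).integral_conv hF hV₁ hXF, (hwt.pow 2).integral_conv hF hV₂ hYF, ← mul_add,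
    ← Complex.add_re, ← integral_add hi1 hi2]
  set f : (ℤ × ℝ) × (ℤ × ℝ) → ℂ := fun q =>
    ((wt φ μ δ₀ ν m t q.1 ^ 2 : ℝ) : ℂ) * (starRingEnd ℂ) (F q.1) * (V₁ q.2 * mulX F (q.1 - q.2)) +
    ((wt φ μ δ₀ ν m t q.1 ^ 2 : ℝ) : ℂ) * (starRingEnd ℂ) (F q.1) * (V₂ q.2 * mulY F (q.1 - q.2)) with hf
  set P : ℤ × ℝ → ℝ := fun p => wt φ μ δ₀ ν m t p * ‖F p‖ with hP
  set Q : ℤ × ℝ → ℝ := fun p => dis μ ν t p * wt φ μ δ₀ ν m t p * ‖F p‖ with hQ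
  have hP0 : ∀ p, 0 ≤ P p := fun p => mul_nonneg (wt_nonneg _ _ _ _ _ _ _) (norm_nonneg _)
  have hQ0 : ∀ p, 0 ≤ Q p := fun p => mul_nonneg (mul_nonneg (dis_nonneg _ _ _ _)
    (wt_nonneg _ _ _ _ _ _ _)) (norm_nonneg _)
  have hPm := hwt.aesm hF
  have hQm := hdwt.aesm hF
  have hP2 := hwt.integrable_sq hF
  have hQ2 := hdwt.integrable_sq hF
  set k := advKernel μ m t with hk
  have hkm : Measurable fun q : (ℤ × ℝ) × (ℤ × ℝ) => k q.2 (q.1 - q.2) := by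
    have hs : Measurable fun q : (ℤ × ℝ) × (ℤ × ℝ) => q.1 - q.2 := measurable_fst.sub measurable_snd
    exact (((measurable_lamDecay m t).comp measurable_snd).add ((measurable_lamDecay m t).comp hs)).add
      (((measurable_lowWeight μ).comp measurable_snd).mul
        (((measurable_fst_cast.abs.sqrt).comp hs).mul ((measurable_lamDecay m t).comp hs)))
  have hk0 : ∀ b c, 0 ≤ k b c := fun b c => by
    have h1 := lamDecay_pos m t b
    have h2 := lamDecay_pos m t c
    have h3 : 0 ≤ lowWeight μ b := by unfold lowWeight; positivity
    rw [hk]; unfold advKernel; positivity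
  set S := (advBound μ m).toReal with hS
  set N := Real.sqrt (wtEnergy φ μ δ₀ ν m t F) with hN
  set D := wtDissipation φ μ δ₀ ν m t F with hD
  have hD0 : 0 ≤ D := wtDissipation_nonneg _ _ _ _ _ _ _
  have hDs : Real.sqrt D * Real.sqrt D = D := Real.mul_self_sqrt hD0
  obtain ⟨i1, b1⟩ := (isTrilinear_advKernel hm μ t).integral_mul_le (advBound_ne_top hμ0 hm) hkm hk0
    hQm hQm hPm hQ0 hQ0 hP0 hQ2 hQ2 hP2
  obtain ⟨i2, b2⟩ := (isTrilinear_advKernel hm μ t).integral_mul_le (advBound_ne_top hμ0 hm) hkm hk0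
    hPm hQm hQm hP0 hQ0 hQ0 hP2 hQ2 hQ2
  obtain ⟨i3, b3⟩ := (isTrilinear_advKernel hm μ t).integral_mul_le (advBound_ne_top hμ0 hm) hkm hk0
    hQm hPm hQm hQ0 hP0 hQ0 hQ2 hP2 hQ2
  have hPN : Real.sqrt (∫ p, P p ^ 2 ∂freqMeasure) = N := rfl
  have hQD : Real.sqrt (∫ p, Q p ^ 2 ∂freqMeasure) = Real.sqrt D := rfl
  rw [hPN, hQD] at b1 b2 b3
  set K := ghostBound μ * 2 ^ m * (6 + 12 / δ₀) with hK
  have hK0 : 0 ≤ K := by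
    have := two_le_ghostBound μ
    positivity
  have hpt : ∀ᵐ q ∂(freqMeasure.prod freqMeasure), ‖((h ^ 2 : ℝ) : ℂ) * f q‖ ≤
      K * (Q q.1 * Q q.2 * P (q.1 - q.2) * k q.2 (q.1 - q.2) +
        P q.1 * Q q.2 * Q (q.1 - q.2) * k q.2 (q.1 - q.2) +
        Q q.1 * P q.2 * Q (q.1 - q.2) * k q.2 (q.1 - q.2)) := by
    filter_upwards [Measure.quasiMeasurePreserving_snd.ae hb₁,
      Measure.quasiMeasurePreserving_snd.ae hb₂] with q hq1 hq2
    obtain ⟨a, b⟩ := q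
    dsimp only at hq1 hq2 ⊢
    obtain ⟨c, rfl⟩ : ∃ c, a = b + c := ⟨a - b, by rw [add_sub_cancel]⟩
    rw [add_sub_cancel_left]
    by_cases hb : b.1 = 0
    · have : f (b + c, b) = 0 := by simp only [hf, h₁ b hb, h₂ b hb]; ring
      rw [this, mul_zero, norm_zero]
      have := hP0; have := hQ0; have := hk0
      exact mul_nonneg hK0 (add_nonneg (add_nonneg
        (mul_nonneg (mul_nonneg (mul_nonneg (hQ0 _) (hQ0 _)) (hP0 _)) (hk0 _ _))
        (mul_nonneg (mul_nonneg (mul_nonneg (hP0 _) (hQ0 _)) (hQ0 _)) (hk0 _ _)))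
        (mul_nonneg (mul_nonneg (mul_nonneg (hQ0 _) (hP0 _)) (hQ0 _)) (hk0 _ _)))
    have hb0 : 0 < absD b ^ 2 := by have := one_le_absD hb; positivity
    have hv1 : ‖V₁ b‖ ≤ |b.2| * ‖F b‖ / absD b ^ 2 := by rwa [le_div_iff₀ hb0]
    have hv2 : ‖V₂ b‖ ≤ |(b.1 : ℝ)| * ‖F b‖ / absD b ^ 2 := by rwa [le_div_iff₀ hb0]
    have hw := wt_mul_advSymbol_le (c := c) hφ hμ0.le hμ hδ (by linarith : 0 ≤ m) hh hh1 hν ht hb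
    have hwa := wt_nonneg φ μ δ₀ ν m t (b + c)
    have hfq : ‖f (b + c, b)‖ ≤ wt φ μ δ₀ ν m t (b + c) ^ 2 * ‖F (b + c)‖ *
        (advSymbol b c * ‖F b‖ * ‖F c‖) := by
      simp only [hf, add_sub_cancel_left]
      refine (norm_add_le _ _).trans ?_
      simp only [norm_mul, RCLike.norm_conj, mulX, mulY, Complex.norm_I, Complex.norm_real,
        Real.norm_eq_abs, one_mul, abs_of_nonneg (sq_nonneg (wt φ μ δ₀ ν m t (b + c)))]
      rw [← mul_add]
      gcongr
      calc ‖V₁ b‖ * (|(c.1 : ℝ)| * ‖F c‖) + ‖V₂ b‖ * (|c.2| * ‖F c‖)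
          ≤ |b.2| * ‖F b‖ / absD b ^ 2 * (|(c.1 : ℝ)| * ‖F c‖) +
            |(b.1 : ℝ)| * ‖F b‖ / absD b ^ 2 * (|c.2| * ‖F c‖) := by gcongr
        _ = _ := by unfold advSymbol; ring
    rw [norm_mul, Complex.norm_real, Real.norm_of_nonneg (sq_nonneg h)]
    calc h ^ 2 * ‖f (b + c, b)‖ ≤ h ^ 2 * (wt φ μ δ₀ ν m t (b + c) ^ 2 * ‖F (b + c)‖ *
        (advSymbol b c * ‖F b‖ * ‖F c‖)) := by gcongr
      _ = (wt φ μ δ₀ ν m t (b + c) * (h ^ 2 * advSymbol b c)) *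
          (wt φ μ δ₀ ν m t (b + c) * ‖F (b + c)‖ * ‖F b‖ * ‖F c‖) := by ring
      _ ≤ (K * (wt φ μ δ₀ ν m t b * wt φ μ δ₀ ν m t c *
        advKernel μ m t b c * disPairs μ ν t b c)) *
          (wt φ μ δ₀ ν m t (b + c) * ‖F (b + c)‖ * ‖F b‖ * ‖F c‖) := by
          gcongr
      _ = _ := by simp only [hP, hQ, hk, disPairs]; ring
  have hint := norm_integral_le_of_norm_le (((i1.add i2).add i3).const_mul K) hpt
  rw [integral_const_mul, norm_mul, Complex.norm_real, Real.norm_of_nonneg (sq_nonneg h)] at hint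
  have hsum := integral_add (i1.add i2) i3
  simp only [Pi.add_apply] at hint hsum
  rw [integral_add i1 i2] at hsum
  rw [integral_const_mul, hsum] at hint
  have hpi : (2 * Real.pi)⁻¹ ≤ 1 := inv_le_one_of_one_le₀ (by nlinarith [Real.pi_gt_three])
  have hpi0 : 0 ≤ (2 * Real.pi)⁻¹ := by positivity
  rw [abs_mul, abs_of_nonneg hpi0]
  calc h ^ 2 * ((2 * Real.pi)⁻¹ * |(∫ q, f q ∂(freqMeasure.prod freqMeasure)).re|)
      ≤ h ^ 2 * (1 * ‖∫ q, f q ∂(freqMeasure.prod freqMeasure)‖) := by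
        gcongr; exact Complex.abs_re_le_norm _
    _ = h ^ 2 * ‖∫ q, f q ∂(freqMeasure.prod freqMeasure)‖ := by rw [one_mul]
    _ ≤ K * (S * (Real.sqrt D * Real.sqrt D * N) + S * (N * Real.sqrt D * Real.sqrt D) +
        S * (Real.sqrt D * N * Real.sqrt D)) :=
        hint.trans (mul_le_mul_of_nonneg_left (add_le_add (add_le_add b1 b2) b3) hK0)
    _ = advConst μ δ₀ m * (N * D) := by
        unfold advConst
        rw [← hK, ← hS]
        linear_combination (3 * K * S * N) * hDs

/-- The transport by the shear flow `(u₁)₀` is controlled by the dissipation: it is antisymmetric, so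
that only a commutator with the weight remains. -/
theorem zero_transport_le (hφ : IsProfile φ) (hμ : μ < 1) (hδ : 0 ≤ δ₀)
    (hm : 2 < m) {h : ℝ} (hh : 0 < h) (hh1 : h ≤ 1) (hν : ν = h ^ 6) (ht : 0 ≤ t)
    (hF : Rapid F) (hV : Rapid V) (hG : Rapid G)
    (hb : ∀ᵐ p ∂freqMeasure, |p.2| * ‖V p‖ ≤ ‖F p‖)
    (h0 : ∀ p : ℤ × ℝ, p.1 ≠ 0 → V p = 0)
    (hreal : ∀ᵐ p ∂freqMeasure, V (-p) = (starRingEnd ℂ) (V p)) :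
    h ^ 2 * |∫ p, wt φ μ δ₀ ν m t p ^ 2 * ((starRingEnd ℂ) (G p) * conv V (mulX G) p).re ∂freqMeasure| ≤
      commConst μ m * (Real.sqrt (wtEnergy φ μ δ₀ ν m t F) * wtDissipation φ μ δ₀ ν m t G) := by
  have hν0 : 0 < ν := by rw [hν]; positivity
  have hwt := polyBdd_wt hφ hμ hδ hν0 m ht
  have hdwt := (polyBdd_dis hμ hν0 t).mul hwt
  have hXG : Rapid (mulX G) := RapidOn.mulX hG
  have hi := (hwt.pow 2).integrable_conv hG hV hXG
  rw [(hwt.pow 2).integral_conv hG hV hXG]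
  set f : (ℤ × ℝ) × (ℤ × ℝ) → ℂ := fun q =>
    ((wt φ μ δ₀ ν m t q.1 ^ 2 : ℝ) : ℂ) * (starRingEnd ℂ) (G q.1) * (V q.2 * mulX G (q.1 - q.2)) with hf
  set σ : (ℤ × ℝ) × (ℤ × ℝ) → (ℤ × ℝ) × (ℤ × ℝ) := fun q => (q.1 - q.2, -q.2) with hσ
  have hmp : MeasurePreserving σ (freqMeasure.prod freqMeasure) (freqMeasure.prod freqMeasure) :=
    measurePreserving_sub_neg
  have hiσ : Integrable (fun q => f (σ q)) (freqMeasure.prod freqMeasure) := hmp.integrable_comp_of_integrable hi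
  have hσi : ∫ q, f (σ q) ∂(freqMeasure.prod freqMeasure) = ∫ q, f q ∂(freqMeasure.prod freqMeasure) := by
    rw [← integral_map hmp.aemeasurable (by rw [hmp.map_eq]; exact hi.aestronglyMeasurable), hmp.map_eq]
  set P : ℤ × ℝ → ℝ := fun p => wt φ μ δ₀ ν m t p * ‖F p‖ with hP
  set Q : ℤ × ℝ → ℝ := fun p => dis μ ν t p * wt φ μ δ₀ ν m t p * ‖G p‖ with hQ
  have hP0 : ∀ p, 0 ≤ P p := fun p => mul_nonneg (wt_nonneg _ _ _ _ _ _ _) (norm_nonneg _)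
  have hQ0 : ∀ p, 0 ≤ Q p := fun p => mul_nonneg (mul_nonneg (dis_nonneg _ _ _ _)
    (wt_nonneg _ _ _ _ _ _ _)) (norm_nonneg _)
  set k := commKernel m t with hk
  have hkm : Measurable fun q : (ℤ × ℝ) × (ℤ × ℝ) => k q.2 (q.1 - q.2) := by
    have hs : Measurable fun q : (ℤ × ℝ) × (ℤ × ℝ) => q.1 - q.2 := measurable_fst.sub measurable_snd
    exact (((measurable_lamDecay m t).comp (measurable_snd.add hs)).add
      ((measurable_lamDecay m t).comp measurable_snd)).add ((measurable_lamDecay m t).comp hs)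
  have hk0 : ∀ b c, 0 ≤ k b c := fun b c => by
    have h1 := lamDecay_pos m t b
    have h2 := lamDecay_pos m t c
    have h3 := lamDecay_pos m t (b + c)
    rw [hk]; unfold commKernel; positivity
  set N := Real.sqrt (wtEnergy φ μ δ₀ ν m t F) with hN
  set D := wtDissipation φ μ δ₀ ν m t G with hD
  have hDs : Real.sqrt D * Real.sqrt D = D := Real.mul_self_sqrt (wtDissipation_nonneg _ _ _ _ _ _ _)
  obtain ⟨i1, b1⟩ := (isTrilinear_commKernel m t).integral_mul_le (commBound_ne_top hm) hkm hk0
    (hdwt.aesm hG) (hwt.aesm hF) (hdwt.aesm hG) hQ0 hP0 hQ0 (hdwt.integrable_sq hG)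
    (hwt.integrable_sq hF) (hdwt.integrable_sq hG)
  have hPN : Real.sqrt (∫ p, P p ^ 2 ∂freqMeasure) = N := rfl
  have hQD : Real.sqrt (∫ p, Q p ^ 2 ∂freqMeasure) = Real.sqrt D := rfl
  rw [hPN, hQD] at b1
  set K := (1 + 2 * m * 2 ^ (m - 1)) * ghostBound μ with hK
  have hK0 : 0 ≤ K := by
    have := two_le_ghostBound μ
    positivity
  have hpt : ∀ᵐ q ∂(freqMeasure.prod freqMeasure), ‖h ^ 2 * (f q + f (σ q)).re‖ ≤
      K * (Q q.1 * P q.2 * Q (q.1 - q.2) * k q.2 (q.1 - q.2)) := by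
    filter_upwards [Measure.quasiMeasurePreserving_snd.ae hb,
      Measure.quasiMeasurePreserving_snd.ae hreal] with q hq1 hq2
    obtain ⟨a, b⟩ := q
    dsimp only at hq1 hq2 ⊢
    obtain ⟨c, rfl⟩ : ∃ c, a = b + c := ⟨a - b, by rw [add_sub_cancel]⟩
    have hneg : c - -b = b + c := by abel
    simp only [hf, hσ, hneg, add_sub_cancel_left]
    by_cases hb0 : b.1 = 0
    swap
    · have hb0' : (-b).1 ≠ 0 := by simpa using hb0
      rw [h0 b hb0, h0 (-b) hb0']
      simp only [zero_mul, mul_zero, add_zero, Complex.zero_re, norm_zero]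
      exact mul_nonneg hK0 (mul_nonneg (mul_nonneg (mul_nonneg (hQ0 _) (hP0 _)) (hQ0 _)) (hk0 _ _))
    have hab : (b + c).1 = c.1 := by rw [Prod.fst_add, hb0, zero_add]
    have hw := wt_sq_sub_le (c := c) hφ hμ hδ (by linarith : 1 ≤ m) hh hh1 hν ht hb0
    -- the two contributions are opposite complex conjugates, up to the weight
    have hz : (((wt φ μ δ₀ ν m t (b + c) ^ 2 : ℝ) : ℂ) * (starRingEnd ℂ) (G (b + c)) * (V b * mulX G c) +
        ((wt φ μ δ₀ ν m t c ^ 2 : ℝ) : ℂ) * (starRingEnd ℂ) (G c) * (V (-b) * mulX G (b + c))).re =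
        (wt φ μ δ₀ ν m t (b + c) ^ 2 - wt φ μ δ₀ ν m t c ^ 2) *
          ((starRingEnd ℂ) (G (b + c)) * (V b * mulX G c)).re := by
      rw [hq2]
      simp only [mulX, hab]
      set x := wt φ μ δ₀ ν m t (b + c)
      set y := wt φ μ δ₀ ν m t c
      have e : ((y ^ 2 : ℝ) : ℂ) * (starRingEnd ℂ) (G c) *
          ((starRingEnd ℂ) (V b) * (Complex.I * ((c.1 : ℝ) : ℂ) * G (b + c))) =
          ((-(y ^ 2) : ℝ) : ℂ) * (starRingEnd ℂ) ((starRingEnd ℂ) (G (b + c)) *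
            (V b * (Complex.I * ((c.1 : ℝ) : ℂ) * G c))) := by
        simp only [map_mul, Complex.conj_conj, Complex.conj_I, Complex.conj_ofReal, Complex.ofReal_neg]
        ring
      rw [e, Complex.add_re, mul_assoc, Complex.re_ofReal_mul, Complex.re_ofReal_mul, Complex.conj_re]
      ring
    rw [hz]
    have hwa := wt_nonneg φ μ δ₀ ν m t (b + c)
    have hwb := wt_nonneg φ μ δ₀ ν m t b
    have hwc := wt_nonneg φ μ δ₀ ν m t c
    have hda := dis_nonneg μ ν t (b + c)
    have hdc := dis_nonneg μ ν t c
    have hkk := hk0 b c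
    have hre : |((starRingEnd ℂ) (G (b + c)) * (V b * mulX G c)).re| ≤
        ‖G (b + c)‖ * (‖V b‖ * (|(c.1 : ℝ)| * ‖G c‖)) := by
      refine (Complex.abs_re_le_norm _).trans_eq ?_
      simp only [norm_mul, RCLike.norm_conj, mulX, Complex.norm_I, Complex.norm_real,
        Real.norm_eq_abs, one_mul]
    rw [Real.norm_eq_abs, abs_mul, abs_mul, abs_of_nonneg (sq_nonneg h)]
    calc _ ≤ h ^ 2 * (|wt φ μ δ₀ ν m t (b + c) ^ 2 - wt φ μ δ₀ ν m t c ^ 2| *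
          (‖G (b + c)‖ * (‖V b‖ * (|(c.1 : ℝ)| * ‖G c‖)))) := by gcongr
      _ = h ^ 2 * (|(c.1 : ℝ)| * |wt φ μ δ₀ ν m t (b + c) ^ 2 - wt φ μ δ₀ ν m t c ^ 2|) *
          (‖G (b + c)‖ * ‖G c‖ * ‖V b‖) := by ring
      _ ≤ K * (|b.2| * (wt φ μ δ₀ ν m t (b + c) * wt φ μ δ₀ ν m t b * wt φ μ δ₀ ν m t c *
          commKernel m t b c * (dis μ ν t (b + c) * dis μ ν t c))) *
          (‖G (b + c)‖ * ‖G c‖ * ‖V b‖) := by gcongr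
      _ = K * (wt φ μ δ₀ ν m t (b + c) * wt φ μ δ₀ ν m t b * wt φ μ δ₀ ν m t c *
          commKernel m t b c * (dis μ ν t (b + c) * dis μ ν t c) *
          (‖G (b + c)‖ * ‖G c‖)) * (|b.2| * ‖V b‖) := by ring
      _ ≤ K * (wt φ μ δ₀ ν m t (b + c) * wt φ μ δ₀ ν m t b * wt φ μ δ₀ ν m t c *
          commKernel m t b c * (dis μ ν t (b + c) * dis μ ν t c) *
          (‖G (b + c)‖ * ‖G c‖)) * ‖F b‖ := by gcongr
      _ = _ := by simp only [hP, hQ, hk]; ring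
  have hint := norm_integral_le_of_norm_le (i1.const_mul K) hpt
  have hre : ∫ q, (f q + f (σ q)).re ∂(freqMeasure.prod freqMeasure) =
      2 * (∫ q, f q ∂(freqMeasure.prod freqMeasure)).re := by
    have h1 := integral_re (hi.add hiσ)
    simp only [RCLike.re_to_complex, Pi.add_apply] at h1
    rw [h1, integral_add hi hiσ, hσi, Complex.add_re]; ring
  rw [integral_const_mul, integral_const_mul, norm_mul, Real.norm_of_nonneg (sq_nonneg h), hre,
    Real.norm_eq_abs, abs_mul, abs_of_pos (two_pos : (0 : ℝ) < 2)] at hint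
  have hpi : (2 * Real.pi)⁻¹ ≤ 1 := inv_le_one_of_one_le₀ (by nlinarith [Real.pi_gt_three])
  have hpi0 : 0 ≤ (2 * Real.pi)⁻¹ := by positivity
  rw [abs_mul, abs_of_nonneg hpi0]
  set I := |(∫ q, f q ∂(freqMeasure.prod freqMeasure)).re|
  have hI : 0 ≤ I := abs_nonneg _
  calc h ^ 2 * ((2 * Real.pi)⁻¹ * I) ≤ h ^ 2 * (2 * I) := by gcongr; linarith
    _ ≤ K * ((commBound m).toReal * (Real.sqrt D * N * Real.sqrt D)) :=
        hint.trans (mul_le_mul_of_nonneg_left b1 hK0)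
    _ = commConst μ m * (N * D) := by
        unfold commConst
        rw [← hK]
        linear_combination (K * (commBound m).toReal * N) * hDs

end

/-! ### The energy inequality for a forced transport-diffusion equation -/

section
variable {φ : ℝ → ℝ} {μ δ₀ ν m t T : ℝ}

theorem polyBdd_MDeriv (hφ : IsProfile φ) (hμ : μ < 1) (hδ : 0 ≤ δ₀) (hν : 0 < ν) (ht : 0 ≤ t) :
    PolyBdd (MDeriv φ μ δ₀ ν t) := by
  set g := δ₀ * ν ^ (1 / 3 : ℝ) with hg
  have hg0 : 0 ≤ g := by positivity
  refine ⟨measurable_MDeriv hφ hμ δ₀ ν t, Real.exp (g * t) * (g * ghostBound μ +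
    (ν ^ (1 / 3 : ℝ) + 1 + echoSum μ)), 1, fun p => ?_⟩
  have h1 := ghost_le hφ hμ ν t p
  have h1' := one_le_ghost hφ hμ ν t p
  have h4 := ghostDecay_nonneg (μ := μ) hφ hν t p
  have h5 := ghostDecay_le hφ hμ hν t p
  have h6 := absDxThird_sq_le p
  have h7 := growth_nonneg hδ hν p
  have h8 := growth_le hδ hν p
  have hJ := one_le_bracket p
  have hσ := echoSum_nonneg μ
  have hB := two_le_ghostBound μ
  have h9 : growth δ₀ ν p * ghost φ μ ν t p ≤ g * ghostBound μ := by gcongr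
  have h10 : 0 ≤ growth δ₀ ν p * ghost φ μ ν t p := mul_nonneg h7 (by linarith)
  have h11 : ν ^ (1 / 3 : ℝ) * absDxThird p ^ 2 ≤ ν ^ (1 / 3 : ℝ) * bracket p := by gcongr
  have h12 : g * ghostBound μ ≤ g * ghostBound μ * bracket p :=
    le_mul_of_one_le_right (by positivity) hJ
  have h13 : echoSum μ ≤ echoSum μ * bracket p := le_mul_of_one_le_right hσ hJ
  unfold MDeriv
  rw [abs_mul, abs_of_pos (Real.exp_pos _), pow_one, mul_assoc]
  gcongr
  rw [abs_le]; constructor <;> linarith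

theorem polyBdd_Lam_rpow (m t : ℝ) : PolyBdd fun p => Lam t p ^ m := by
  refine ⟨(measurable_Lam t).pow_const m, (2 + 2 * t ^ 2) ^ ⌈m⌉₊, ⌈m⌉₊, fun p => ?_⟩
  have hL := Lam_pos t p
  rw [abs_of_pos (by positivity), ← mul_pow]
  calc Lam t p ^ m ≤ Lam t p ^ (⌈m⌉₊ : ℝ) :=
        Real.rpow_le_rpow_of_exponent_le (one_le_Lam t p) (Nat.le_ceil m)
    _ = Lam t p ^ ⌈m⌉₊ := Real.rpow_natCast _ _
    _ ≤ _ := pow_le_pow_left₀ hL.le (Lam_le_bracket t p) _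

theorem polyBdd_const (c : ℝ) : PolyBdd fun _ => c :=
  ⟨measurable_const, |c|, 0, fun p => by simp⟩

theorem PolyBdd.integrable_mul_sq {β : ℤ × ℝ → ℝ} {F : ℤ × ℝ → ℂ} (hβ : PolyBdd β) (hF : Rapid F) :
    Integrable (fun p => β p * ‖F p‖ ^ 2) freqMeasure := by
  refine (hβ.integrable_pair hF hF).congr (Filter.Eventually.of_forall fun p => ?_)
  dsimp only
  rw [mul_comm ((starRingEnd ℂ) (F p)), Complex.mul_conj, Complex.ofReal_re, Complex.normSq_eq_norm_sq]

theorem mulX_mulX_add_mulY_mulY (F : ℤ × ℝ → ℂ) (p : ℤ × ℝ) :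
    mulX (mulX F) p + mulY (mulY F) p = ((-(absD p ^ 2) : ℝ) : ℂ) * F p := by
  rw [absD_sq]
  unfold mulX mulY
  push_cast
  linear_combination (((p.1 : ℂ)) ^ 2 + (p.2 : ℂ) ^ 2) * F p * Complex.I_sq

theorem IsInv.lap {f : ℝ → ℝ → ℝ} {F : ℤ × ℝ → ℂ} (h : IsInv f F) :
    IsInv (lap f) (fun p => mulX (mulX F) p + mulY (mulY F) p) := h.dx.dx.add h.dy.dy

/-- The energy inequality for `∂ₜf + y ∂ₓf - νΔf = r`. -/
theorem energy_rate_le (hφ : IsProfile φ) (hμ : μ < 1) (hδ : 0 ≤ δ₀) (hδ' : δ₀ ≤ coer μ) (hν : 0 < ν)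
    {f : ℝ → ℝ → ℝ → ℝ} {F R : ℝ → ℤ × ℝ → ℂ} (hf : IsRegular T f F)
    (hR : ∀ a b : ℝ, 0 < a → b < T → RapidOn (Icc a b) R)
    (heq : ∀ t ∈ Ioo 0 T,
      IsInv (fun x y => dt f t x y + y * dx (f t) x y - ν * lap (f t) x y) (R t))
    {χ : ℤ → ℝ} (hχ : PolyBdd fun p => χ p.1) (ht : t ∈ Ioo 0 T) :
    ∃ E', HasDerivAt (fun s => ∫ p, (χ p.1 * wt φ μ δ₀ ν m s p) ^ 2 * ‖F s p‖ ^ 2 ∂freqMeasure) E' t ∧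
      E' ≤ -coer μ * wtDissipation φ μ δ₀ ν m t (fun p => (χ p.1 : ℂ) * F t p) +
        2 * ∫ p, (χ p.1 * wt φ μ δ₀ ν m t p) ^ 2 * ((starRingEnd ℂ) (F t p) * R t p).re ∂freqMeasure := by
  have hF := (hf.fourier t ht).isInv
  have hRt := (heq t ht).rapid
  set G : ℝ → ℤ × ℝ → ℂ := fun t p => (ν : ℂ) * (mulX (mulX (F t)) p + mulY (mulY (F t)) p) + R t p with hG
  have hGr : ∀ a b : ℝ, 0 < a → b < T → RapidOn (Icc a b) G := fun a b ha hb => by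
    have h := hf.rapidOn ha hb
    exact ((h.mulX.mulX.add h.mulY.mulY).const_mul ν).add (hR a b ha hb)
  have hGeq : ∀ t ∈ Ioo 0 T, ∀ x y,
      ((dt f t x y + y * dx (f t) x y : ℝ) : ℂ) = invFourier (G t) x y := fun t ht x y => by
    rw [← (((hf.fourier t ht).isInv.lap.const_mul ν).add (heq t ht)).eq]
    congr 1; ring
  have hχ2 : ∃ (C : ℝ) (i : ℕ), ∀ p : ℤ × ℝ, χ p.1 ^ 2 ≤ C * bracket p ^ i := by
    obtain ⟨C, i, h⟩ := (hχ.pow 2).bound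
    exact ⟨C, i, fun p => (le_abs_self _).trans (h p)⟩
  have hd := hasDerivAt_weighted_energy (m := m) hφ hμ hδ hν hf hGr hGeq hχ2 ht
  simp only [mul_pow]
  refine ⟨_, hd, ?_⟩
  have hwt := polyBdd_wt hφ hμ hδ hν m ht.1.le
  have hw2 : PolyBdd fun p => χ p.1 ^ 2 * wt φ μ δ₀ ν m t p ^ 2 := (hχ.pow 2).mul (hwt.pow 2)
  have hD2 : PolyBdd fun p => absD p ^ 2 := by
    refine ⟨measurable_absD.pow_const 2, 1, 1, fun p => ?_⟩
    rw [absD_sq, abs_of_nonneg (by positivity)]; unfold bracket; linarith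
  have i1 := ((hχ.pow 2).mul ((polyBdd_MDeriv hφ hμ hδ hν ht.1.le).mul
    ((polyBdd_Lam_rpow m t).pow 2))).integrable_mul_sq hF.rapid
  have i2 := (hw2.mul ((polyBdd_const (-ν)).mul hD2)).integrable_mul_sq hF.rapid
  have i3 := hw2.integrable_pair hF.rapid hRt
  have e1 : ∫ p, χ p.1 ^ 2 * wt φ μ δ₀ ν m t p ^ 2 * ((starRingEnd ℂ) (F t p) * G t p).re ∂freqMeasure =
      ∫ p, χ p.1 ^ 2 * wt φ μ δ₀ ν m t p ^ 2 * (-ν * absD p ^ 2) * ‖F t p‖ ^ 2 ∂freqMeasure +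
      ∫ p, χ p.1 ^ 2 * wt φ μ δ₀ ν m t p ^ 2 * ((starRingEnd ℂ) (F t p) * R t p).re ∂freqMeasure := by
    rw [← integral_add i2 i3]
    refine integral_congr_ae (Filter.Eventually.of_forall fun p => ?_)
    simp only [hG, mulX_mulX_add_mulY_mulY]
    have : (starRingEnd ℂ) (F t p) * ((ν : ℂ) * (((-(absD p ^ 2) : ℝ) : ℂ) * F t p) + R t p) =
        ((-ν * absD p ^ 2 * ‖F t p‖ ^ 2 : ℝ) : ℂ) + (starRingEnd ℂ) (F t p) * R t p := by
      have h := Complex.mul_conj (F t p)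
      rw [Complex.normSq_eq_norm_sq] at h
      push_cast at h ⊢
      linear_combination (-(ν : ℂ) * (absD p : ℂ) ^ 2) * h
    rw [this, Complex.add_re, Complex.ofReal_re]
    ring
  rw [e1]
  have hcoer : ∫ p, χ p.1 ^ 2 * (MDeriv φ μ δ₀ ν t p * (Lam t p ^ m) ^ 2) * ‖F t p‖ ^ 2 ∂freqMeasure +
      2 * ∫ p, χ p.1 ^ 2 * wt φ μ δ₀ ν m t p ^ 2 * (-ν * absD p ^ 2) * ‖F t p‖ ^ 2 ∂freqMeasure ≤
      -coer μ * wtDissipation φ μ δ₀ ν m t (fun p => (χ p.1 : ℂ) * F t p) := by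
    unfold wtDissipation
    rw [← integral_const_mul, ← integral_const_mul, ← integral_add i1 (i2.const_mul 2)]
    refine integral_mono (i1.add (i2.const_mul 2))
      ((((polyBdd_dis hμ hν t).mul hwt).integrable_sq (hχ.rapid hF.rapid)).const_mul _) fun p => ?_
    have hc := coercivity hφ hμ hδ' hν t p
    have hd := dis_sq (μ := μ) hν t p
    have hM := wt_sq hφ hμ δ₀ ν m t p
    dsimp only [Pi.add_apply]
    rw [norm_mul, Complex.norm_real, Real.norm_eq_abs, mul_pow, mul_pow, mul_pow, sq_abs, hd, hM]
    have h0 : 0 ≤ χ p.1 ^ 2 * (Lam t p ^ m) ^ 2 * ‖F t p‖ ^ 2 := by positivity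
    have := mul_le_mul_of_nonneg_left hc h0
    linarith
  linarith

end

/-! ### The velocity in terms of the vorticity -/

section
variable {ν T t : ℝ} {ω θ u₁ u₂ : ℝ → ℝ → ℝ → ℝ} {ωh θh u₁h u₂h : ℝ → ℤ × ℝ → ℂ}

/-- Fourier transform of the zero mode. -/
noncomputable def zeroPart (F : ℤ × ℝ → ℂ) : ℤ × ℝ → ℂ := fun p => if p.1 = 0 then F p else 0

theorem nonzeroMode_eq (F : ℤ × ℝ → ℂ) : nonzeroMode F = fun p => F p + ((-1 : ℝ) : ℂ) * zeroPart F p := by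
  funext p
  unfold nonzeroMode zeroPart
  split_ifs <;> simp

theorem RapidOn.zeroPart {ι : Type*} {I : Set ι} {F : ι → ℤ × ℝ → ℂ} (h : RapidOn I F) :
    RapidOn I fun t => zeroPart (F t) := h.indicator {0}

theorem RapidOn.nonzeroMode {ι : Type*} {I : Set ι} {F : ι → ℤ × ℝ → ℂ} (h : RapidOn I F) :
    RapidOn I fun t => nonzeroMode (F t) := by
  simp only [nonzeroMode_eq]
  exact h.add (h.zeroPart.const_mul _)

theorem ae_snd_ne_zero : ∀ᵐ p ∂freqMeasure, p.2 ≠ 0 := by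
  have : ∀ᵐ ξ : ℝ, ξ ≠ 0 := Measure.ae_ne volume 0
  unfold freqMeasure
  exact Measure.quasiMeasurePreserving_snd.ae this

/-- The Biot-Savart law in Fourier variables, from `div u = 0` and `curl u = ω`. -/
theorem IsSolution.velocity (h : IsSolution ν T ω θ u₁ u₂ ωh θh u₁h u₂h) (ht : t ∈ Ioo 0 T) :
    ∀ᵐ p ∂freqMeasure, ‖u₁h t p‖ * absD p ^ 2 = |p.2| * ‖ωh t p‖ ∧
      ‖u₂h t p‖ * absD p ^ 2 = |(p.1 : ℝ)| * ‖ωh t p‖ := by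
  have hω := (h.regular_ω.fourier t ht).isInv
  have h1 := (h.regular_u₁.fourier t ht).isInv
  have h2 := (h.regular_u₂.fourier t ht).isInv
  have hdiv : mulY (u₂h t) =ᵐ[freqMeasure] fun p => ((-1 : ℝ) : ℂ) * mulX (u₁h t) p := by
    refine h2.dy.ae_eq ?_
    have := h1.dx.const_mul (-1)
    convert this using 3 with x y
    linarith [h.div_free t ht x y]
  have hcurl : ωh t =ᵐ[freqMeasure] fun p => mulX (u₂h t) p + ((-1 : ℝ) : ℂ) * mulY (u₁h t) p := by
    refine hω.ae_eq ?_
    have := h2.dx.add (h1.dy.const_mul (-1))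
    convert this using 3 with x y
    linarith [h.curl t ht x y]
  filter_upwards [hdiv, hcurl] with p hp1 hp2
  have e1 : Complex.I * (((p.2 : ℝ) : ℂ) * ωh t p) = ((absD p ^ 2 : ℝ) : ℂ) * u₁h t p := by
    rw [absD_sq, hp2]
    unfold mulX mulY at hp1 ⊢
    push_cast at hp1 ⊢
    linear_combination (Complex.I * (p.1 : ℂ)) * hp1 -
      ((p.1 : ℂ) ^ 2 + (p.2 : ℂ) ^ 2) * u₁h t p * Complex.I_sq
  have e2 : ((p.1 : ℝ) : ℂ) * ωh t p = Complex.I * (((absD p ^ 2 : ℝ) : ℂ) * u₂h t p) := by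
    rw [absD_sq, hp2]
    unfold mulX mulY at hp1 ⊢
    push_cast at hp1 ⊢
    linear_combination (-(p.2 : ℂ)) * hp1
  have n1 := congrArg norm e1
  have n2 := congrArg norm e2
  simp only [norm_mul, Complex.norm_I, Complex.norm_real, Real.norm_eq_abs, one_mul, abs_pow,
    abs_of_nonneg (absD_nonneg p)] at n1 n2
  constructor <;> linarith

/-- The zero mode of `u₁` gains one derivative in `y` over the vorticity, and `u₂` has no zero mode. -/
theorem IsSolution.velocity_zeroMode (h : IsSolution ν T ω θ u₁ u₂ ωh θh u₁h u₂h) (ht : t ∈ Ioo 0 T) :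
    (∀ᵐ p ∂freqMeasure, |p.2| * ‖zeroPart (u₁h t) p‖ ≤ ‖ωh t p‖) ∧
      u₂h t =ᵐ[freqMeasure] nonzeroMode (u₂h t) := by
  have hv := h.velocity ht
  constructor
  · filter_upwards [hv, ae_snd_ne_zero] with p hp hp2
    unfold zeroPart
    split_ifs with h0
    · have h1 := hp.1
      rw [absD_sq, h0] at h1
      have h2 : 0 < |p.2| := by positivity
      have h3 : |p.2| * (|p.2| * ‖u₁h t p‖) = |p.2| * ‖ωh t p‖ := by
        rw [← h1, ← sq_abs p.2]; push_cast; ring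
      exact (mul_left_cancel₀ h2.ne' h3).le
    · simp
  · filter_upwards [hv, ae_snd_ne_zero] with p hp hp2
    unfold nonzeroMode
    split_ifs with h0
    · have h1 := hp.2
      rw [absD_sq, h0] at h1
      simp only [Int.cast_zero, abs_zero, zero_mul, mul_eq_zero, norm_eq_zero] at h1
      rcases h1 with h1 | h1
      · exact h1
      · exact absurd h1 (by positivity)
    · rfl

end

/-! ### The energy inequalities for the system -/

section
variable {φ : ℝ → ℝ} {μ δ₀ ν m m₁ t T h δ : ℝ} {ω θ u₁ u₂ : ℝ → ℝ → ℝ → ℝ}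
  {ωh θh u₁h u₂h : ℝ → ℤ × ℝ → ℂ}

theorem mulNorm_sq (a : ℤ × ℝ → ℝ) (F : ℤ × ℝ → ℂ) :
    mulNorm a F ^ 2 = ∫ p, (a p) ^ 2 * ‖F p‖ ^ 2 ∂freqMeasure :=
  Real.sq_sqrt (integral_nonneg fun _ => by positivity)

theorem mulNorm_wt (φ : ℝ → ℝ) (μ δ₀ ν m t : ℝ) (F : ℤ × ℝ → ℂ) :
    mulNorm (wt φ μ δ₀ ν m t) F = Real.sqrt (wtEnergy φ μ δ₀ ν m t F) := by
  unfold mulNorm wtEnergy; simp only [mul_pow]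

/-- A weight in `k` commutes with the transport by a shear flow. -/
theorem conv_zeroPart_mulX (χ : ℤ → ℝ) (V F : ℤ × ℝ → ℂ) (a : ℤ × ℝ) :
    conv (zeroPart V) (mulX fun p => (χ p.1 : ℂ) * F p) a = (χ a.1 : ℂ) * conv (zeroPart V) (mulX F) a := by
  unfold conv
  rw [mul_left_comm]
  congr 1
  rw [← integral_const_mul (χ a.1 : ℂ)]
  refine integral_congr_ae (Filter.Eventually.of_forall fun b => ?_)
  by_cases hb : b.1 = 0
  · have : (a - b).1 = a.1 := by rw [Prod.fst_sub, hb, sub_zero]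
    simp only [mulX, this]; ring
  · simp [zeroPart, hb]

/-- Transport by the zero mode of `u₁`, acting on the vorticity or on the temperature with any weight
in `k`. -/
theorem IsSolution.zero_transport_le (h : IsSolution ν T ω θ u₁ u₂ ωh θh u₁h u₂h) (ht : t ∈ Ioo 0 T)
    (hφ : IsProfile φ) (hμ : μ < 1) (hδ : 0 ≤ δ₀) (hm : 2 < m) {h' : ℝ} (hh : 0 < h') (hh1 : h' ≤ 1)
    (hν : ν = h' ^ 6) {G : ℤ × ℝ → ℂ} (hG : Rapid G)
    (hN : mulNorm (wt φ μ δ₀ ν m t) (ωh t) ≤ δ * h' ^ 2) :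
    |∫ p, wt φ μ δ₀ ν m t p ^ 2 *
      ((starRingEnd ℂ) (G p) * conv (zeroPart (u₁h t)) (mulX G) p).re ∂freqMeasure| ≤
      commConst μ m * δ * wtDissipation φ μ δ₀ ν m t G := by
  have hω := (h.regular_ω.fourier t ht).isInv
  have h1 := (h.regular_u₁.fourier t ht).isInv
  have hV : Rapid (Boussinesq.zeroPart (u₁h t)) := RapidOn.zeroPart h1.rapid
  have hz := Boussinesq.zero_transport_le (δ₀ := δ₀) hφ hμ hδ hm hh hh1 hν ht.1.le hω.rapid hV hG
    (h.velocity_zeroMode ht).1 (fun p hp => if_neg hp) h1.zeroMode.conj_neg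
  have hC : 0 ≤ commConst μ m := commConst_nonneg (by linarith)
  have hD := wtDissipation_nonneg φ μ δ₀ ν m t G
  rw [← mulNorm_wt] at hz
  have hh2 : 0 < h' ^ 2 := by positivity
  refine le_of_mul_le_mul_left (hz.trans ?_) hh2
  calc _ ≤ commConst μ m * (δ * h' ^ 2 * wtDissipation φ μ δ₀ ν m t G) := by gcongr
    _ = _ := by ring

theorem IsInv.congr_ae {f : ℝ → ℝ → ℝ} {F G : ℤ × ℝ → ℂ} (h : IsInv f F) (hG : Rapid G)
    (hFG : F =ᵐ[freqMeasure] G) : IsInv f G :=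
  ⟨hG, fun x y => by rw [h.eq, invFourier_congr hFG]⟩

/-- The energy inequality for the vorticity, with the buoyancy as a source term. Here and below `h'` is
`ν^{1/6}`, which makes all powers of the viscosity integral. -/
theorem IsSolution.vorticity_rate_le (h : IsSolution ν T ω θ u₁ u₂ ωh θh u₁h u₂h) (ht : t ∈ Ioo 0 T)
    (hφ : IsProfile φ) (hμ0 : 0 < μ) (hμ : μ < 1) (hδ : 0 < δ₀) (hδ' : δ₀ ≤ coer μ) (hm : 2 < m)
    {h' : ℝ} (hh : 0 < h') (hh1 : h' ≤ 1) (hν : ν = h' ^ 6) (hht : 1 ≤ h' * t)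
    (hN : mulNorm (wt φ μ δ₀ ν m t) (ωh t) ≤ δ * h' ^ 2) :
    ∃ E', HasDerivAt (fun s => mulNorm (wt φ μ δ₀ ν m s) (ωh s) ^ 2) E' t ∧
      E' ≤ -coer μ * wtDissipation φ μ δ₀ ν m t (ωh t) +
        2 * ((advConst μ δ₀ m + commConst μ m) * δ * wtDissipation φ μ δ₀ ν m t (ωh t)) +
        2 * ∫ p, wt φ μ δ₀ ν m t p ^ 2 * ((starRingEnd ℂ) (ωh t p) * mulX (θh t) p).re ∂freqMeasure := by
  have hν0 : 0 < ν := by rw [hν]; positivity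
  set R : ℝ → ℤ × ℝ → ℂ := fun t p =>
    (((-1 : ℝ) : ℂ) * conv (zeroPart (u₁h t)) (mulX (ωh t)) p +
      (((-1 : ℝ) : ℂ) * conv (nonzeroMode (u₁h t)) (mulX (ωh t)) p +
        ((-1 : ℝ) : ℂ) * conv (nonzeroMode (u₂h t)) (mulY (ωh t)) p)) + mulX (θh t) p with hR
  have hRr : ∀ a b : ℝ, 0 < a → b < T → RapidOn (Icc a b) R := fun a b ha hb => by
    have r1 := h.regular_ω.rapidOn ha hb
    have r2 := h.regular_θ.rapidOn ha hb
    have r3 := h.regular_u₁.rapidOn ha hb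
    have r4 := h.regular_u₂.rapidOn ha hb
    exact (((r3.zeroPart.conv r1.mulX).const_mul _).add
      (((r3.nonzeroMode.conv r1.mulX).const_mul _).add
        ((r4.nonzeroMode.conv r1.mulY).const_mul _))).add r2.mulX
  have heq : ∀ t ∈ Ioo 0 T,
      IsInv (fun x y => dt ω t x y + y * dx (ω t) x y - ν * lap (ω t) x y) (R t) := fun t ht => by
    have i1 := (h.regular_ω.fourier t ht).isInv
    have i2 := (h.regular_θ.fourier t ht).isInv
    have i3 := (h.regular_u₁.fourier t ht).isInv
    have i4 := (h.regular_u₂.fourier t ht).isInv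
    have i5 : IsInv (fun x y => u₁ t x y + (-1) * zeroMode (u₁ t) y) (nonzeroMode (u₁h t)) := by
      rw [nonzeroMode_eq]; exact i3.add (i3.zeroMode.const_mul (-1))
    have i7 : IsInv (fun _ y => zeroMode (u₁ t) y) (zeroPart (u₁h t)) := i3.zeroMode
    have i6 : IsInv (u₂ t) (nonzeroMode (u₂h t)) :=
      i4.congr_ae (RapidOn.nonzeroMode i4.rapid) (h.velocity_zeroMode ht).2
    have := (((i7.mul i1.dx).const_mul (-1)).add
      (((i5.mul i1.dx).const_mul (-1)).add ((i6.mul i1.dy).const_mul (-1)))).add i2.dx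
    convert this using 3 with x y
    have := h.vorticity t ht x y
    linarith
  obtain ⟨E', hd, hE⟩ := energy_rate_le (m := m) (χ := fun _ => 1) hφ hμ hδ.le hδ' hν0 h.regular_ω
    hRr heq (polyBdd_const 1) ht
  simp only [one_mul, Complex.ofReal_one] at hd hE
  simp only [mulNorm_sq]
  refine ⟨E', hd, hE.trans ?_⟩
  have i1 := (h.regular_ω.fourier t ht).isInv
  have i2 := (h.regular_θ.fourier t ht).isInv
  have i3 := (h.regular_u₁.fourier t ht).isInv
  have i4 := (h.regular_u₂.fourier t ht).isInv
  have c1 : Rapid (conv (zeroPart (u₁h t)) (mulX (ωh t))) :=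
    RapidOn.conv (RapidOn.zeroPart i3.rapid) (RapidOn.mulX i1.rapid)
  have hn1 : Rapid (nonzeroMode (u₁h t)) := RapidOn.nonzeroMode i3.rapid
  have hn2 : Rapid (nonzeroMode (u₂h t)) := RapidOn.nonzeroMode i4.rapid
  have c2 : Rapid (conv (nonzeroMode (u₁h t)) (mulX (ωh t))) := RapidOn.conv hn1 (RapidOn.mulX i1.rapid)
  have c3 : Rapid (conv (nonzeroMode (u₂h t)) (mulY (ωh t))) := RapidOn.conv hn2 (RapidOn.mulY i1.rapid)
  have c4 : Rapid (mulX (θh t)) := RapidOn.mulX i2.rapid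
  have hw2 := (polyBdd_wt (φ := φ) hφ hμ hδ.le hν0 m ht.1.le).pow 2
  have j1 := hw2.integrable_pair i1.rapid c1
  have j2 := hw2.integrable_pair i1.rapid c2
  have j3 := hw2.integrable_pair i1.rapid c3
  have j4 := hw2.integrable_pair i1.rapid c4
  have hzero := h.zero_transport_le ht hφ hμ hδ.le hm hh hh1 hν i1.rapid hN
  have hnz := nonzero_transport_le (t := t) hφ hμ0 hμ hδ hm hh hh1 hν hht i1.rapid hn1 hn2
    ((h.velocity ht).mono fun p hp => by
      unfold nonzeroMode; split_ifs
      · simp only [norm_zero, zero_mul]; positivity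
      · exact hp.1.le)
    ((h.velocity ht).mono fun p hp => by
      unfold nonzeroMode; split_ifs
      · simp only [norm_zero, zero_mul]; positivity
      · exact hp.2.le) (fun p hp => if_pos hp) (fun p hp => if_pos hp)
  rw [← mulNorm_wt] at hnz
  set X := wtDissipation φ μ δ₀ ν m t (ωh t) with hX
  have hX0 : 0 ≤ X := wtDissipation_nonneg _ _ _ _ _ _ _
  have hA0 : 0 ≤ advConst μ δ₀ m := advConst_nonneg hδ
  have hnz' := le_of_mul_le_mul_left (hnz.trans (show _ ≤ h' ^ 2 * (advConst μ δ₀ m * δ * X) by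
    calc _ ≤ advConst μ δ₀ m * (δ * h' ^ 2 * X) := by gcongr
      _ = _ := by ring)) (by positivity : 0 < h' ^ 2)
  have hsplit : ∫ p, wt φ μ δ₀ ν m t p ^ 2 * ((starRingEnd ℂ) (ωh t p) * R t p).re ∂freqMeasure =
      -(∫ p, wt φ μ δ₀ ν m t p ^ 2 *
        ((starRingEnd ℂ) (ωh t p) * conv (zeroPart (u₁h t)) (mulX (ωh t)) p).re ∂freqMeasure) -
      ((∫ p, wt φ μ δ₀ ν m t p ^ 2 *
        ((starRingEnd ℂ) (ωh t p) * conv (nonzeroMode (u₁h t)) (mulX (ωh t)) p).re ∂freqMeasure) +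
      ∫ p, wt φ μ δ₀ ν m t p ^ 2 *
        ((starRingEnd ℂ) (ωh t p) * conv (nonzeroMode (u₂h t)) (mulY (ωh t)) p).re ∂freqMeasure) +
      ∫ p, wt φ μ δ₀ ν m t p ^ 2 * ((starRingEnd ℂ) (ωh t p) * mulX (θh t) p).re ∂freqMeasure := by
    have s1 := integral_add (j1.neg.sub (j2.add j3)) j4
    have s2 := integral_sub j1.neg (j2.add j3)
    have s3 := integral_add j2 j3
    simp only [Pi.add_apply, Pi.sub_apply, Pi.neg_apply, integral_neg] at s1 s2 s3
    rw [← s3, ← s2, ← s1]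
    refine integral_congr_ae (Filter.Eventually.of_forall fun p => ?_)
    simp only [hR, mul_add, Complex.add_re, Complex.ofReal_neg,
      Complex.ofReal_one, neg_mul, one_mul, mul_neg, Complex.neg_re]
    ring
  rw [hsplit]
  have a1 := neg_le_of_abs_le hzero
  have a2 := neg_le_of_abs_le hnz'
  have e : (advConst μ δ₀ m + commConst μ m) * δ * X =
    advConst μ δ₀ m * δ * X + commConst μ m * δ * X := by ring
  rw [e]
  linarith

/-- The energy inequality for the temperature. -/
theorem IsSolution.temperature_rate_le (h : IsSolution ν T ω θ u₁ u₂ ωh θh u₁h u₂h) (ht : t ∈ Ioo 0 T)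
    (hφ : IsProfile φ) (hμ : μ < 1) (hδ : 0 ≤ δ₀) (hδ' : δ₀ ≤ coer μ) (hm : 2 < m)
    {h' : ℝ} (hh : 0 < h') (hh1 : h' ≤ 1) (hν : ν = h' ^ 6)
    (hN : mulNorm (wt φ μ δ₀ ν m t) (ωh t) ≤ δ * h' ^ 2)
    {χ : ℤ → ℝ} (hχ : PolyBdd fun p => χ p.1) :
    ∃ E', HasDerivAt (fun s => ∫ p, (χ p.1 * wt φ μ δ₀ ν m s p) ^ 2 * ‖θh s p‖ ^ 2 ∂freqMeasure) E' t ∧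
      E' ≤ -coer μ * wtDissipation φ μ δ₀ ν m t (fun p => (χ p.1 : ℂ) * θh t p) +
        2 * (commConst μ m * δ * wtDissipation φ μ δ₀ ν m t (fun p => (χ p.1 : ℂ) * θh t p)) := by
  have hν0 : 0 < ν := by rw [hν]; positivity
  set R : ℝ → ℤ × ℝ → ℂ := fun t p =>
    ((-1 : ℝ) : ℂ) * conv (zeroPart (u₁h t)) (mulX (θh t)) p with hR
  have hRr : ∀ a b : ℝ, 0 < a → b < T → RapidOn (Icc a b) R := fun a b ha hb =>
    ((h.regular_u₁.rapidOn ha hb).zeroPart.conv (h.regular_θ.rapidOn ha hb).mulX).const_mul _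
  have heq : ∀ t ∈ Ioo 0 T,
      IsInv (fun x y => dt θ t x y + y * dx (θ t) x y - ν * lap (θ t) x y) (R t) := fun t ht => by
    have i2 := (h.regular_θ.fourier t ht).isInv
    have i3 := (h.regular_u₁.fourier t ht).isInv
    have i7 : IsInv (fun _ y => zeroMode (u₁ t) y) (zeroPart (u₁h t)) := i3.zeroMode
    have := (i7.mul i2.dx).const_mul (-1)
    convert this using 3 with x y
    have := h.temperature t ht x y
    linarith
  obtain ⟨E', hd, hE⟩ := energy_rate_le (m := m) hφ hμ hδ hδ' hν0 h.regular_θ hRr heq hχ ht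
  refine ⟨E', hd, hE.trans ?_⟩
  have i2 := (h.regular_θ.fourier t ht).isInv
  have hz := h.zero_transport_le ht hφ hμ hδ hm hh hh1 hν (hχ.rapid i2.rapid) hN
  have e : ∫ p, (χ p.1 * wt φ μ δ₀ ν m t p) ^ 2 * ((starRingEnd ℂ) (θh t p) * R t p).re ∂freqMeasure =
      -∫ p, wt φ μ δ₀ ν m t p ^ 2 * ((starRingEnd ℂ) ((χ p.1 : ℂ) * θh t p) *
        conv (zeroPart (u₁h t)) (mulX fun p => (χ p.1 : ℂ) * θh t p) p).re ∂freqMeasure := by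
    rw [← integral_neg]
    refine integral_congr_ae (Filter.Eventually.of_forall fun p => ?_)
    simp only [hR, conv_zeroPart_mulX, map_mul, Complex.conj_ofReal]
    rw [show ((χ p.1 : ℂ) * (starRingEnd ℂ) (θh t p) * ((χ p.1 : ℂ) *
        conv (zeroPart (u₁h t)) (mulX (θh t)) p)) = ((χ p.1 ^ 2 : ℝ) : ℂ) *
        ((starRingEnd ℂ) (θh t p) * conv (zeroPart (u₁h t)) (mulX (θh t)) p) by push_cast; ring,
      Complex.re_ofReal_mul, mul_left_comm ((starRingEnd ℂ) (θh t p)), Complex.re_ofReal_mul]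
    ring
  rw [e]
  have a1 := neg_le_of_abs_le hz
  linarith

/-- Enhanced dissipation pays for the buoyancy, which loses a derivative in `x` and the factor
`ν^{-1/3}`. -/
theorem buoyancy_le (hφ : IsProfile φ) (hμ : μ < 1) (hδ : 0 ≤ δ₀) (ht : 0 ≤ t) {h : ℝ} (hh : 0 < h)
    (hν : ν = h ^ 6) {F G : ℤ × ℝ → ℂ} (hF : Rapid F) (hG : Rapid G) {χ : ℤ → ℝ}
    (hχ : PolyBdd fun p => χ p.1) (hχ1 : ∀ p : ℤ × ℝ, p.1 ≠ 0 → absDxThird p ≤ χ p.1) {c : ℝ} (hc : 0 < c) :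
    2 * ∫ p, wt φ μ δ₀ ν m t p ^ 2 * ((starRingEnd ℂ) (F p) * mulX G p).re ∂freqMeasure ≤
      c / 4 * wtDissipation φ μ δ₀ ν m t F +
        4 / c * (h ^ 4)⁻¹ * wtDissipation φ μ δ₀ ν m t (fun p => (χ p.1 : ℂ) * G p) := by
  have hν0 : 0 < ν := by rw [hν]; positivity
  have hwt := polyBdd_wt (δ₀ := δ₀) hφ hμ hδ hν0 m ht
  have hdwt := (polyBdd_dis hμ hν0 t).mul hwt
  have i1 := (hwt.pow 2).integrable_pair hF (RapidOn.mulX hG : Rapid (mulX G))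
  have i2 := hdwt.integrable_sq hF
  have i3 := hdwt.integrable_sq (hχ.rapid hG)
  unfold wtDissipation
  rw [← integral_const_mul, ← integral_const_mul, ← integral_const_mul,
    ← integral_add (i2.const_mul _) (i3.const_mul _)]
  refine integral_mono (i1.const_mul 2) ((i2.const_mul _).add (i3.const_mul _)) fun p => ?_
  dsimp only [Pi.add_apply]
  have hw := wt_nonneg φ μ δ₀ ν m t p
  have hd := dis_nonneg μ ν t p
  have hre : ((starRingEnd ℂ) (F p) * mulX G p).re ≤ ‖F p‖ * (|(p.1 : ℝ)| * ‖G p‖) := by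
    refine (Complex.re_le_norm _).trans_eq ?_
    simp only [norm_mul, RCLike.norm_conj, mulX, Complex.norm_I, Complex.norm_real,
      Real.norm_eq_abs, one_mul]
  rw [norm_mul, Complex.norm_real, Real.norm_eq_abs]
  by_cases hp : p.1 = 0
  · rw [hp] at hre
    simp only [Int.cast_zero, abs_zero, zero_mul, mul_zero] at hre
    have : wt φ μ δ₀ ν m t p ^ 2 * ((starRingEnd ℂ) (F p) * mulX G p).re ≤ 0 :=
      mul_nonpos_of_nonneg_of_nonpos (sq_nonneg _) hre
    have : 0 ≤ c / 4 * (dis μ ν t p * wt φ μ δ₀ ν m t p * ‖F p‖) ^ 2 +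
      4 / c * (h ^ 4)⁻¹ * (dis μ ν t p * wt φ μ δ₀ ν m t p * (|χ p.1| * ‖G p‖)) ^ 2 := by positivity
    linarith
  have hκ := absDxThird_nonneg p
  have hχp := (hχ1 p hp).trans (le_abs_self _)
  have he := enhanced_le_dis (μ := μ) hh hν t p
  set u := dis μ ν t p * wt φ μ δ₀ ν m t p * ‖F p‖ with hu
  set v := dis μ ν t p * wt φ μ δ₀ ν m t p * (|χ p.1| * ‖G p‖) with hv
  have huv : wt φ μ δ₀ ν m t p ^ 2 * ((starRingEnd ℂ) (F p) * mulX G p).re ≤ (h ^ 2)⁻¹ * (u * v) := by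
    rw [← div_eq_inv_mul, le_div_iff₀ (by positivity)]
    calc wt φ μ δ₀ ν m t p ^ 2 * ((starRingEnd ℂ) (F p) * mulX G p).re * h ^ 2
        ≤ wt φ μ δ₀ ν m t p ^ 2 * (‖F p‖ * (|(p.1 : ℝ)| * ‖G p‖)) * h ^ 2 := by gcongr
      _ = (h * absDxThird p) * (h * absDxThird p) * absDxThird p *
          (wt φ μ δ₀ ν m t p ^ 2 * ‖F p‖ * ‖G p‖) := by rw [← absDxThird_pow_three]; ring
      _ ≤ dis μ ν t p * dis μ ν t p * |χ p.1| * (wt φ μ δ₀ ν m t p ^ 2 * ‖F p‖ * ‖G p‖) := by gcongr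
      _ = u * v := by rw [hu, hv]; ring
  have hsq : 2 * ((h ^ 2)⁻¹ * (u * v)) ≤ c / 4 * u ^ 2 + 4 / c * (h ^ 4)⁻¹ * v ^ 2 := by
    have : c / 4 * u ^ 2 + 4 / c * (h ^ 4)⁻¹ * v ^ 2 - 2 * ((h ^ 2)⁻¹ * (u * v)) =
        c / 4 * (u - 4 / c * (h ^ 2)⁻¹ * v) ^ 2 := by field_simp; ring
    have : 0 ≤ c / 4 * (u - 4 / c * (h ^ 2)⁻¹ * v) ^ 2 := by positivity
    linarith
  linarith

end

/-! ### The dissipation functionals -/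

section
variable {φ : ℝ → ℝ} {μ δ₀ ν m m₁ t T δ : ℝ} {ω θ u₁ u₂ : ℝ → ℝ → ℝ → ℝ}
  {ωh θh u₁h u₂h : ℝ → ℤ × ℝ → ℂ}

theorem polyBdd_of_sq_le {β : ℤ × ℝ → ℝ} (hβ : Measurable β) {C : ℝ} (h : ∀ p, β p ^ 2 ≤ C * bracket p) :
    PolyBdd β := by
  refine ⟨hβ, 1 + C, 1, fun p => ?_⟩
  have h1 := h p
  have h2 := one_le_bracket p
  rw [pow_one, ← sq_abs] at *
  nlinarith [sq_nonneg (|β p| - 1), abs_nonneg (β p)]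

theorem polyBdd_absD : PolyBdd absD :=
  polyBdd_of_sq_le (C := 1) measurable_absD fun p => by rw [absD_sq]; unfold bracket; linarith

theorem polyBdd_absDxThird : PolyBdd absDxThird :=
  polyBdd_of_sq_le (C := 1) measurable_absDxThird fun p => by
    rw [one_mul]; exact absDxThird_sq_le p

theorem polyBdd_damping : PolyBdd fun p => |(p.1 : ℝ)| / absD p :=
  polyBdd_of_sq_le (C := 1) (measurable_fst_cast.abs.div measurable_absD) fun p => by
    rw [div_pow, sq_abs, one_mul]
    exact (sq_div_absD_le_one p).trans (one_le_bracket p)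

theorem polyBdd_sqrt_Upsilon (hμ : μ < 1) (t : ℝ) : PolyBdd fun p => Real.sqrt (Upsilon μ t p) :=
  polyBdd_of_sq_le (C := echoSum μ) (measurable_Upsilon hμ t).sqrt fun p => by
    rw [Real.sq_sqrt (Upsilon_nonneg μ t p)]
    exact (Upsilon_le hμ t p).trans (le_mul_of_one_le_right (echoSum_nonneg μ) (one_le_bracket p))

theorem wtDissipation_eq (hφ : IsProfile φ) (hμ : μ < 1) (hδ : 0 ≤ δ₀) (hν : 0 < ν) (ht : 0 ≤ t)
    {F : ℤ × ℝ → ℂ} (hF : Rapid F) :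
    wtDissipation φ μ δ₀ ν m t F =
      ν * (∫ p, (absD p * wt φ μ δ₀ ν m t p * ‖F p‖) ^ 2 ∂freqMeasure) +
      ν ^ (1 / 3 : ℝ) * (∫ p, (absDxThird p * wt φ μ δ₀ ν m t p * ‖F p‖) ^ 2 ∂freqMeasure) +
      (∫ p, (|(p.1 : ℝ)| / absD p * wt φ μ δ₀ ν m t p * ‖F p‖) ^ 2 ∂freqMeasure) +
      ∫ p, (Real.sqrt (Upsilon μ t p) * wt φ μ δ₀ ν m t p * ‖F p‖) ^ 2 ∂freqMeasure := by
  have hwt := polyBdd_wt (δ₀ := δ₀) hφ hμ hδ hν m ht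
  have i1 := ((polyBdd_absD.mul hwt).integrable_sq hF).const_mul ν
  have i2 := ((polyBdd_absDxThird.mul hwt).integrable_sq hF).const_mul (ν ^ (1 / 3 : ℝ))
  have i3 := (polyBdd_damping.mul hwt).integrable_sq hF
  have i4 := ((polyBdd_sqrt_Upsilon hμ t).mul hwt).integrable_sq hF
  have s1 := integral_add ((i1.add i2).add i3) i4
  have s2 := integral_add (i1.add i2) i3
  have s3 := integral_add i1 i2
  simp only [Pi.add_apply, integral_const_mul] at s1 s2 s3
  rw [← s3, ← s2, ← s1]
  unfold wtDissipation
  refine integral_congr_ae (Filter.Eventually.of_forall fun p => ?_)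
  simp only [mul_pow, dis_sq hν, div_pow, sq_abs, Real.sq_sqrt (Upsilon_nonneg μ t p), dissip]
  ring

/-- As `|D| |û₂| = |k| |D|⁻¹ |ω̂|`, the third term of `𝓒𝓚(ω)` is the part of the dissipation that comes
from inviscid damping. -/
theorem IsSolution.CKω_eq (h : IsSolution ν T ω θ u₁ u₂ ωh θh u₁h u₂h) (ht : t ∈ Ioo 0 T)
    (hφ : IsProfile φ) (hμ : μ < 1) (hδ : 0 ≤ δ₀) (hν : 0 < ν) :
    CKω φ μ δ₀ ν m t (ωh t) (u₂h t) = δ₀ / 2 * wtDissipation φ μ δ₀ ν m t (ωh t) := by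
  have hω := (h.regular_ω.fourier t ht).isInv
  rw [wtDissipation_eq hφ hμ hδ hν ht.1.le hω.rapid]
  unfold CKω
  simp only [mulNorm_sq, ← mul_pow]
  have e : ∫ p, (absD p * wt φ μ δ₀ ν m t p * ‖nonzeroMode (u₂h t) p‖) ^ 2 ∂freqMeasure =
      ∫ p, (|(p.1 : ℝ)| / absD p * wt φ μ δ₀ ν m t p * ‖ωh t p‖) ^ 2 ∂freqMeasure := by
    refine integral_congr_ae ((h.velocity ht).mono fun p hp => ?_)
    dsimp only
    by_cases h0 : p.1 = 0
    · simp [nonzeroMode, h0]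
    have hD := one_le_absD h0
    have h2 : absD p * ‖u₂h t p‖ = |(p.1 : ℝ)| / absD p * ‖ωh t p‖ := by
      rw [div_mul_eq_mul_div, eq_div_iff (by positivity), ← hp.2]; ring
    rw [show nonzeroMode (u₂h t) p = u₂h t p from if_neg h0]
    congr 1
    linear_combination wt φ μ δ₀ ν m t p * h2
  rw [e]

theorem CKθ_le (hφ : IsProfile φ) (hμ : μ < 1) (hδ : 0 ≤ δ₀) (hν : 0 < ν) (ht : 0 ≤ t)
    {G H : ℤ × ℝ → ℂ} (hH : Rapid H) (hGH : ∀ p, ‖H p‖ = angX p ^ m₁ * ‖G p‖) :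
    CKθ φ μ δ₀ ν m m₁ t G ≤ δ₀ / 2 * wtDissipation φ μ δ₀ ν m t H := by
  rw [wtDissipation_eq hφ hμ hδ hν ht hH]
  unfold CKθ wtX
  simp only [mulNorm_sq, hGH]
  have e : ∀ β : ℤ × ℝ → ℝ, ∫ p, (β p * (angX p ^ m₁ * wt φ μ δ₀ ν m t p)) ^ 2 * ‖G p‖ ^ 2 ∂freqMeasure =
      ∫ p, (β p * wt φ μ δ₀ ν m t p * (angX p ^ m₁ * ‖G p‖)) ^ 2 ∂freqMeasure := fun β => by
    congr 1; ext p; ring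
  rw [e, e]
  have n1 : 0 ≤ ∫ p, (|(p.1 : ℝ)| / absD p * wt φ μ δ₀ ν m t p * (angX p ^ m₁ * ‖G p‖)) ^ 2 ∂freqMeasure :=
    integral_nonneg fun _ => sq_nonneg _
  have n2 : 0 ≤ ∫ p, (Real.sqrt (Upsilon μ t p) * wt φ μ δ₀ ν m t p *
      (angX p ^ m₁ * ‖G p‖)) ^ 2 ∂freqMeasure := integral_nonneg fun _ => sq_nonneg _
  exact mul_le_mul_of_nonneg_left (by linarith) (by positivity)

/-! ### Conclusion -/

theorem one_le_angX (p : ℤ × ℝ) : 1 ≤ angX p := by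
  unfold angX; rw [Real.one_le_sqrt]; nlinarith [sq_nonneg (p.1 : ℝ)]

theorem polyBdd_angX_rpow (m₁ : ℝ) : PolyBdd fun p => angX p ^ m₁ := by
  refine ⟨measurable_angX.pow_const _, 1, ⌈m₁⌉₊, fun p => ?_⟩
  have h1 := one_le_angX p
  rw [abs_of_pos (by positivity), one_mul]
  calc angX p ^ m₁ ≤ angX p ^ (⌈m₁⌉₊ : ℝ) := Real.rpow_le_rpow_of_exponent_le h1 (Nat.le_ceil m₁)
    _ = angX p ^ ⌈m₁⌉₊ := Real.rpow_natCast _ _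
    _ ≤ _ := by
      gcongr
      unfold angX bracket
      rw [Real.sqrt_le_left (by positivity)]
      nlinarith [sq_nonneg (p.1 : ℝ), sq_nonneg p.2]

theorem absDxThird_le_angX_rpow (hm₁ : 1 ≤ m₁) (p : ℤ × ℝ) : absDxThird p ≤ angX p ^ m₁ := by
  have h1 := one_le_angX p
  have h2 : |(p.1 : ℝ)| ≤ angX p := by
    apply Real.le_sqrt_of_sq_le; rw [sq_abs]; linarith
  calc absDxThird p ≤ angX p ^ (1 / 3 : ℝ) := by
        unfold absDxThird; gcongr
    _ ≤ angX p ^ m₁ := Real.rpow_le_rpow_of_exponent_le h1 (by linarith)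

/-- The energy inequality for the vorticity together with `G = sel θ`, the temperature or its nonzero
modes; `χ(k)` is the corresponding weight. -/
theorem IsSolution.energy_le (h : IsSolution ν T ω θ u₁ u₂ ωh θh u₁h u₂h) (ht : t ∈ Ioo 0 T)
    (hφ : IsProfile φ) (hμ0 : 0 < μ) (hμ : μ < 1) (hδ : 0 < δ₀) (hδ' : δ₀ ≤ coer μ) (hm : 2 < m)
    (hν0 : 0 < ν) (hν1 : ν ≤ 1) (hνt : ν ^ (-(1 / 6) : ℝ) ≤ t)
    (hN : mulNorm (wt φ μ δ₀ ν m t) (ωh t) ≤ δ * ν ^ (1 / 3 : ℝ))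
    (hδs : (advConst μ δ₀ m + commConst μ m) * δ ≤ coer μ / 16)
    (hδs' : commConst μ m * δ ≤ coer μ / 16)
    {K : ℝ} (hK : 16 / coer μ ^ 2 ≤ K) {sel : (ℤ × ℝ → ℂ) → ℤ × ℝ → ℂ} {χ : ℤ → ℝ}
    (hχ : PolyBdd fun p => χ p.1) (hχ1 : ∀ p : ℤ × ℝ, p.1 ≠ 0 → absDxThird p ≤ χ p.1)
    (hsel : ∀ F p, (χ p.1 : ℂ) * F p = ((angX p ^ m₁ : ℝ) : ℂ) * sel F p) :
    ∃ E', HasDerivAt (fun s => energy φ μ δ₀ ν m m₁ K s (ωh s) (sel (θh s))) E' t ∧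
      E' + CKω φ μ δ₀ ν m t (ωh t) (u₂h t) +
        K * ν ^ (-(2 / 3) : ℝ) * CKθ φ μ δ₀ ν m m₁ t (sel (θh t)) ≤ 0 := by
  obtain ⟨h', hh, hν⟩ : ∃ h' : ℝ, 0 < h' ∧ ν = h' ^ 6 := by
    refine ⟨ν ^ (1 / 6 : ℝ), by positivity, ?_⟩
    rw [← Real.rpow_natCast, ← Real.rpow_mul hν0.le]; norm_num
  have hh1 : h' ≤ 1 := by
    by_contra hn
    have := one_lt_pow₀ (not_le.1 hn) (show 6 ≠ 0 by norm_num)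
    linarith
  have hht : 1 ≤ h' * t := by
    have e : ν ^ (-(1 / 6) : ℝ) = h'⁻¹ := by
      rw [hν, ← Real.rpow_natCast, ← Real.rpow_mul hh.le, ← Real.rpow_neg_one]; norm_num
    rw [e] at hνt
    calc 1 = h' * h'⁻¹ := (mul_inv_cancel₀ hh.ne').symm
      _ ≤ _ := by gcongr
  have e4 : ν ^ (-(2 / 3) : ℝ) = (h' ^ 4)⁻¹ := by
    rw [hν, ← Real.rpow_natCast, ← Real.rpow_natCast, ← Real.rpow_mul hh.le, ← Real.rpow_neg hh.le]
    norm_num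
  rw [rpow_third_eq hh hν] at hN
  have hω := (h.regular_ω.fourier t ht).isInv
  have hθ := (h.regular_θ.fourier t ht).isInv
  obtain ⟨E₁, hd₁, hE₁⟩ := h.vorticity_rate_le ht hφ hμ0 hμ hδ hδ' hm hh hh1 hν hht hN
  obtain ⟨E₂, hd₂, hE₂⟩ := h.temperature_rate_le ht hφ hμ hδ.le hδ' hm hh hh1 hν hN hχ
  have hc := coer_pos μ
  have hb := buoyancy_le (m := m) hφ hμ hδ.le ht.1.le hh hν hω.rapid hθ.rapid hχ hχ1 hc
  have hnorm : ∀ F p, |χ p.1| * ‖F p‖ = angX p ^ m₁ * ‖sel F p‖ := fun F p => by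
    have := congrArg norm (hsel F p)
    have hA := one_le_angX p
    rwa [norm_mul, norm_mul, Complex.norm_real, Complex.norm_real, Real.norm_eq_abs,
      Real.norm_of_nonneg (by positivity)] at this
  have hCK := CKθ_le (m := m) hφ hμ hδ.le hν0 ht.1.le (hχ.rapid hθ.rapid) (m₁ := m₁) (G := sel (θh t))
    fun p => by rw [norm_mul, Complex.norm_real, Real.norm_eq_abs, hnorm]
  have hen : ∀ s, mulNorm (wtX φ μ δ₀ ν m m₁ s) (sel (θh s)) ^ 2 =
      ∫ p, (χ p.1 * wt φ μ δ₀ ν m s p) ^ 2 * ‖θh s p‖ ^ 2 ∂freqMeasure := fun s => by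
    rw [mulNorm_sq]
    congr 1; ext p
    have := hnorm (θh s) p
    unfold wtX
    calc _ = wt φ μ δ₀ ν m s p ^ 2 * (angX p ^ m₁ * ‖sel (θh s) p‖) ^ 2 := by ring
      _ = wt φ μ δ₀ ν m s p ^ 2 * (|χ p.1| * ‖θh s p‖) ^ 2 := by rw [this]
      _ = _ := by rw [mul_pow, sq_abs]; ring
  rw [h.CKω_eq ht hφ hμ hδ.le hν0, e4]
  unfold energy
  simp only [hen, e4]
  refine ⟨_, hd₁.add (hd₂.const_mul _), ?_⟩
  have hX := wtDissipation_nonneg φ μ δ₀ ν m t (ωh t)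
  have hY := wtDissipation_nonneg φ μ δ₀ ν m t (fun p => (χ p.1 : ℂ) * θh t p)
  set X := wtDissipation φ μ δ₀ ν m t (ωh t)
  set Y := wtDissipation φ μ δ₀ ν m t (fun p => (χ p.1 : ℂ) * θh t p)
  set c := coer μ
  have hK0 : 0 ≤ K := le_trans (by positivity) hK
  have hr : 0 < (h' ^ 4)⁻¹ := by positivity
  have b1 : (advConst μ δ₀ m + commConst μ m) * δ * X ≤ c / 16 * X := by gcongr
  have b2 : commConst μ m * δ * Y ≤ c / 16 * Y := by gcongr
  have b3 : δ₀ / 2 * X ≤ c / 2 * X := by gcongr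
  have b4 : δ₀ / 2 * Y ≤ c / 2 * Y := by gcongr
  have f1 : E₁ + δ₀ / 2 * X ≤ 4 / c * (h' ^ 4)⁻¹ * Y := by
    have : 0 ≤ c * X := by positivity
    linarith
  have f2 : E₂ + CKθ φ μ δ₀ ν m m₁ t (sel (θh t)) ≤ -(3 * c / 8) * Y := by linarith
  have f3 : 4 / c ≤ K * (3 * c / 8) := by
    calc 4 / c ≤ 6 / c := by gcongr; norm_num
      _ = 16 / c ^ 2 * (3 * c / 8) := by field_simp; norm_num
      _ ≤ _ := by gcongr
  calc E₁ + K * (h' ^ 4)⁻¹ * E₂ + δ₀ / 2 * X + K * (h' ^ 4)⁻¹ * CKθ φ μ δ₀ ν m m₁ t (sel (θh t))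
      = (E₁ + δ₀ / 2 * X) + K * (h' ^ 4)⁻¹ * (E₂ + CKθ φ μ δ₀ ν m m₁ t (sel (θh t))) := by ring
    _ ≤ 4 / c * (h' ^ 4)⁻¹ * Y + K * (h' ^ 4)⁻¹ * (-(3 * c / 8) * Y) := by gcongr
    _ = (4 / c - K * (3 * c / 8)) * ((h' ^ 4)⁻¹ * Y) := by ring
    _ ≤ 0 := mul_nonpos_of_nonpos_of_nonneg (by linarith) (by positivity)

end
end Boussinesq

theorem proposition3p2 (φ : ℝ → ℝ) (hφ : Boussinesq.IsProfile φ)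
    (μ : ℝ) (hμ : 2 / 3 ≤ μ) (hμ' : μ < 1) :
    ∃ δmax : ℝ, 0 < δmax ∧ ∀ δ₀ : ℝ, 0 < δ₀ → δ₀ ≤ δmax →
    ∀ m m₁ : ℝ, 2 < m → 1 ≤ m₁ →
    ∃ δ : ℝ, 0 < δ ∧ ∃ K₀ : ℝ, 0 < K₀ ∧ ∀ K : ℝ, K₀ ≤ K →
    ∀ ν : ℝ, 0 < ν → ν ≤ 1 →
    ∀ (T : ℝ) (ω θ u₁ u₂ : ℝ → ℝ → ℝ → ℝ) (ωh θh u₁h u₂h : ℝ → ℤ × ℝ → ℂ),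
    Boussinesq.IsSolution ν T ω θ u₁ u₂ ωh θh u₁h u₂h →
    ∀ t : ℝ, ν ^ (-(1 / 6) : ℝ) ≤ t → t < T →
    Boussinesq.mulNorm (Boussinesq.wt φ μ δ₀ ν m t) (ωh t) ≤ δ * ν ^ (1 / 3 : ℝ) →
    Boussinesq.mulNorm (Boussinesq.wtX φ μ δ₀ ν m m₁ t) (θh t) ≤ δ * ν ^ (2 / 3 : ℝ) →
    (∃ E' : ℝ,
      HasDerivAt (fun s => Boussinesq.energy φ μ δ₀ ν m m₁ K s
        (ωh s) (Boussinesq.nonzeroMode (θh s))) E' t ∧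
      E' + Boussinesq.CKω φ μ δ₀ ν m t (ωh t) (u₂h t)
        + K * ν ^ (-(2 / 3) : ℝ) *
          Boussinesq.CKθ φ μ δ₀ ν m m₁ t (Boussinesq.nonzeroMode (θh t)) ≤ 0) ∧
    (∃ E' : ℝ,
      HasDerivAt (fun s => Boussinesq.energy φ μ δ₀ ν m m₁ K s (ωh s) (θh s)) E' t ∧
      E' + Boussinesq.CKω φ μ δ₀ ν m t (ωh t) (u₂h t)
        + K * ν ^ (-(2 / 3) : ℝ) * Boussinesq.CKθ φ μ δ₀ ν m m₁ t (θh t) ≤ 0) := by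
  have hc := Boussinesq.coer_pos μ
  refine ⟨Boussinesq.coer μ, hc, fun δ₀ hδ₀ hδ₀' m m₁ hm hm₁ => ?_⟩
  have hA : 0 ≤ Boussinesq.advConst μ δ₀ m := Boussinesq.advConst_nonneg hδ₀
  have hC : 0 ≤ Boussinesq.commConst μ m := Boussinesq.commConst_nonneg (by linarith)
  set A := Boussinesq.advConst μ δ₀ m
  set C := Boussinesq.commConst μ m
  set c := Boussinesq.coer μ
  -- with this `δ` the interactions cost at most a fixed fraction of the dissipation
  set δ := c / (16 * (A + C + 1)) with hδ
  have hδ0 : 0 < δ := by positivity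
  have hδs : (A + C) * δ ≤ c / 16 := by
    calc (A + C) * δ ≤ (A + C + 1) * δ :=
        mul_le_mul_of_nonneg_right (by linarith) hδ0.le
      _ = c / 16 := by rw [hδ]; field_simp
  have hδs' : C * δ ≤ c / 16 := 
    le_trans (mul_le_mul_of_nonneg_right (by linarith : C ≤ A + C) hδ0.le) hδs
  -- with this `K₀` the dissipation of `θ` absorbs the buoyancy
  refine ⟨δ, hδ0, 16 / c ^ 2, by positivity, fun K hK ν hν0 hν1 T ω θ u₁ u₂ ωh θh u₁h u₂h h t hνt htT
    hN _ => ?_⟩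
  have ht : t ∈ Ioo 0 T := ⟨lt_of_lt_of_le (by positivity) hνt, htT⟩
  have hang : ∀ p : ℤ × ℝ, Real.sqrt (1 + (p.1 : ℝ) ^ 2) = Boussinesq.angX p := fun _ => rfl
  have hang' := Boussinesq.polyBdd_angX_rpow m₁
  constructor
  · refine h.energy_le ht hφ (by linarith) hμ' hδ₀ hδ₀' hm hν0 hν1 hνt hN hδs hδs' hK
      (χ := fun k => if k = 0 then 0 else Real.sqrt (1 + (k : ℝ) ^ 2) ^ m₁)
      (sel := Boussinesq.nonzeroMode) ?_ ?_ ?_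
    · refine ⟨Boussinesq.measurable_of_fst fun k : ℤ => if k = 0 then (0 : ℝ) else
        Real.sqrt (1 + (k : ℝ) ^ 2) ^ m₁, hang'.bound.imp fun C hC => hC.imp fun j hj p => ?_⟩
      refine le_trans ?_ (hj p)
      split_ifs
      · rw [abs_zero]; exact abs_nonneg _
      · exact le_rfl
    · intro p hp
      rw [if_neg hp]
      exact Boussinesq.absDxThird_le_angX_rpow hm₁ p
    · intro F p
      unfold Boussinesq.nonzeroMode
      split_ifs
      · simp
      · rfl
  · exact h.energy_le ht hφ (by linarith) hμ' hδ₀ hδ₀' hm hν0 hν1 hνt hN hδs hδs' hK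
      (χ := fun k => Real.sqrt (1 + (k : ℝ) ^ 2) ^ m₁) (sel := fun F => F) hang'
      (fun p _ => Boussinesq.absDxThird_le_angX_rpow hm₁ p) fun F p => rfl
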